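/- Let $d\ge 1$, let $\mathbb T=\mathbb R/2\pi\mathbb Z$, and let $1<p\le \min\{2,\,1+\tfrac2d\}$. Consider the defocusing nonlinear Schrödinger equation $$ i\partial_t u+\Delta_{\mathbb R^d\times\mathbb T}u=|u|^{p-1}u,\qquad u:\mathbb R\times\mathbb R^d\times\mathbb T\to\mathbb C. $$ Here a (global) solution is a function $u\in C(\mathbb R;L^2(\mathbb R^d\times\mathbb T))\cap L^{p+1}_{\mathrm{loc}}(\mathbb R;L^{p+1}(\mathbb R^d\times\mathbb T))$ that satisfies the equation in the sense of distributions; in particular every solution in $C(\mathbb R;H^1(\mathbb R^d\times\mathbb T))$ is covered. Let $e^{it\Delta_{\mathbb R^d\times\mathbb T}}$ denote the free Schrödinger group on $L^2(\mathbb R^d\times\mathbb T)$, that is, the operator that multiplies the Fourier transform at frequency $(\xi,n)\in\mathbb R^d\times\mathbb Z$ by $e^{-it(|\xi|^2+n^2)}$. If $u$ is a solution that is not identically zero, then for every $h\in L^2(\mathbb R^d\times\mathbb T)$, $$ \bigl\|u(t)-e^{it\Delta_{\mathbb R^d\times\mathbb T}}h\bigr\|_{L^2(\mathbb R^d\times\mathbb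 T)}\nrightarrow 0\qquad\text{as } t\to\infty . $$ -/

import Mathlib

open MeasureTheory Filter Topology Set
open scoped FourierTransform ContDiff Laplacian

/-- The length `2π` of the torus `𝕋 = ℝ / 2πℤ` is positive. -/
instance factTwoPiPos : Fact (0 < 2 * Real.pi) := ⟨Real.two_pi_pos⟩

/-- The cylinder `ℝ^d × 𝕋` with `𝕋 = ℝ / 2πℤ`; it carries the product of Lebesgue measure on `ℝ^d`
and the measure of total mass `2π` on `𝕋`. -/
abbrev Cylinder (d : ℕ) : Type := EuclideanSpace ℝ (Fin d) × AddCircle (2 * Real.pi)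

/-- The complex Hilbert space `L²(ℝ^d)`. -/
abbrev L2Euclidean (d : ℕ) : Type := Lp ℂ 2 (volume : Measure (EuclideanSpace ℝ (Fin d)))

/-- The complex Hilbert space `L²(ℝ^d × 𝕋)`. -/
abbrev L2Cylinder (d : ℕ) : Type := Lp ℂ 2 (volume : Measure (Cylinder d))

/-! ### The free Schrödinger group -/

theorem memLp_schrodingerSymbol_mul {d : ℕ} (t : ℝ) (f : L2Euclidean d) :
    MemLp (fun ξ : EuclideanSpace ℝ (Fin d) =>
      Complex.exp ((-(t * (2 * Real.pi * ‖ξ‖) ^ 2) : ℝ) * Complex.I) * f ξ) 2 volume := by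
  have hm : AEStronglyMeasurable (fun ξ : EuclideanSpace ℝ (Fin d) =>
      Complex.exp ((-(t * (2 * Real.pi * ‖ξ‖) ^ 2) : ℝ) * Complex.I)) volume :=
    Continuous.aestronglyMeasurable (by fun_prop)
  refine (Lp.memLp f).of_le (hm.mul (Lp.memLp f).1) (Eventually.of_forall fun ξ => ?_)
  rw [norm_mul, Complex.norm_exp_ofReal_mul_I, one_mul]

/-- The operator `e^{itΔ}` on `L²(ℝ^d)`. The Fourier transform is `∫ e^{-2πi y·ξ} f(y) dy`, so that
`e^{itΔ}` is the Fourier multiplier with symbol `e^{-it|2πξ|²}`. -/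
noncomputable def euclideanPropagator (d : ℕ) (t : ℝ) (f : L2Euclidean d) : L2Euclidean d :=
  𝓕⁻ ((memLp_schrodingerSymbol_mul t (𝓕 f)).toLp _ : L2Euclidean d)

/-- The function `f(y) e^{inx} / √(2π)` on the cylinder. -/
noncomputable def modeFun {d : ℕ} (n : ℤ) (f : EuclideanSpace ℝ (Fin d) → ℂ) (z : Cylinder d) : ℂ :=
  f z.1 * (fourier n z.2 / (Real.sqrt (2 * Real.pi) : ℂ))

theorem memLp_modeFun {d : ℕ} (n : ℤ) (f : L2Euclidean d) :
    MemLp (modeFun n f) 2 (volume : Measure (Cylinder d)) := by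
  have h1 : MemLp (fun z : Cylinder d => f z.1) 2 volume := (Lp.memLp f).comp_fst volume
  have hm : AEStronglyMeasurable (fun z : Cylinder d =>
      fourier n z.2 / (Real.sqrt (2 * Real.pi) : ℂ)) volume :=
    Continuous.aestronglyMeasurable (by fun_prop)
  refine h1.of_le_mul (c := 1 / Real.sqrt (2 * Real.pi)) (h1.1.mul hm)
    (Eventually.of_forall fun z => ?_)
  simp only [modeFun, norm_mul, norm_div, Complex.norm_real, fourier_apply, Circle.norm_coe,
    Real.norm_eq_abs, abs_of_nonneg (Real.sqrt_nonneg _)]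
  rw [mul_comm]

theorem inner_modeFun {d : ℕ} (n m : ℤ) (f g : L2Euclidean d) :
    inner ℂ ((memLp_modeFun n f).toLp _ : L2Cylinder d) ((memLp_modeFun m g).toLp _)
      = if n = m then inner ℂ f g else 0 := by
  have hs : (Real.sqrt (2 * Real.pi) : ℂ) * (Real.sqrt (2 * Real.pi) : ℂ) = (2 * Real.pi : ℝ) := by
    rw [← Complex.ofReal_mul, Real.mul_self_sqrt Real.two_pi_pos.le]
  have hpi : ((2 * Real.pi : ℝ) : ℂ) ≠ 0 := by exact_mod_cast Real.two_pi_pos.ne'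
  have h1 : inner ℂ ((memLp_modeFun n f).toLp _ : L2Cylinder d) ((memLp_modeFun m g).toLp _)
      = ∫ z : Cylinder d, (inner ℂ (f z.1) (g z.1)) *
          (fourier (m - n) z.2 / ((2 * Real.pi : ℝ) : ℂ)) := by
    rw [L2.inner_def]
    refine integral_congr_ae ?_
    filter_upwards [(memLp_modeFun n f).coeFn_toLp, (memLp_modeFun m g).coeFn_toLp] with z hf hg
    rw [hf, hg]
    simp only [modeFun, RCLike.inner_apply, map_mul, map_div₀, Complex.conj_ofReal]
    rw [sub_eq_add_neg, fourier_add, fourier_neg, ← hs]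
    ring
  rw [h1, Measure.volume_eq_prod, integral_prod_mul (f := fun y => inner ℂ (f y) (g y))
    (g := fun x => fourier (m - n) x / ((2 * Real.pi : ℝ) : ℂ)), ← L2.inner_def]
  rw [integral_div]
  split_ifs with h
  · subst h
    have hone : ∫ x : AddCircle (2 * Real.pi), fourier (n - n) x = ((2 * Real.pi : ℝ) : ℂ) := by
      simp [measureReal_def, AddCircle.measure_univ, ENNReal.toReal_ofReal Real.pi_pos.le]
    rw [hone, div_self hpi, mul_one]
  · have h0 : ∫ x : AddCircle (2 * Real.pi), fourier (m - n) x = 0 := by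
      have hmn : m - n ≠ 0 := by omega
      exact integral_eq_zero_of_add_right_eq_neg (fourier_add_half_inv_index hmn Real.two_pi_pos)
    rw [h0]; simp

/-- The isometric embedding `f ↦ f(y) e^{inx} / √(2π)` of `L²(ℝ^d)` onto the `n`-th Fourier mode in
`L²(ℝ^d × 𝕋)`. -/
noncomputable def modeEmbedding (d : ℕ) (n : ℤ) : L2Euclidean d →ₗᵢ[ℂ] L2Cylinder d :=
  LinearMap.isometryOfInner
    { toFun := fun f => (memLp_modeFun n f).toLp _
      map_add' := fun f g => by
        rw [← MemLp.toLp_add]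
        refine MemLp.toLp_congr _ _ ?_
        have h := Measure.quasiMeasurePreserving_fst (μ := (volume :
          Measure (EuclideanSpace ℝ (Fin d)))) (ν := (volume :
          Measure (AddCircle (2 * Real.pi)))) |>.ae_eq (Lp.coeFn_add f g)
        filter_upwards [h] with z hz
        simp only [Function.comp_apply, Pi.add_apply] at hz
        simp only [modeFun, Pi.add_apply, hz, add_mul]
      map_smul' := fun c f => by
        rw [RingHom.id_apply, ← MemLp.toLp_const_smul]
        refine MemLp.toLp_congr _ _ ?_
        have h := Measure.quasiMeasurePreserving_fst (μ := (volume :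
          Measure (EuclideanSpace ℝ (Fin d)))) (ν := (volume :
          Measure (AddCircle (2 * Real.pi)))) |>.ae_eq (Lp.coeFn_smul c f)
        filter_upwards [h] with z hz
        simp only [Function.comp_apply, Pi.smul_apply, smul_eq_mul] at hz
        simp only [modeFun, Pi.smul_apply, hz, smul_eq_mul, mul_assoc] }
    (fun f g => by
      have h := inner_modeFun n n f g
      rw [if_pos rfl] at h
      exact h)

/-- The `n`-th Fourier coefficient `h ↦ (2π)^{-1/2} ∫_𝕋 h(·, x) e^{-inx} dx`, as the adjoint
of the embedding of the `n`-th mode. -/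
noncomputable def modeCoefficient (d : ℕ) (n : ℤ) : L2Cylinder d →L[ℂ] L2Euclidean d :=
  ContinuousLinearMap.adjoint (modeEmbedding d n).toContinuousLinearMap

/-- The operator `e^{itΔ}` on `L²(ℝ^d × 𝕋)`: with `h = ∑ₙ hₙ(y) e^{inx} / √(2π)`,
`e^{itΔ} h = ∑ₙ (e^{-itn²} e^{itΔ_y} hₙ)(y) e^{inx} / √(2π)`. -/
noncomputable def cylinderPropagator (d : ℕ) (t : ℝ) (h : L2Cylinder d) : L2Cylinder d :=
  ∑' n : ℤ, modeEmbedding d n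
    (Complex.exp ((-(t * (n : ℝ) ^ 2) : ℝ) * Complex.I) •
      euclideanPropagator d t (modeCoefficient d n h))

theorem norm_euclideanPropagator (d : ℕ) (t : ℝ) (f : L2Euclidean d) :
    ‖euclideanPropagator d t f‖ = ‖f‖ := by
  have h : ‖euclideanPropagator d t f‖ =
      ‖((memLp_schrodingerSymbol_mul t (𝓕 f)).toLp _ : L2Euclidean d)‖ :=
    (Lp.fourierTransformₗᵢ (EuclideanSpace ℝ (Fin d)) ℂ).symm.norm_map _
  rw [h, ← Lp.norm_fourier_eq f, Lp.norm_toLp, Lp.norm_def]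
  congr 1
  refine eLpNorm_congr_norm_ae (Eventually.of_forall fun ξ => ?_)
  rw [norm_mul, Complex.norm_exp_ofReal_mul_I, one_mul]

theorem orthogonalFamily_modeEmbedding (d : ℕ) :
    OrthogonalFamily ℂ (fun _ : ℤ => L2Euclidean d) (modeEmbedding d) := by
  intro n m hnm f g
  have h := inner_modeFun n m f g
  rw [if_neg hnm] at h
  exact h

/-- The series that defines `e^{itΔ} h` converges in `L²(ℝ^d × 𝕋)`. -/
theorem summable_cylinderPropagator (d : ℕ) (t : ℝ) (h : L2Cylinder d) :
    Summable fun n : ℤ => modeEmbedding d n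
      (Complex.exp ((-(t * (n : ℝ) ^ 2) : ℝ) * Complex.I) •
        euclideanPropagator d t (modeCoefficient d n h)) := by
  rw [(orthogonalFamily_modeEmbedding d).summable_iff_norm_sq_summable]
  have hn : ∀ n : ℤ, ‖Complex.exp ((-(t * (n : ℝ) ^ 2) : ℝ) * Complex.I) •
      euclideanPropagator d t (modeCoefficient d n h)‖ = ‖modeCoefficient d n h‖ := by
    intro n
    rw [norm_smul, Complex.norm_exp_ofReal_mul_I, one_mul, norm_euclideanPropagator]
  simp only [hn]
  refine summable_of_sum_le (c := ‖h‖ ^ 2) (fun n => sq_nonneg _) fun s => ?_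
  -- Bessel's inequality
  set v : L2Cylinder d := ∑ n ∈ s, modeEmbedding d n (modeCoefficient d n h) with hv
  have h1 : ‖v‖ ^ 2 = ∑ n ∈ s, ‖modeCoefficient d n h‖ ^ 2 :=
    (orthogonalFamily_modeEmbedding d).norm_sum (fun n => modeCoefficient d n h) s
  have h2 : inner ℂ v h = ((∑ n ∈ s, ‖modeCoefficient d n h‖ ^ 2 : ℝ) : ℂ) := by
    rw [hv, sum_inner]
    push_cast
    refine Finset.sum_congr rfl fun n _ => ?_
    have := ContinuousLinearMap.adjoint_inner_right (modeEmbedding d n).toContinuousLinearMap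
      (modeCoefficient d n h) h
    rw [LinearIsometry.coe_toContinuousLinearMap] at this
    rw [← this]
    exact inner_self_eq_norm_sq_to_K (𝕜 := ℂ) _
  rw [← h1] at h2 ⊢
  have h3 : ‖v‖ ^ 2 ≤ ‖v‖ * ‖h‖ := by
    have := norm_inner_le_norm (𝕜 := ℂ) v h
    rwa [h2, Complex.norm_real, Real.norm_of_nonneg (sq_nonneg _)] at this
  nlinarith [norm_nonneg v, norm_nonneg h, sq_nonneg (‖v‖ - ‖h‖)]

/-! ### Solutions of the nonlinear Schrödinger equation -/

/-- Test functions on the cylinder: compactly supported functions that are smooth, smoothness being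
tested on the universal cover `ℝ^d × ℝ`. -/
def IsTestFunction {d : ℕ} (ψ : Cylinder d → ℂ) : Prop :=
  HasCompactSupport ψ ∧
    ContDiff ℝ ∞ (fun q : EuclideanSpace ℝ (Fin d) × ℝ =>
      ψ (q.1, (q.2 : AddCircle (2 * Real.pi))))

/-- The Laplacian `Δ_y + ∂_x²` on the cylinder. -/
noncomputable def cylinderLaplacian {d : ℕ} (ψ : Cylinder d → ℂ) (z : Cylinder d) : ℂ :=
  (Δ (fun y : EuclideanSpace ℝ (Fin d) => ψ (y, z.2))) z.1 +
    iteratedDeriv 2 (fun s : ℝ => ψ (z.1, z.2 + (s : AddCircle (2 * Real.pi)))) 0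

/-- `u` is a global solution of the defocusing equation `i ∂_t u + Δ u = |u|^{p-1} u` on the cylinder:
it is continuous in time with values in `L²`, it lies in `L^{p+1}` locally in time, and it satisfies
the equation in the sense of distributions (written in the form integrated in time). -/
structure IsNLSSolution (d : ℕ) (p : ℝ) (u : ℝ → L2Cylinder d) : Prop where
  continuous : Continuous u
  locally_Lp : ∀ a b : ℝ, ∫⁻ t in Icc a b, ∫⁻ z : Cylinder d, ‖u t z‖ₑ ^ (p + 1) < ⊤
  equation : ∀ ψ : Cylinder d → ℂ, IsTestFunction ψ → ∀ a b : ℝ,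
    Complex.I * ((∫ z : Cylinder d, u b z * ψ z) - ∫ z : Cylinder d, u a z * ψ z) =
      ∫ t in a..b, ((∫ z : Cylinder d, ((‖u t z‖ ^ (p - 1) : ℝ) : ℂ) * u t z * ψ z) -
        ∫ z : Cylinder d, u t z * cylinderLaplacian ψ z)

/-! Suppose that u(t) is asymptotic to e^{itΔ}h in L². Along a free wave the nonlinearity decays
only like t^{-α} with α = d(p-1)/2 ≤ 1, which is not integrable. Its accumulated effect is therefore
unbounded unless a certain resonant average vanishes, and a positivity argument shows that this
average can vanish only for h = 0.

The decay is made visible by the lens transform v(t,ξ,x) = (4πt)^{d/2} e^{-4π²it|ξ|²} u(t,4πtξ,x),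
an isometry of L². It turns a free solution, up to o(1), into the profile Σ e^{-in²t} aₙ(ξ)
e^{inx}/√(2π), where aₙ is a constant multiple of the Fourier transform of the n-th mode of h
(`tendsto_cylinderLens_cylinderPropagator`). The profile no longer disperses and is 2π-periodic in
t. Pairing v with χ(ξ)e^{-inx} and multiplying by e^{in²t} gives an amplitude whose derivative is
(4πt)^{-α} times the nonlinear pairing, up to a unimodular factor, plus O(t^{-2})
(`IsNLSSolution.hasDerivAt_amplitude`). The amplitude is bounded by conservation of mass. Since p ≤
2, the nonlinear pairing is continuous on L², so v may be replaced there by the profile. As α ≤ 1,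
the resulting periodic function must have mean zero (`integral_eq_zero_of_bounded_of_hasDerivAt`).

Hence, for almost every ξ, the function F = Σ aₙ(ξ) e^{inx-in²τ}/√(2π) on the torus has |F|^{p-1}F
orthogonal to every wave e^{inx-in²τ}, thus to F itself, and ∫|F|^{p+1} = 0. This last pairing is
legitimate because Zygmund's estimate puts F in L⁴, hence |F|^{p-1}F in L². So every aₙ vanishes,
‖u(t)‖ → 0, and conservation of mass gives u = 0.

Conservation of mass (`IsNLSSolution.norm_eq`) needs an argument at this low regularity: the
solution is mollified, the Laplacian term drops out by symmetry of the kernels, and the nonlinear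
term disappears in the limit because u is locally in L^{p+1}. -/

/-! ### Weighted dilations of `L²` -/

/-- A measurable equivalence that scales the measure by a constant, together with a weight of constant
modulus that compensates for it. -/
structure WeightedDilation (α : Type*) [MeasureSpace α] where
  /-- the change of variables -/
  map : α ≃ᵐ α
  /-- the weight -/
  weight : α → ℂ
  /-- the modulus of the weight -/
  modulus : NNReal
  measurable_weight : Measurable weight
  nnnorm_weight : ∀ x, ‖weight x‖₊ = modulus
  smul_map : modulus ^ 2 • Measure.map map volume = volume

namespace WeightedDilation

variable {α : Type*} [MeasureSpace α] (D : WeightedDilation α)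

theorem quasiMeasurePreserving (h0 : D.modulus ≠ 0) :
    Measure.QuasiMeasurePreserving D.map volume volume := by
  refine ⟨D.map.measurable, ?_⟩
  conv_rhs => rw [← D.smul_map]
  refine Measure.AbsolutelyContinuous.mk fun s _ hs => ?_
  rw [Measure.smul_apply, smul_eq_zero] at hs
  exact hs.resolve_left (pow_ne_zero 2 h0)

/-- The weight multiplies the norm by `modulus`, and the change of variables divides it by the same
number. No measurability of `f` is needed because `map` is a measurable equivalence. -/
theorem eLpNorm_weight_mul_comp (f : α → ℂ) :
    eLpNorm (fun x => D.weight x * f (D.map x)) 2 volume = eLpNorm f 2 volume := by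
  have h1 : eLpNorm (fun x => D.weight x * f (D.map x)) 2 volume =
      eLpNorm ((D.modulus : ℝ) • fun x => f (D.map x)) 2 volume := by
    refine eLpNorm_congr_norm_ae (Eventually.of_forall fun x => ?_)
    have : ‖D.weight x‖ = D.modulus := congrArg NNReal.toReal (D.nnnorm_weight x)
    simp [this]
  rw [h1, eLpNorm_const_smul]
  conv_rhs => rw [← D.smul_map]
  have h2 : eLpNorm f 2 (Measure.map D.map volume) = eLpNorm (fun x => f (D.map x)) 2 volume :=
    D.map.measurableEmbedding.eLpNorm_map_measure
  have h3 : ((D.modulus ^ 2 : NNReal) : ENNReal) ^ (1 / (2 : ENNReal)).toReal = D.modulus := by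
    rw [ENNReal.coe_pow, ← ENNReal.rpow_natCast, ← ENNReal.rpow_mul]
    norm_num
  have h4 : (D.modulus ^ 2 • Measure.map D.map volume : Measure α) =
    ((D.modulus ^ 2 : NNReal) : ENNReal) • Measure.map D.map volume := rfl
  rw [h4, eLpNorm_smul_measure_of_ne_top (by norm_num), h3, h2, smul_eq_mul]
  congr 1
  simp

theorem integral_eq (f : α → ℂ) :
    ∫ x, f x = ((D.modulus : ℝ) ^ 2 : ℝ) * ∫ x, f (D.map x) := by
  conv_lhs => rw [← D.smul_map]
  rw [integral_smul_nnreal_measure, D.map.measurableEmbedding.integral_map, NNReal.smul_def]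
  simp

theorem memLp (h0 : D.modulus ≠ 0) (f : Lp ℂ 2 (volume : Measure α)) :
    MemLp (fun x => D.weight x * f (D.map x)) 2 volume := by
  refine ⟨D.measurable_weight.aestronglyMeasurable.mul
    ((Lp.aestronglyMeasurable f).comp_quasiMeasurePreserving (D.quasiMeasurePreserving h0)), ?_⟩
  rw [D.eLpNorm_weight_mul_comp]
  exact Lp.eLpNorm_lt_top f

/-- The isometry `f ↦ weight · (f ∘ map)` of `L²`. -/
noncomputable def isometry (h0 : D.modulus ≠ 0) :
    Lp ℂ 2 (volume : Measure α) →ₗᵢ[ℂ] Lp ℂ 2 (volume : Measure α) where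
  toFun f := (D.memLp h0 f).toLp _
  map_add' f g := by
    rw [← MemLp.toLp_add]
    refine MemLp.toLp_congr _ _ ?_
    filter_upwards [(D.quasiMeasurePreserving h0).ae_eq (Lp.coeFn_add f g)] with x hx
    simp only [Function.comp_apply, Pi.add_apply] at hx
    simp only [Pi.add_apply, hx, mul_add]
  map_smul' c f := by
    rw [RingHom.id_apply, ← MemLp.toLp_const_smul]
    refine MemLp.toLp_congr _ _ ?_
    filter_upwards [(D.quasiMeasurePreserving h0).ae_eq (Lp.coeFn_smul c f)] with x hx
    simp only [Function.comp_apply, Pi.smul_apply, smul_eq_mul] at hx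
    simp only [Pi.smul_apply, hx, smul_eq_mul]
    ring
  norm_map' f := by
    change ‖(D.memLp h0 f).toLp _‖ = ‖f‖
    rw [Lp.norm_toLp, D.eLpNorm_weight_mul_comp, Lp.norm_def]

theorem coeFn_isometry (h0 : D.modulus ≠ 0) (f : Lp ℂ 2 (volume : Measure α)) :
    D.isometry h0 f =ᵐ[volume] fun x => D.weight x * f (D.map x) :=
  (D.memLp h0 f).coeFn_toLp

end WeightedDilation

/-! ### The lens transform -/

/-- The dilation factor of the lens transform, equal to `4πt` for `t ≥ 1`. -/
noncomputable def lensScale (t : ℝ) : ℝ := 4 * Real.pi * max t 1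

/-- The cut-off `max t 1` serves this purpose: the lens is an isometry at every time, while only t ≥
1 matters for the asymptotics. -/
theorem lensScale_pos (t : ℝ) : 0 < lensScale t := by
  unfold lensScale; positivity

theorem lensScale_of_one_le {t : ℝ} (ht : 1 ≤ t) : lensScale t = 4 * Real.pi * t := by
  rw [lensScale, max_eq_left ht]

/-- The weight `(4πt)^{d/2} e^{-4π² i t |ξ|²}` of the lens transform. -/
noncomputable def lensWeight (d : ℕ) (t : ℝ) (ξ : EuclideanSpace ℝ (Fin d)) : ℂ :=
  ((lensScale t ^ ((d : ℝ) / 2) : ℝ) : ℂ) *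
    Complex.exp ((-(4 * Real.pi ^ 2 * t * ‖ξ‖ ^ 2) : ℝ) * Complex.I)

theorem continuous_lensWeight (d : ℕ) (t : ℝ) : Continuous (lensWeight d t) := by
  unfold lensWeight; fun_prop

theorem norm_lensWeight (d : ℕ) (t : ℝ) (ξ : EuclideanSpace ℝ (Fin d)) :
    ‖lensWeight d t ξ‖ = lensScale t ^ ((d : ℝ) / 2) := by
  rw [lensWeight, norm_mul, Complex.norm_exp_ofReal_mul_I, mul_one, Complex.norm_real,
    Real.norm_of_nonneg (Real.rpow_nonneg (lensScale_pos t).le _)]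

/-- The modulus of the weight of the lens transform. -/
noncomputable def lensModulus (d : ℕ) (t : ℝ) : NNReal :=
  ⟨lensScale t ^ ((d : ℝ) / 2), Real.rpow_nonneg (lensScale_pos t).le _⟩

theorem lensModulus_ne_zero (d : ℕ) (t : ℝ) : lensModulus d t ≠ 0 := by
  intro h
  exact (Real.rpow_pos_of_pos (lensScale_pos t) ((d : ℝ) / 2)).ne' (congrArg NNReal.toReal h)

theorem lensModulus_sq (d : ℕ) (t : ℝ) : (lensModulus d t : ℝ) ^ 2 = lensScale t ^ d := by
  change (lensScale t ^ ((d : ℝ) / 2)) ^ 2 = _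
  rw [← Real.rpow_natCast, ← Real.rpow_mul (lensScale_pos t).le]
  norm_num

theorem lensModulus_sq_smul_map (d : ℕ) (t : ℝ) :
    lensModulus d t ^ 2 • Measure.map (fun y : EuclideanSpace ℝ (Fin d) => lensScale t • y) volume
      = volume := by
  rw [Measure.map_addHaar_smul _ (lensScale_pos t).ne', finrank_euclideanSpace, Fintype.card_fin]
  have h : ENNReal.ofReal |(lensScale t ^ d)⁻¹| = ((lensModulus d t ^ 2)⁻¹ : NNReal) := by
    rw [abs_of_pos (inv_pos.2 (pow_pos (lensScale_pos t) d)), ← lensModulus_sq, ENNReal.ofReal]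
    congr 1
    rw [Real.toNNReal_inv]
    congr 1
    rw [← NNReal.coe_pow, Real.toNNReal_coe]
  rw [h]
  change lensModulus d t ^ 2 • ((lensModulus d t ^ 2)⁻¹ • volume : Measure _) = volume
  rw [smul_smul, mul_inv_cancel₀ (pow_ne_zero 2 (lensModulus_ne_zero d t)), one_smul]

/-- The lens transform on `ℝ^d`, as a weighted dilation. -/
noncomputable def euclideanLensData (d : ℕ) (t : ℝ) :
    WeightedDilation (EuclideanSpace ℝ (Fin d)) where
  map := MeasurableEquiv.smul₀ (lensScale t) (lensScale_pos t).ne'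
  weight := lensWeight d t
  modulus := lensModulus d t
  measurable_weight := (continuous_lensWeight d t).measurable
  nnnorm_weight ξ := NNReal.eq (norm_lensWeight d t ξ)
  smul_map := lensModulus_sq_smul_map d t

/-- The lens transform on the cylinder, as a weighted dilation in the Euclidean variable. -/
noncomputable def cylinderLensData (d : ℕ) (t : ℝ) : WeightedDilation (Cylinder d) where
  map := MeasurableEquiv.prodCongr (MeasurableEquiv.smul₀ (lensScale t) (lensScale_pos t).ne')
    (MeasurableEquiv.refl _)
  weight z := lensWeight d t z.1
  modulus := lensModulus d t
  measurable_weight := (continuous_lensWeight d t).measurable.comp measurable_fst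
  nnnorm_weight z := NNReal.eq (norm_lensWeight d t z.1)
  smul_map := by
    have h := Measure.map_prod_map (volume : Measure (EuclideanSpace ℝ (Fin d)))
      (volume : Measure (AddCircle (2 * Real.pi)))
      (f := fun y => lensScale t • y) (g := id) (measurable_const_smul _) measurable_id
    have h2 : (⇑(MeasurableEquiv.prodCongr (MeasurableEquiv.smul₀ (lensScale t)
        (lensScale_pos t).ne') (MeasurableEquiv.refl _)) : Cylinder d → Cylinder d) =
        Prod.map (fun y => lensScale t • y) id := rfl
    rw [h2, Measure.volume_eq_prod, ← h, Measure.map_id]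
    conv_rhs => rw [← lensModulus_sq_smul_map d t]
    exact (Measure.prod_smul_left (lensModulus d t ^ 2)).symm

/-- The lens transform on `L²(ℝ^d)`. -/
noncomputable def euclideanLens (d : ℕ) (t : ℝ) : L2Euclidean d →ₗᵢ[ℂ] L2Euclidean d :=
  (euclideanLensData d t).isometry (lensModulus_ne_zero d t)

/-- The lens transform on `L²(ℝ^d × 𝕋)`. -/
noncomputable def cylinderLens (d : ℕ) (t : ℝ) : L2Cylinder d →ₗᵢ[ℂ] L2Cylinder d :=
  (cylinderLensData d t).isometry (lensModulus_ne_zero d t)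

theorem coeFn_euclideanLens (d : ℕ) (t : ℝ) (f : L2Euclidean d) :
    euclideanLens d t f =ᵐ[volume] fun ξ => lensWeight d t ξ * f (lensScale t • ξ) :=
  (euclideanLensData d t).coeFn_isometry (lensModulus_ne_zero d t) f

theorem coeFn_cylinderLens (d : ℕ) (t : ℝ) (f : L2Cylinder d) :
    cylinderLens d t f =ᵐ[volume] fun z => lensWeight d t z.1 * f (lensScale t • z.1, z.2) :=
  (cylinderLensData d t).coeFn_isometry (lensModulus_ne_zero d t) f

/-- The lens acts on the Euclidean variable alone, so the free asymptotics on the cylinder reduce to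
those on ℝ^d, mode by mode. -/
theorem cylinderLens_modeEmbedding (d : ℕ) (t : ℝ) (n : ℤ) (f : L2Euclidean d) :
    cylinderLens d t (modeEmbedding d n f) = modeEmbedding d n (euclideanLens d t f) := by
  apply Lp.ext
  have h1 : modeEmbedding d n f =ᵐ[volume] modeFun n f := (memLp_modeFun n f).coeFn_toLp
  have h2 : modeEmbedding d n (euclideanLens d t f) =ᵐ[volume] modeFun n (euclideanLens d t f) :=
    (memLp_modeFun n _).coeFn_toLp
  have h3 := ((cylinderLensData d t).quasiMeasurePreserving (lensModulus_ne_zero d t)).ae_eq h1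
  have h4 := (Measure.quasiMeasurePreserving_fst (μ := (volume :
          Measure (EuclideanSpace ℝ (Fin d)))) (ν := (volume :
          Measure (AddCircle (2 * Real.pi))))).ae_eq (coeFn_euclideanLens d t f)
  filter_upwards [coeFn_cylinderLens d t (modeEmbedding d n f), h2, h3, h4] with z e1 e2 e3 e4
  rw [e1, e2]
  have e3' : modeEmbedding d n f (lensScale t • z.1, z.2) = modeFun n f (lensScale t • z.1, z.2) :=
    e3
  simp only [Function.comp_apply] at e4
  rw [e3', modeFun, modeFun, e4, mul_assoc]

/-! ### Asymptotics of the free evolution on `ℝ^d` -/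

theorem iteratedDeriv_cexp_ofReal_mul_I (n : ℕ) :
    iteratedDeriv n (fun x : ℝ => Complex.exp (x * Complex.I)) =
      fun x : ℝ => Complex.I ^ n * Complex.exp (x * Complex.I) := by
  induction n with
  | zero => simp
  | succ n ih =>
    rw [iteratedDeriv_succ, ih]
    funext x
    have h : HasDerivAt (fun x : ℝ => Complex.exp ((x : ℂ) * Complex.I))
        (Complex.exp (x * Complex.I) * (1 * Complex.I)) x :=
      ((Complex.ofRealCLM.hasDerivAt (x := x)).mul_const Complex.I).cexp
    rw [(h.const_mul (Complex.I ^ n)).deriv]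
    ring

theorem hasTemperateGrowth_cexp_ofReal_mul_I :
    (fun x : ℝ => Complex.exp (x * Complex.I)).HasTemperateGrowth := by
  refine ⟨(Complex.ofRealCLM.contDiff.mul contDiff_const).cexp, fun n => ⟨0, 1, fun x => ?_⟩⟩
  rw [norm_iteratedFDeriv_eq_norm_iteratedDeriv, iteratedDeriv_cexp_ofReal_mul_I]
  simp [Complex.norm_exp_ofReal_mul_I]

theorem hasTemperateGrowth_cexp_mul_norm_sq {V : Type*} [NormedAddCommGroup V]
    [InnerProductSpace ℝ V] (s : ℝ) :
    (fun y : V => Complex.exp ((s * ‖y‖ ^ 2 : ℝ) * Complex.I)).HasTemperateGrowth := by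
  have h : (fun y : V => s * ‖y‖ ^ 2).HasTemperateGrowth :=
    (Function.HasTemperateGrowth.const s).mul (Function.hasTemperateGrowth_norm_sq V)
  exact hasTemperateGrowth_cexp_ofReal_mul_I.comp h

theorem schrodingerSymbol_eq (d : ℕ) (t : ℝ) :
    (fun ξ : EuclideanSpace ℝ (Fin d) =>
      Complex.exp ((-(t * (2 * Real.pi * ‖ξ‖) ^ 2) : ℝ) * Complex.I)) =
    fun ξ => Complex.exp ((-(4 * Real.pi ^ 2 * t) * ‖ξ‖ ^ 2 : ℝ) * Complex.I) := by
  funext ξ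
  congr 3
  ring

theorem euclideanPropagator_toLp (d : ℕ) (t : ℝ) (f : SchwartzMap (EuclideanSpace ℝ (Fin d)) ℂ) :
    euclideanPropagator d t (f.toLp 2) =
      (𝓕⁻ (SchwartzMap.smulLeftCLM ℂ (fun ξ : EuclideanSpace ℝ (Fin d) =>
        Complex.exp ((-(4 * Real.pi ^ 2 * t) * ‖ξ‖ ^ 2 : ℝ) * Complex.I)) (𝓕 f))).toLp 2 := by
  rw [← SchwartzMap.toLp_fourierInv_eq, euclideanPropagator]
  congr 1
  apply Lp.ext
  refine (MemLp.coeFn_toLp _).trans ?_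
  refine EventuallyEq.trans ?_ (SchwartzMap.coeFn_toLp _ 2 volume).symm
  rw [SchwartzMap.toLp_fourier_eq]
  filter_upwards [SchwartzMap.coeFn_toLp (𝓕 f) 2 volume] with ξ h
  rw [h, SchwartzMap.smulLeftCLM_apply_apply (hasTemperateGrowth_cexp_mul_norm_sq _), smul_eq_mul]
  rw [show Complex.exp ((-(t * (2 * Real.pi * ‖ξ‖) ^ 2) : ℝ) * Complex.I) =
    Complex.exp ((-(4 * Real.pi ^ 2 * t) * ‖ξ‖ ^ 2 : ℝ) * Complex.I) from
      congrFun (schrodingerSymbol_eq d t) ξ]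

/-- The Fourier transform is moved from `f` onto the Gaussian, whose transform is explicit when Re b
> 0. -/
theorem integral_fourier_mul_gaussian {V : Type*} [NormedAddCommGroup V] [InnerProductSpace ℝ V]
    [FiniteDimensional ℝ V] [MeasurableSpace V] [BorelSpace V] {b : ℂ} (hb : 0 < b.re) (y : V)
    {f : V → ℂ} (hf : Integrable f) :
    ∫ η : V, 𝓕 f η * Complex.exp (-b * ‖η‖ ^ 2 + 2 * Real.pi * Complex.I * inner ℝ y η) =
      (Real.pi / b) ^ (Module.finrank ℝ V / 2 : ℂ) *
        ∫ x : V, f x * Complex.exp (-Real.pi ^ 2 * ‖y - x‖ ^ 2 / b) := by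
  have J : Integrable (fun w : V =>
      Complex.exp (-b * ‖w‖ ^ 2 + 2 * Real.pi * Complex.I * inner ℝ y w)) :=
    GaussianFourier.integrable_cexp_neg_mul_sq_norm_add hb _ _
  have h := VectorFourier.integral_fourierIntegral_smul_eq_flip (L := innerₗ V)
      Real.continuous_fourierChar continuous_inner hf J
  have h2 : ∀ x : V, VectorFourier.fourierIntegral Real.fourierChar volume (innerₗ V).flip
      (fun w : V => Complex.exp (-b * ‖w‖ ^ 2 + 2 * Real.pi * Complex.I * inner ℝ y w)) x =
      (Real.pi / b) ^ (Module.finrank ℝ V / 2 : ℂ) *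
        Complex.exp (-Real.pi ^ 2 * ‖y - x‖ ^ 2 / b) := by
    intro x
    rw [← fourier_gaussian_innerProductSpace' hb y x, flip_innerₗ]
    rfl
  simp only [h2, smul_eq_mul] at h
  rw [← integral_const_mul]
  refine Eq.trans h (integral_congr_ae (Eventually.of_forall fun x => ?_))
  simp only
  ring

/-- The Schrödinger symbol is a Gaussian with imaginary parameter, which is not integrable. It is
reached as the limit of b = ε + is as ε ↓ 0, with |𝓕 f| and |f| as dominating functions on the two
sides. -/
theorem integral_fourier_mul_gaussian_of_re_eq_zero {V : Type*} [NormedAddCommGroup V]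
    [InnerProductSpace ℝ V]
    [FiniteDimensional ℝ V] [MeasurableSpace V] [BorelSpace V] {s : ℝ} (hs : 0 < s) (y : V)
    {f : V → ℂ} (hf : Integrable f) (hf' : Integrable (𝓕 f)) :
    ∫ η : V, 𝓕 f η * Complex.exp (-(s * Complex.I) * ‖η‖ ^ 2
        + 2 * Real.pi * Complex.I * inner ℝ y η) =
      (Real.pi / (s * Complex.I)) ^ (Module.finrank ℝ V / 2 : ℂ) *
        ∫ x : V, f x * Complex.exp (-Real.pi ^ 2 * ‖y - x‖ ^ 2 / (s * Complex.I)) := by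
  have hsI : (s : ℂ) * Complex.I ≠ 0 :=
    mul_ne_zero (Complex.ofReal_ne_zero.2 hs.ne') Complex.I_ne_zero
  have hlim : Tendsto (fun ε : ℝ => (ε : ℂ) + s * Complex.I) (𝓝[>] 0) (𝓝 (s * Complex.I)) := by
    have : Tendsto (fun ε : ℝ => (ε : ℂ) + s * Complex.I) (𝓝 0) (𝓝 ((0 : ℝ) + s * Complex.I)) :=
      Continuous.tendsto (by fun_prop) 0
    rw [Complex.ofReal_zero, zero_add] at this
    exact this.mono_left nhdsWithin_le_nhds
  have hL : Tendsto (fun ε : ℝ => ∫ η : V, 𝓕 f η * Complex.exp (-((ε : ℂ) + s * Complex.I) * ‖η‖ ^ 2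
        + 2 * Real.pi * Complex.I * inner ℝ y η)) (𝓝[>] 0)
      (𝓝 (∫ η : V, 𝓕 f η * Complex.exp (-(s * Complex.I) * ‖η‖ ^ 2
        + 2 * Real.pi * Complex.I * inner ℝ y η))) := by
    refine tendsto_integral_filter_of_dominated_convergence (fun η => ‖𝓕 f η‖) ?_ ?_ hf'.norm ?_
    · refine Eventually.of_forall fun ε => hf'.1.mul (Continuous.aestronglyMeasurable ?_)
      fun_prop
    · filter_upwards [self_mem_nhdsWithin] with ε hε
      refine Eventually.of_forall fun η => ?_
      rw [norm_mul, Complex.norm_exp]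
      refine mul_le_of_le_one_right (norm_nonneg _) (Real.exp_le_one_iff.2 ?_)
      have : ((-((ε : ℂ) + s * Complex.I) * ‖η‖ ^ 2
        + 2 * Real.pi * Complex.I * inner ℝ y η)).re = -(ε * ‖η‖ ^ 2) := by
        simp [← Complex.ofReal_pow]
      rw [this]
      have : (0 : ℝ) < ε := hε
      have : 0 ≤ ε * ‖η‖ ^ 2 := by positivity
      linarith
    · refine Eventually.of_forall fun η => Tendsto.const_mul _ ?_
      exact (Complex.continuous_exp.tendsto _).comp
        ((hlim.neg.mul_const _).add_const _)
  have hR : Tendsto (fun ε : ℝ => (Real.pi / ((ε : ℂ) + s * Complex.I)) ^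
      (Module.finrank ℝ V / 2 : ℂ) *
        ∫ x : V, f x * Complex.exp (-Real.pi ^ 2 * ‖y - x‖ ^ 2 / ((ε : ℂ) + s * Complex.I)))
      (𝓝[>] 0) (𝓝 ((Real.pi / (s * Complex.I)) ^ (Module.finrank ℝ V / 2 : ℂ) *
        ∫ x : V, f x * Complex.exp (-Real.pi ^ 2 * ‖y - x‖ ^ 2 / (s * Complex.I)))) := by
    refine Tendsto.mul ?_ ?_
    · refine (Tendsto.div tendsto_const_nhds hlim hsI).cpow tendsto_const_nhds (Or.inr ?_)
      -- The limiting base -iπ/s lies off the branch cut, so the complex power is continuous there.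
      have : (Real.pi : ℂ) / (s * Complex.I) = ((-(Real.pi / s) : ℝ) : ℂ) * Complex.I := by
        rw [div_eq_iff hsI]
        push_cast
        have hs0 : (s : ℂ) ≠ 0 := Complex.ofReal_ne_zero.2 hs.ne'
        field_simp
        rw [Complex.I_sq]
        ring
      rw [this]
      have h3 : (0 : ℝ) < Real.pi / s := div_pos Real.pi_pos hs
      simp only [Complex.mul_im, Complex.ofReal_re, Complex.I_im, Complex.ofReal_im, Complex.I_re,
        mul_one, mul_zero, add_zero]
      linarith
    · refine tendsto_integral_filter_of_dominated_convergence (fun x => ‖f x‖) ?_ ?_ hf.norm ?_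
      · refine Eventually.of_forall fun ε => hf.1.mul (Continuous.aestronglyMeasurable ?_)
        fun_prop
      · filter_upwards [self_mem_nhdsWithin] with ε hε
        refine Eventually.of_forall fun x => ?_
        have hε' : (0 : ℝ) < ε := hε
        rw [norm_mul, Complex.norm_exp]
        refine mul_le_of_le_one_right (norm_nonneg _) (Real.exp_le_one_iff.2 ?_)
        have h1 : (-(Real.pi : ℂ) ^ 2 * ‖y - x‖ ^ 2 / ((ε : ℂ) + s * Complex.I)) =
          ((-(Real.pi ^ 2 * ‖y - x‖ ^ 2) : ℝ) : ℂ) * ((ε : ℂ) + s * Complex.I)⁻¹ := by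
          push_cast
          rw [div_eq_mul_inv]
          ring
        rw [h1, Complex.re_ofReal_mul, Complex.inv_re]
        have h2 : ((ε : ℂ) + s * Complex.I).re = ε := by simp
        rw [h2]
        have : 0 ≤ (Real.pi ^ 2 * ‖y - x‖ ^ 2) * (ε / Complex.normSq ((ε : ℂ) + s * Complex.I)) :=
          mul_nonneg (by positivity) (div_nonneg hε'.le (Complex.normSq_nonneg _))
        linarith
      · refine Eventually.of_forall fun x => Tendsto.const_mul _ ?_
        exact (Complex.continuous_exp.tendsto _).comp (Tendsto.div tendsto_const_nhds hlim hsI)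
  refine tendsto_nhds_unique (hL.congr' ?_) hR
  filter_upwards [self_mem_nhdsWithin] with ε hε
  refine integral_fourier_mul_gaussian ?_ y hf
  have hε' : (0 : ℝ) < ε := hε
  simpa using hε'

theorem cpow_ofReal_mul {r : ℝ} (hr : 0 < r) {z : ℂ} (hz : z ≠ 0) (w : ℂ) :
    ((r : ℂ) * z) ^ w = (r : ℂ) ^ w * z ^ w := by
  have hr' : (r : ℂ) ≠ 0 := Complex.ofReal_ne_zero.2 hr.ne'
  rw [Complex.cpow_def_of_ne_zero (mul_ne_zero hr' hz), Complex.cpow_def_of_ne_zero hr',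
    Complex.cpow_def_of_ne_zero hz, Complex.log_ofReal_mul hr hz, ← Complex.exp_add, add_mul,
    Complex.ofReal_log hr.le]

/-- The constant phase in the asymptotics of the free evolution. -/
noncomputable def lensPhase (d : ℕ) : ℂ := (-Complex.I) ^ ((d : ℂ) / 2)

/-- The dilation factor cancels the dispersive decay exactly, since π/(4π²it) = (4πt)⁻¹(-i); only a
constant phase is left. -/
theorem lensScale_rpow_mul_cpow (d : ℕ) {t : ℝ} (ht : 1 ≤ t) :
    ((lensScale t ^ ((d : ℝ) / 2) : ℝ) : ℂ) *
      (Real.pi / (((4 * Real.pi ^ 2 * t : ℝ) : ℂ) * Complex.I)) ^ ((d : ℂ) / 2) = lensPhase d := by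
  have hc := lensScale_pos t
  have h1 : (Real.pi / (((4 * Real.pi ^ 2 * t : ℝ) : ℂ) * Complex.I)) =
      (((lensScale t)⁻¹ : ℝ) : ℂ) * (-Complex.I) := by
    have hp : (Real.pi : ℂ) ≠ 0 := Complex.ofReal_ne_zero.2 Real.pi_ne_zero
    have ht0 : (t : ℂ) ≠ 0 := Complex.ofReal_ne_zero.2 (by linarith)
    rw [lensScale_of_one_le ht, div_eq_iff (mul_ne_zero (Complex.ofReal_ne_zero.2 (by positivity))
      Complex.I_ne_zero)]
    push_cast
    field_simp
    rw [Complex.I_sq]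
    ring
  rw [h1, cpow_ofReal_mul (inv_pos.2 hc) (neg_ne_zero.2 Complex.I_ne_zero), ← mul_assoc, lensPhase]
  have h2 : ((((lensScale t)⁻¹ : ℝ) : ℂ)) ^ ((d : ℂ) / 2) =
      (((lensScale t)⁻¹ ^ ((d : ℝ) / 2) : ℝ) : ℂ) := by
    rw [Complex.ofReal_cpow (inv_nonneg.2 hc.le)]
    push_cast
    rfl
  rw [h2, ← Complex.ofReal_mul, Real.inv_rpow hc.le, mul_inv_cancel₀
    (Real.rpow_pos_of_pos hc _).ne', Complex.ofReal_one, one_mul]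

/-- The free propagator factors as chirp, Fourier transform, dilation, chirp. In the kernel
e^{i|4πtξ-x|²/(4t)} the square in ξ is cancelled by the lens weight, the cross term is the Fourier
kernel, and the square in x is the remaining chirp on `f`. -/
theorem euclideanLens_propagator_toLp (d : ℕ) {t : ℝ} (ht : 1 ≤ t)
    (f : SchwartzMap (EuclideanSpace ℝ (Fin d)) ℂ) :
    euclideanLens d t (euclideanPropagator d t (f.toLp 2)) =
      lensPhase d • 𝓕 ((SchwartzMap.smulLeftCLM ℂ (fun y : EuclideanSpace ℝ (Fin d) =>
        Complex.exp (((4 * t)⁻¹ * ‖y‖ ^ 2 : ℝ) * Complex.I)) f).toLp 2) := by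
  rw [SchwartzMap.toLp_fourier_eq, euclideanPropagator_toLp]
  set g := 𝓕⁻ (SchwartzMap.smulLeftCLM ℂ (fun ξ : EuclideanSpace ℝ (Fin d) =>
        Complex.exp ((-(4 * Real.pi ^ 2 * t) * ‖ξ‖ ^ 2 : ℝ) * Complex.I)) (𝓕 f)) with hg
  set k := SchwartzMap.smulLeftCLM ℂ (fun y : EuclideanSpace ℝ (Fin d) =>
        Complex.exp (((4 * t)⁻¹ * ‖y‖ ^ 2 : ℝ) * Complex.I)) f with hk
  have ht0 : (t : ℂ) ≠ 0 := Complex.ofReal_ne_zero.2 (by linarith)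
  have hπ : (Real.pi : ℂ) ≠ 0 := Complex.ofReal_ne_zero.2 Real.pi_ne_zero
  have key : ∀ ξ, lensWeight d t ξ * g (lensScale t • ξ) = lensPhase d * 𝓕 k ξ := by
    intro ξ
    have h1 : g (lensScale t • ξ) = ∫ η, 𝓕 (f : EuclideanSpace ℝ (Fin d) → ℂ) η *
        Complex.exp (-(((4 * Real.pi ^ 2 * t : ℝ) : ℂ) * Complex.I) * ‖η‖ ^ 2
          + 2 * Real.pi * Complex.I * inner ℝ (lensScale t • ξ) η) := by
      rw [hg, SchwartzMap.fourierInv_coe, Real.fourierInv_eq']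
      refine integral_congr_ae (Eventually.of_forall fun η => ?_)
      simp only
      rw [SchwartzMap.smulLeftCLM_apply_apply (hasTemperateGrowth_cexp_mul_norm_sq _),
        smul_eq_mul, smul_eq_mul, SchwartzMap.fourier_coe, ← mul_assoc, ← Complex.exp_add, mul_comm,
        real_inner_comm]
      congr 2
      push_cast
      ring
    have hint : Integrable (𝓕 (f : EuclideanSpace ℝ (Fin d) → ℂ)) := by
      rw [← SchwartzMap.fourier_coe]; exact (𝓕 f).integrable
    rw [h1, integral_fourier_mul_gaussian_of_re_eq_zero (by positivity) _ f.integrable hint,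
      finrank_euclideanSpace, Fintype.card_fin, lensWeight, ← lensScale_rpow_mul_cpow d ht,
      SchwartzMap.fourier_coe, Real.fourier_eq']
    have h2 : ∫ x, f x * Complex.exp (-(Real.pi : ℂ) ^ 2 * ‖lensScale t • ξ - x‖ ^ 2 /
          (((4 * Real.pi ^ 2 * t : ℝ) : ℂ) * Complex.I)) =
        Complex.exp (((4 * Real.pi ^ 2 * t * ‖ξ‖ ^ 2 : ℝ) : ℂ) * Complex.I) *
        ∫ x, Complex.exp ((-2 * Real.pi * inner ℝ x ξ : ℝ) * Complex.I) • k x := by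
      rw [← integral_const_mul]
      refine integral_congr_ae (Eventually.of_forall fun x => ?_)
      simp only
      rw [hk, SchwartzMap.smulLeftCLM_apply_apply (hasTemperateGrowth_cexp_mul_norm_sq _),
        smul_eq_mul, smul_eq_mul, ← mul_assoc, ← mul_assoc, ← Complex.exp_add, ← Complex.exp_add,
        mul_comm]
      congr 2
      have h3 : ‖lensScale t • ξ - x‖ ^ 2 =
          lensScale t ^ 2 * ‖ξ‖ ^ 2 - 2 * lensScale t * inner ℝ x ξ + ‖x‖ ^ 2 := by
        rw [norm_sub_sq_real, norm_smul, real_inner_smul_left, real_inner_comm,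
          Real.norm_of_nonneg (lensScale_pos t).le]
        ring
      rw [← Complex.ofReal_pow ‖lensScale t • ξ - x‖, h3, lensScale_of_one_le ht]
      rw [div_eq_iff (mul_ne_zero (Complex.ofReal_ne_zero.2 (by positivity)) Complex.I_ne_zero)]
      push_cast
      field_simp
      rw [Complex.I_sq]
      ring
    rw [h2]
    have h4 : Complex.exp (((-(4 * Real.pi ^ 2 * t * ‖ξ‖ ^ 2) : ℝ) : ℂ) * Complex.I) *
        Complex.exp (((4 * Real.pi ^ 2 * t * ‖ξ‖ ^ 2 : ℝ) : ℂ) * Complex.I) = 1 := by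
      rw [← Complex.exp_add, ← add_mul, ← Complex.ofReal_add]
      simp
    linear_combination ((lensScale t ^ ((d : ℝ) / 2) : ℝ) : ℂ) *
      (Real.pi / (((4 * Real.pi ^ 2 * t : ℝ) : ℂ) * Complex.I)) ^ ((d : ℂ) / 2) *
      (∫ x, Complex.exp ((-2 * Real.pi * inner ℝ x ξ : ℝ) * Complex.I) • k x) * h4
  apply Lp.ext
  have hq := ((euclideanLensData d t).quasiMeasurePreserving (lensModulus_ne_zero d t)).ae_eq
    (SchwartzMap.coeFn_toLp g 2 volume)
  filter_upwards [coeFn_euclideanLens d t (g.toLp 2), hq, Lp.coeFn_smul (lensPhase d)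
    ((𝓕 k).toLp 2), SchwartzMap.coeFn_toLp (𝓕 k) 2 volume] with ξ e1 e2 e3 e4
  have e2' : g.toLp 2 volume (lensScale t • ξ) = g (lensScale t • ξ) := e2
  rw [e1, e2', e3, Pi.smul_apply, e4, smul_eq_mul, key]

/-- The chirp tends to 1 pointwise and differs from it by at most 2, so 4|f|² dominates. -/
theorem tendsto_toLp_mul_cexp (d : ℕ) (f : SchwartzMap (EuclideanSpace ℝ (Fin d)) ℂ) :
    Tendsto (fun t : ℝ => ‖(SchwartzMap.smulLeftCLM ℂ (fun y : EuclideanSpace ℝ (Fin d) =>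
        Complex.exp (((4 * t)⁻¹ * ‖y‖ ^ 2 : ℝ) * Complex.I)) f).toLp 2 volume - f.toLp 2 volume‖)
      atTop (𝓝 0) := by
  have hsq : ∀ t : ℝ, ‖(SchwartzMap.smulLeftCLM ℂ (fun y : EuclideanSpace ℝ (Fin d) =>
        Complex.exp (((4 * t)⁻¹ * ‖y‖ ^ 2 : ℝ) * Complex.I)) f).toLp 2 volume
        - f.toLp 2 volume‖ ^ 2 =
      ∫ y, ‖(Complex.exp (((4 * t)⁻¹ * ‖y‖ ^ 2 : ℝ) * Complex.I) - 1) * f y‖ ^ 2 := by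
    intro t
    rw [← SchwartzMap.toLpCLM_apply (𝕜 := ℂ), ← SchwartzMap.toLpCLM_apply (𝕜 := ℂ), ← map_sub,
      SchwartzMap.toLpCLM_apply, SchwartzMap.norm_toLp' (by norm_num) (by norm_num)]
    rw [← Real.rpow_natCast, ← Real.rpow_mul (integral_nonneg fun y => by positivity)]
    rw [show (2 : ENNReal).toReal⁻¹ * ((2 : ℕ) : ℝ) = 1 by norm_num, Real.rpow_one]
    refine integral_congr_ae (Eventually.of_forall fun y => ?_)
    simp only
    rw [sub_apply,
      SchwartzMap.smulLeftCLM_apply_apply (hasTemperateGrowth_cexp_mul_norm_sq _),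
      smul_eq_mul, sub_mul, one_mul]
    norm_num
  have hlim : Tendsto (fun t : ℝ => ∫ y, ‖(Complex.exp (((4 * t)⁻¹ * ‖y‖ ^ 2 : ℝ) * Complex.I) - 1)
      * f y‖ ^ 2) atTop (𝓝 (∫ y : EuclideanSpace ℝ (Fin d), 0)) := by
    refine tendsto_integral_filter_of_dominated_convergence (fun y => 4 * ‖f y‖ ^ 2) ?_ ?_ ?_ ?_
    · refine Eventually.of_forall fun t => Continuous.aestronglyMeasurable ?_
      have := f.continuous
      fun_prop
    · refine Eventually.of_forall fun t => Eventually.of_forall fun y => ?_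
      rw [norm_mul, mul_pow, Real.norm_of_nonneg (by positivity)]
      have h1 : ‖Complex.exp (((4 * t)⁻¹ * ‖y‖ ^ 2 : ℝ) * Complex.I) - 1‖ ≤ 2 := by
        refine (norm_sub_le _ _).trans ?_
        rw [Complex.norm_exp_ofReal_mul_I, norm_one]; norm_num
      have h2 : ‖Complex.exp (((4 * t)⁻¹ * ‖y‖ ^ 2 : ℝ) * Complex.I) - 1‖ ^ 2 ≤ 4 := by
        nlinarith [norm_nonneg (Complex.exp (((4 * t)⁻¹ * ‖y‖ ^ 2 : ℝ) * Complex.I) - 1)]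
      gcongr
    · exact ((memLp_two_iff_integrable_sq_norm f.continuous.aestronglyMeasurable).1
        (f.memLp 2 volume)).const_mul 4
    · refine Eventually.of_forall fun y => ?_
      have h0 : Tendsto (fun t : ℝ => (4 * t)⁻¹) atTop (𝓝 0) :=
        tendsto_inv_atTop_zero.comp (tendsto_id.const_mul_atTop (by norm_num))
      have hc : Continuous fun s : ℝ =>
          ‖(Complex.exp ((s * ‖y‖ ^ 2 : ℝ) * Complex.I) - 1) * f y‖ ^ 2 := by fun_prop
      have := (hc.tendsto 0).comp h0
      rw [show ‖(Complex.exp ((0 * ‖y‖ ^ 2 : ℝ) * Complex.I) - 1) * f y‖ ^ 2 = 0 by simp] at this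
      exact this
  rw [integral_zero] at hlim
  have h3 : Tendsto (fun t : ℝ => ‖(SchwartzMap.smulLeftCLM ℂ (fun y : EuclideanSpace ℝ (Fin d) =>
        Complex.exp (((4 * t)⁻¹ * ‖y‖ ^ 2 : ℝ) * Complex.I)) f).toLp 2 volume
        - f.toLp 2 volume‖ ^ 2) atTop (𝓝 0) := hlim.congr fun t => (hsq t).symm
  simpa [Real.sqrt_sq (norm_nonneg _)] using h3.sqrt

theorem euclideanPropagator_sub (d : ℕ) (t : ℝ) (f g : L2Euclidean d) :
    euclideanPropagator d t (f - g) = euclideanPropagator d t f - euclideanPropagator d t g := by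
  have hF : 𝓕 (f - g) = 𝓕 f - 𝓕 g :=
    map_sub (Lp.fourierTransformₗᵢ (EuclideanSpace ℝ (Fin d)) ℂ) f g
  have hI : ∀ a b : L2Euclidean d, 𝓕⁻ (a - b) = 𝓕⁻ a - 𝓕⁻ b :=
    map_sub (Lp.fourierTransformₗᵢ (EuclideanSpace ℝ (Fin d)) ℂ).symm
  unfold euclideanPropagator
  rw [← hI, ← MemLp.toLp_sub]
  congr 1
  refine MemLp.toLp_congr _ _ ?_
  rw [hF]
  filter_upwards [Lp.coeFn_sub (𝓕 f) (𝓕 g)] with ξ h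
  simp only [Pi.sub_apply, h, mul_sub]

/-- Smooth compactly supported data suffice, because lens and propagator are isometries and the
approximation error is therefore uniform in time. -/
theorem tendsto_euclideanLens_propagator (d : ℕ) (f : L2Euclidean d) :
    Tendsto (fun t : ℝ => ‖euclideanLens d t (euclideanPropagator d t f) - lensPhase d • 𝓕 f‖)
      atTop (𝓝 0) := by
  have hsub : ∀ (f g : L2Euclidean d), 𝓕 (f - g) = 𝓕 f - 𝓕 g :=
    map_sub (Lp.fourierTransformₗᵢ (EuclideanSpace ℝ (Fin d)) ℂ)
  rw [Metric.tendsto_nhds]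
  intro ε hε
  -- Three errors are added: ‖f - g‖ under the isometries, the error for `g` itself, and ‖f - g‖
  -- times the norm of the phase.
  have hζ : 0 < 2 + ‖lensPhase d‖ := by positivity
  obtain ⟨g, hfg, g', hgg', hgc, hgs⟩ := Metric.dense_iff.1
    (Lp.dense_hasCompactSupport_contDiff (F := ℂ) (μ := (volume : Measure (EuclideanSpace ℝ (Fin d))))
      (p := 2) (by norm_num)) f (ε / (2 + ‖lensPhase d‖)) (div_pos hε hζ)
  have hg : g = (hgc.toSchwartzMap hgs).toLp 2 volume := by
    apply Lp.ext
    refine hgg'.trans (SchwartzMap.coeFn_toLp (hgc.toSchwartzMap hgs) 2 volume).symm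
  have hfg' : ‖f - g‖ < ε / (2 + ‖lensPhase d‖) := by
    rw [← dist_eq_norm, dist_comm]; exact hfg
  have hlim : Tendsto (fun t : ℝ => ‖euclideanLens d t (euclideanPropagator d t g)
      - lensPhase d • 𝓕 g‖) atTop (𝓝 0) := by
    rw [hg]
    have := (tendsto_toLp_mul_cexp d (hgc.toSchwartzMap hgs)).const_mul ‖lensPhase d‖
    rw [mul_zero] at this
    refine this.congr' ?_
    filter_upwards [eventually_ge_atTop 1] with t ht
    rw [euclideanLens_propagator_toLp d ht, ← smul_sub, norm_smul, ← hsub, Lp.norm_fourier_eq]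
  filter_upwards [(Metric.tendsto_nhds.1 hlim) (ε / (2 + ‖lensPhase d‖)) (div_pos hε hζ)] with t ht
  rw [dist_zero_right, norm_norm] at ht ⊢
  have e : euclideanLens d t (euclideanPropagator d t f) - lensPhase d • 𝓕 f =
      (euclideanLens d t (euclideanPropagator d t (f - g))) +
      (euclideanLens d t (euclideanPropagator d t g) - lensPhase d • 𝓕 g) -
      lensPhase d • 𝓕 (f - g) := by
    rw [euclideanPropagator_sub, hsub, map_sub, smul_sub]
    abel
  rw [e]
  refine (norm_sub_le _ _).trans_lt ?_
  have h1 := norm_add_le (euclideanLens d t (euclideanPropagator d t (f - g)))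
      (euclideanLens d t (euclideanPropagator d t g) - lensPhase d • 𝓕 g)
  rw [(euclideanLens d t).norm_map, norm_euclideanPropagator] at h1
  rw [norm_smul, Lp.norm_fourier_eq]
  have h2 : ‖lensPhase d‖ * ‖f - g‖ ≤ ‖lensPhase d‖ * (ε / (2 + ‖lensPhase d‖)) := by gcongr
  have h3 : ε = ε / (2 + ‖lensPhase d‖) + ε / (2 + ‖lensPhase d‖)
    + ‖lensPhase d‖ * (ε / (2 + ‖lensPhase d‖)) := by field_simp; ring
  linarith

/-! ### The power nonlinearity -/

/-- The nonlinearity `|z|^{p-1} z`. -/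
noncomputable def powerNonlinearity (p : ℝ) (z : ℂ) : ℂ := ((‖z‖ ^ (p - 1) : ℝ) : ℂ) * z

theorem norm_powerNonlinearity {p : ℝ} (hp : 1 < p) (z : ℂ) :
    ‖powerNonlinearity p z‖ = ‖z‖ ^ p := by
  rw [powerNonlinearity, norm_mul, Complex.norm_real,
    Real.norm_of_nonneg (Real.rpow_nonneg (norm_nonneg z) _)]
  rcases (norm_nonneg z).eq_or_lt with h | h
  · rw [← h, mul_zero, Real.zero_rpow (by linarith)]
  · conv_lhs => rw [← Real.rpow_one ‖z‖, ← Real.rpow_mul (norm_nonneg z), one_mul,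
      ← Real.rpow_add h]
    ring_nf

theorem rpow_le_one_add {x q : ℝ} (hx : 0 ≤ x) (hq : 0 ≤ q) (hq1 : q ≤ 1) : x ^ q ≤ 1 + x := by
  rcases le_total x 1 with h | h
  · linarith [Real.rpow_le_one hx h hq]
  · have := Real.rpow_le_rpow_of_exponent_le h hq1
    rw [Real.rpow_one] at this
    linarith

/-- With q = p - 1 and |b| ≤ |a|, the difference is |a|^q (a - b) + (|a|^q - |b|^q) b. Because q ≤
1, both terms are controlled with a weight that grows linearly, which is what makes nonlinear
pairings continuous on L². -/
theorem norm_powerNonlinearity_sub_le {p : ℝ} (hp : 1 < p) (hp2 : p ≤ 2) (a b : ℂ) :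
    ‖powerNonlinearity p a - powerNonlinearity p b‖ ≤ (2 + ‖a‖ + ‖b‖) * ‖a - b‖ := by
  wlog hab : ‖b‖ ≤ ‖a‖ generalizing a b
  · have := this b a (le_of_not_ge hab)
    rw [norm_sub_rev, norm_sub_rev a b]
    linarith
  set A := ‖a‖ with hA
  set B := ‖b‖ with hB
  have hA0 : 0 ≤ A := norm_nonneg a
  have hB0 : 0 ≤ B := norm_nonneg b
  set q := p - 1 with hq
  have hq0 : 0 < q := by rw [hq]; linarith
  have hq1 : q ≤ 1 := by rw [hq]; linarith
  have hBA : B ^ q ≤ A ^ q := Real.rpow_le_rpow hB0 hab hq0.le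
  -- This amounts to A^q B ≤ A B^q, the monotonicity of x^{1-q}.
  have key : (A ^ q - B ^ q) * B ≤ B ^ q * (A - B) := by
    have : A ^ q * B ≤ A * B ^ q := by
      rcases hB0.eq_or_lt with h | h
      · rw [← h, Real.zero_rpow hq0.ne', mul_zero, mul_zero]
      · have hApos : 0 < A := h.trans_le hab
        have e1 : A = A ^ q * A ^ (1 - q) := by
          rw [← Real.rpow_add hApos]; simp
        have e2 : B = B ^ q * B ^ (1 - q) := by
          rw [← Real.rpow_add h]; simp
        have e3 : B ^ (1 - q) ≤ A ^ (1 - q) := Real.rpow_le_rpow hB0 hab (by linarith)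
        calc A ^ q * B = A ^ q * B ^ q * B ^ (1 - q) := by
              conv_lhs => rw [e2]
              ring
          _ ≤ A ^ q * B ^ q * A ^ (1 - q) := by gcongr
          _ = A * B ^ q := by
              conv_rhs => rw [e1]
              ring
    linarith
  have hAB : A - B ≤ ‖a - b‖ := norm_sub_norm_le a b
  have e : powerNonlinearity p a - powerNonlinearity p b =
      ((A ^ q : ℝ) : ℂ) * (a - b) + ((A ^ q - B ^ q : ℝ) : ℂ) * b := by
    simp only [powerNonlinearity]
    push_cast
    ring
  rw [e]
  refine (norm_add_le _ _).trans ?_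
  rw [norm_mul, norm_mul, Complex.norm_real, Complex.norm_real,
    Real.norm_of_nonneg (Real.rpow_nonneg hA0 _), Real.norm_of_nonneg (sub_nonneg.2 hBA), ← hB]
  have h1 := rpow_le_one_add hA0 hq0.le hq1
  have h2 := rpow_le_one_add hB0 hq0.le hq1
  have h3 : 0 ≤ B ^ q := Real.rpow_nonneg hB0 _
  have h4 : B ^ q * (A - B) ≤ B ^ q * ‖a - b‖ := by gcongr
  have h5 : A ^ q * ‖a - b‖ ≤ (1 + A) * ‖a - b‖ := by gcongr
  have h6 : B ^ q * ‖a - b‖ ≤ (1 + B) * ‖a - b‖ := by gcongr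
  nlinarith

theorem powerNonlinearity_zero (p : ℝ) : powerNonlinearity p 0 = 0 := by
  simp [powerNonlinearity]

theorem norm_powerNonlinearity_le {p : ℝ} (hp : 1 < p) (hp2 : p ≤ 2) (a : ℂ) :
    ‖powerNonlinearity p a‖ ≤ (2 + ‖a‖) * ‖a‖ := by
  have := norm_powerNonlinearity_sub_le hp hp2 a 0
  simpa [powerNonlinearity_zero] using this

theorem continuous_powerNonlinearity {p : ℝ} (hp : 1 < p) : Continuous (powerNonlinearity p) := by
  unfold powerNonlinearity
  refine Continuous.mul (Complex.continuous_ofReal.comp ?_) continuous_id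
  exact continuous_norm.rpow_const fun z => Or.inr (by linarith)

/-! ### Pairings with continuous compactly supported functions -/

section Pairing

variable {α : Type*} [MeasurableSpace α] {μ : Measure α}

theorem integrable_mul_of_memLp_two {f g : α → ℂ} (hf : MemLp f 2 μ) (hg : MemLp g 2 μ) :
    Integrable (fun x => f x * g x) μ :=
  memLp_one_iff_integrable.1 (hg.smul (p := 2) (q := 2) (r := 1) hf)

theorem integral_norm_mul_norm_le {f g : α → ℂ} (hf : MemLp f 2 μ) (hg : MemLp g 2 μ) :
    ∫ x, ‖f x‖ * ‖g x‖ ∂μ ≤ (eLpNorm f 2 μ).toReal * (eLpNorm g 2 μ).toReal := by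
  have h := eLpNorm_smul_le_mul_eLpNorm (p := 2) (q := 2) (r := 1) hg.1 hf.1
  have h2 : ∫ x, ‖f x‖ * ‖g x‖ ∂μ = (eLpNorm (f • g) 1 μ).toReal := by
    rw [eLpNorm_one_eq_lintegral_enorm, ← integral_norm_eq_lintegral_enorm (hf.1.smul hg.1)]
    simp
  rw [h2, ← ENNReal.toReal_mul]
  exact ENNReal.toReal_mono (ENNReal.mul_ne_top hf.eLpNorm_ne_top hg.eLpNorm_ne_top) h

theorem norm_integral_mul_le_eLpNorm {f g : α → ℂ} (hf : MemLp f 2 μ) (hg : MemLp g 2 μ) :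
    ‖∫ x, f x * g x ∂μ‖ ≤ (eLpNorm f 2 μ).toReal * (eLpNorm g 2 μ).toReal := by
  refine (norm_integral_le_integral_norm _).trans ?_
  simpa only [norm_mul] using integral_norm_mul_norm_le hf hg

variable {G : α → ℂ}

theorem norm_integral_Lp_mul_le (hG : MemLp G 2 μ) (f : Lp ℂ 2 μ) :
    ‖∫ x, f x * G x ∂μ‖ ≤ ‖f‖ * (eLpNorm G 2 μ).toReal := by
  rw [Lp.norm_def]
  exact norm_integral_mul_le_eLpNorm (Lp.memLp f) hG

theorem integral_Lp_sub_mul (hG : MemLp G 2 μ) (f g : Lp ℂ 2 μ) :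
    ∫ x, (f - g) x * G x ∂μ = ∫ x, f x * G x ∂μ - ∫ x, g x * G x ∂μ := by
  rw [← integral_sub (integrable_mul_of_memLp_two (Lp.memLp f) hG)
    (integrable_mul_of_memLp_two (Lp.memLp g) hG)]
  refine integral_congr_ae ?_
  filter_upwards [Lp.coeFn_sub f g] with x hx
  rw [hx, Pi.sub_apply, sub_mul]

theorem continuous_integral_Lp_mul (hG : MemLp G 2 μ) :
    Continuous fun f : Lp ℂ 2 μ => ∫ x, f x * G x ∂μ := by
  have h : LipschitzWith ⟨(eLpNorm G 2 μ).toReal, ENNReal.toReal_nonneg⟩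
      fun f : Lp ℂ 2 μ => ∫ x, f x * G x ∂μ := by
    refine LipschitzWith.of_dist_le_mul fun f g => ?_
    rw [dist_eq_norm, dist_eq_norm, ← integral_Lp_sub_mul hG, mul_comm]
    exact norm_integral_Lp_mul_le hG _
  exact h.continuous

variable [TopologicalSpace α] [OpensMeasurableSpace α] [IsFiniteMeasureOnCompacts μ]

theorem memLp_indicator_tsupport (hG : HasCompactSupport G) :
    MemLp ((tsupport G).indicator fun _ => (1 : ℂ)) 2 μ :=
  memLp_indicator_const 2 (isClosed_tsupport G).measurableSet 1
    (Or.inr hG.isCompact.measure_lt_top.ne)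

theorem integrable_powerNonlinearity_mul [TopologicalSpace.PseudoMetrizableSpace α]
    {p : ℝ} (hp : 1 < p) (hp2 : p ≤ 2)
    (hG : Continuous G) (hGc : HasCompactSupport G) (f : Lp ℂ 2 μ) :
    Integrable (fun x => powerNonlinearity p (f x) * G x) μ := by
  obtain ⟨M, hM⟩ := hG.bounded_above_of_compact_support hGc
  have hf := Lp.memLp f
  have hK := memLp_indicator_tsupport (μ := μ) hGc
  have h1 := (integrable_mul_of_memLp_two hf hK).norm
  have h2 := (integrable_mul_of_memLp_two hf hf).norm
  refine Integrable.mono' (((h1.const_mul 2).add h2).const_mul M)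
    (((continuous_powerNonlinearity hp).comp_aestronglyMeasurable hf.1).mul
      hG.aestronglyMeasurable) (Eventually.of_forall fun x => ?_)
  simp only [Pi.add_apply, norm_mul]
  have h3 := norm_powerNonlinearity_le hp hp2 (f x)
  by_cases hx : x ∈ tsupport G
  · rw [indicator_of_mem hx, norm_one]
    calc ‖powerNonlinearity p (f x)‖ * ‖G x‖ ≤ ((2 + ‖f x‖) * ‖f x‖) * M := by
          gcongr; exact hM x
      _ = _ := by ring
  · rw [image_eq_zero_of_notMem_tsupport hx, norm_zero, mul_zero]
    have := (norm_nonneg _).trans (hM x)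
    positivity

/-- The linear growth of the Lipschitz weight lets Cauchy–Schwarz close with L² norms only. This
matters because closeness of the solution to its profile is known in L² and in no stronger norm. -/
theorem exists_norm_integral_powerNonlinearity_sub_le [TopologicalSpace.PseudoMetrizableSpace α]
    {p : ℝ} (hp : 1 < p) (hp2 : p ≤ 2) (hG : Continuous G) (hGc : HasCompactSupport G) :
    ∃ C : ℝ, 0 ≤ C ∧ ∀ f g : Lp ℂ 2 μ,
      ‖∫ x, powerNonlinearity p (f x) * G x ∂μ - ∫ x, powerNonlinearity p (g x) * G x ∂μ‖ ≤
        C * (1 + ‖f‖ + ‖g‖) * ‖f - g‖ := by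
  obtain ⟨M, hM⟩ := hG.bounded_above_of_compact_support hGc
  have hK := memLp_indicator_tsupport (μ := μ) hGc
  set κ := (eLpNorm ((tsupport G).indicator fun _ => (1 : ℂ)) 2 μ).toReal with hκ
  have hκ0 : 0 ≤ κ := ENNReal.toReal_nonneg
  -- The constant part 2 of the Lipschitz weight is not in L²; restricting it to the support of `G`
  -- costs the factor κ.
  refine ⟨|M| * (2 * κ + 1), by positivity, fun f g => ?_⟩
  have hf := Lp.memLp f
  have hg := Lp.memLp g
  have hd := Lp.memLp (f - g)
  rw [← integral_sub (integrable_powerNonlinearity_mul hp hp2 hG hGc f)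
    (integrable_powerNonlinearity_mul hp hp2 hG hGc g)]
  have h1 := (integrable_mul_of_memLp_two hd hK).norm
  have h2 := (integrable_mul_of_memLp_two hd hf).norm
  have h3 := (integrable_mul_of_memLp_two hd hg).norm
  simp only [norm_mul] at h1 h2 h3
  have hb : ‖∫ x, (powerNonlinearity p (f x) * G x - powerNonlinearity p (g x) * G x) ∂μ‖ ≤
      ∫ x, |M| * (2 * (‖(f - g) x‖ * ‖(tsupport G).indicator (fun _ => (1 : ℂ)) x‖) +
        ‖(f - g) x‖ * ‖f x‖ + ‖(f - g) x‖ * ‖g x‖) ∂μ := by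
    refine norm_integral_le_of_norm_le ((((h1.const_mul 2).add h2).add h3).const_mul |M|) ?_
    filter_upwards [Lp.coeFn_sub f g] with x hx
    rw [hx, Pi.sub_apply, ← sub_mul, norm_mul]
    have h4 := norm_powerNonlinearity_sub_le hp hp2 (f x) (g x)
    by_cases hxG : x ∈ tsupport G
    · rw [indicator_of_mem hxG, norm_one]
      calc ‖powerNonlinearity p (f x) - powerNonlinearity p (g x)‖ * ‖G x‖
          ≤ ((2 + ‖f x‖ + ‖g x‖) * ‖f x - g x‖) * |M| := by
            gcongr; exact (hM x).trans (le_abs_self M)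
        _ = _ := by ring
    · rw [image_eq_zero_of_notMem_tsupport hxG, norm_zero, mul_zero]
      positivity
  refine hb.trans ?_
  have h12 : Integrable (fun x => 2 * (‖(f - g) x‖ * ‖(tsupport G).indicator (fun _ => (1 : ℂ)) x‖) +
        ‖(f - g) x‖ * ‖f x‖) μ := (h1.const_mul 2).add h2
  rw [integral_const_mul, integral_add h12 h3, integral_add (h1.const_mul 2) h2, integral_const_mul, mul_assoc, mul_assoc]
  refine mul_le_mul_of_nonneg_left ?_ (abs_nonneg M)
  have b1 := integral_norm_mul_norm_le hd hK
  have b2 := integral_norm_mul_norm_le hd hf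
  have b3 := integral_norm_mul_norm_le hd hg
  rw [← Lp.norm_def] at b1 b2 b3
  rw [← Lp.norm_def] at b2 b3
  rw [← hκ] at b1
  have hn := norm_nonneg (f - g)
  have hnf := norm_nonneg f
  have hng := norm_nonneg g
  have : 0 ≤ κ * (‖f‖ + ‖g‖) * ‖f - g‖ := by positivity
  nlinarith

theorem continuous_integral_powerNonlinearity_mul [TopologicalSpace.PseudoMetrizableSpace α]
    {p : ℝ} (hp : 1 < p) (hp2 : p ≤ 2) (hG : Continuous G) (hGc : HasCompactSupport G) :
    Continuous fun f : Lp ℂ 2 μ => ∫ x, powerNonlinearity p (f x) * G x ∂μ := by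
  obtain ⟨C, hC, h⟩ := exists_norm_integral_powerNonlinearity_sub_le (μ := μ) hp hp2 hG hGc
  rw [continuous_iff_continuousAt]
  intro g
  rw [ContinuousAt, tendsto_iff_norm_sub_tendsto_zero]
  have hlim : Tendsto (fun f : Lp ℂ 2 μ => C * (1 + ‖f‖ + ‖g‖) * ‖f - g‖) (𝓝 g)
      (𝓝 (C * (1 + ‖g‖ + ‖g‖) * ‖g - g‖)) := Continuous.tendsto (by fun_prop) g
  rw [sub_self, norm_zero, mul_zero] at hlim
  exact squeeze_zero (fun _ => norm_nonneg _) (fun f => h f g) hlim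

end Pairing

/-! ### Products of test functions -/

theorem two_le_infty : (2 : WithTop ℕ∞) ≤ ∞ := WithTop.coe_le_coe.2 (le_top : (2 : ℕ∞) ≤ ⊤)

/-- The second derivative of a function on the circle. -/
noncomputable def circleSecondDeriv (β : AddCircle (2 * Real.pi) → ℂ)
    (x : AddCircle (2 * Real.pi)) : ℂ :=
  iteratedDeriv 2 (fun s : ℝ => β (x + (s : AddCircle (2 * Real.pi)))) 0

theorem circleSecondDeriv_coe (β : AddCircle (2 * Real.pi) → ℂ) (s : ℝ) :
    circleSecondDeriv β (s : AddCircle (2 * Real.pi)) =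
      iteratedDeriv 2 (fun r : ℝ => β (r : AddCircle (2 * Real.pi))) s := by
  have h := congrFun (iteratedDeriv_comp_const_add 2
    (fun r : ℝ => β (r : AddCircle (2 * Real.pi))) s) 0
  rw [add_zero] at h
  rw [← h, circleSecondDeriv]
  simp only [AddCircle.coe_add]

theorem continuous_of_continuous_comp_coe {X : Type*} [TopologicalSpace X]
    {β : AddCircle (2 * Real.pi) → X}
    (h : Continuous fun s : ℝ => β (s : AddCircle (2 * Real.pi))) : Continuous β :=
  (QuotientAddGroup.isQuotientMap_mk _).continuous_iff.2 h

theorem continuous_circleSecondDeriv {β : AddCircle (2 * Real.pi) → ℂ}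
    (hβ : ContDiff ℝ ∞ fun s : ℝ => β (s : AddCircle (2 * Real.pi))) :
    Continuous (circleSecondDeriv β) := by
  refine continuous_of_continuous_comp_coe ?_
  simp only [circleSecondDeriv_coe]
  exact hβ.continuous_iteratedDeriv 2 two_le_infty

theorem isTestFunction_mul {d : ℕ} {α : EuclideanSpace ℝ (Fin d) → ℂ}
    {β : AddCircle (2 * Real.pi) → ℂ} (hα : ContDiff ℝ ∞ α) (hαc : HasCompactSupport α)
    (hβ : ContDiff ℝ ∞ fun s : ℝ => β (s : AddCircle (2 * Real.pi))) :
    IsTestFunction fun z : Cylinder d => α z.1 * β z.2 := by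
  refine ⟨?_, ?_⟩
  · refine HasCompactSupport.intro (hαc.isCompact.prod isCompact_univ) fun z hz => ?_
    have : z.1 ∉ tsupport α := fun h => hz ⟨h, mem_univ _⟩
    rw [image_eq_zero_of_notMem_tsupport this, zero_mul]
  · exact (hα.comp contDiff_fst).mul (hβ.comp contDiff_snd)

theorem cylinderLaplacian_mul {d : ℕ} {α : EuclideanSpace ℝ (Fin d) → ℂ}
    (β : AddCircle (2 * Real.pi) → ℂ) (hα : ContDiff ℝ ∞ α) (z : Cylinder d) :
    cylinderLaplacian (fun z : Cylinder d => α z.1 * β z.2) z =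
      (Δ α) z.1 * β z.2 + α z.1 * circleSecondDeriv β z.2 := by
  rw [cylinderLaplacian]
  congr 1
  · have h : (fun y : EuclideanSpace ℝ (Fin d) => α y * β z.2) = (β z.2) • α := by
      funext y
      rw [Pi.smul_apply, smul_eq_mul, mul_comm]
    simp only [h]
    rw [InnerProductSpace.laplacian_smul _ ((hα.of_le two_le_infty).contDiffAt), smul_eq_mul,
      mul_comm]
  · simp only
    rw [iteratedDeriv_const_mul_field, circleSecondDeriv]

theorem continuous_laplacian {d : ℕ} {α : EuclideanSpace ℝ (Fin d) → ℂ} (hα : ContDiff ℝ ∞ α) :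
    Continuous (Δ α) := by
  rw [InnerProductSpace.laplacian_eq_iteratedFDeriv_stdOrthonormalBasis]
  refine continuous_finsetSum _ fun i _ => ?_
  have := hα.continuous_iteratedFDeriv (m := 2) two_le_infty
  fun_prop

theorem hasCompactSupport_laplacian {d : ℕ} {α : EuclideanSpace ℝ (Fin d) → ℂ}
    (hα : HasCompactSupport α) : HasCompactSupport (Δ α) := by
  refine HasCompactSupport.intro (hα.iteratedFDeriv (𝕜 := ℝ) 2).isCompact fun y hy => ?_
  rw [InnerProductSpace.laplacian_eq_iteratedFDeriv_stdOrthonormalBasis]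
  simp only [image_eq_zero_of_notMem_tsupport hy]
  simp

theorem hasCompactSupport_mul_snd {d : ℕ} {α : EuclideanSpace ℝ (Fin d) → ℂ}
    (β : AddCircle (2 * Real.pi) → ℂ) (hα : HasCompactSupport α) :
    HasCompactSupport fun z : Cylinder d => α z.1 * β z.2 := by
  refine HasCompactSupport.intro (hα.isCompact.prod isCompact_univ) fun z hz => ?_
  have : z.1 ∉ tsupport α := fun h => hz ⟨h, mem_univ _⟩
  rw [image_eq_zero_of_notMem_tsupport this, zero_mul]

/-! ### The equation in differentiated form -/

/-- The integrand in the time-integrated equation is continuous in time, since both pairings are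
continuous on L². The fundamental theorem of calculus then turns the weak equation into a classical
derivative. -/
theorem IsNLSSolution.hasDerivAt_integral_mul {d : ℕ} {p : ℝ} {u : ℝ → L2Cylinder d}
    (hu : IsNLSSolution d p u) (hp : 1 < p) (hp2 : p ≤ 2) {ψ : Cylinder d → ℂ}
    (hψ : IsTestFunction ψ) (hψc : Continuous ψ) (hΔ : Continuous (cylinderLaplacian ψ))
    (hΔc : HasCompactSupport (cylinderLaplacian ψ)) (t : ℝ) :
    HasDerivAt (fun s => ∫ z, u s z * ψ z)
      (-Complex.I * ((∫ z, powerNonlinearity p (u t z) * ψ z) -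
        ∫ z, u t z * cylinderLaplacian ψ z)) t := by
  have hg : Continuous fun s => (∫ z, powerNonlinearity p (u s z) * ψ z) -
        ∫ z, u s z * cylinderLaplacian ψ z :=
    ((continuous_integral_powerNonlinearity_mul hp hp2 hψc hψ.1).comp hu.continuous).sub
      ((continuous_integral_Lp_mul (hΔ.memLp_of_hasCompactSupport hΔc)).comp hu.continuous)
  have h1 := intervalIntegral.integral_hasDerivAt_right (hg.intervalIntegrable t t)
    (hg.stronglyMeasurableAtFilter _ _) hg.continuousAt
  have h2 := (h1.const_mul (-Complex.I)).add_const (∫ z, u t z * ψ z)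
  refine h2.congr_of_eventuallyEq (Eventually.of_forall fun s => ?_)
  have h3 := hu.equation ψ hψ t s
  have h4 : ∫ r in t..s, ((∫ z, powerNonlinearity p (u r z) * ψ z) -
        ∫ z, u r z * cylinderLaplacian ψ z) =
      Complex.I * ((∫ z, u s z * ψ z) - ∫ z, u t z * ψ z) := h3.symm
  simp only
  rw [h4]
  linear_combination ((∫ z, u s z * ψ z) - ∫ z, u t z * ψ z) * Complex.I_sq

/-- A product rule in which `u` is differentiable only after pairing. `W s` is expanded to first
order at `t₀`: the frozen test function gives `D`, the linear term gives the second summand, and the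
remainder is o(|s - t₀|) in L² because `W'` is continuous and all supports lie in `K`. -/
theorem hasDerivAt_integral_mul_of_moving_test {d : ℕ} {u : ℝ → L2Cylinder d} {t₀ : ℝ}
    (hu : ContinuousAt u t₀) {W W' : ℝ → Cylinder d → ℂ} {K : Set (Cylinder d)} (hK : IsCompact K)
    {δ : ℝ} (hδ : 0 < δ) (hWK : ∀ s ∈ Metric.ball t₀ δ, ∀ z ∉ K, W s z = 0)
    (hW : ∀ s ∈ Metric.ball t₀ δ, ∀ z, HasDerivAt (fun r => W r z) (W' s z) s)
    (hWc : ∀ s, Continuous (W s))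
    (hW'c : ContinuousOn (Function.uncurry W') (Metric.ball t₀ δ ×ˢ univ)) {D : ℂ}
    (hD : HasDerivAt (fun s => ∫ z, u s z * W t₀ z) D t₀) :
    HasDerivAt (fun s => ∫ z, u s z * W s z) (D + ∫ z, u t₀ z * W' t₀ z) t₀ := by
  have hball : Metric.ball t₀ δ ∈ 𝓝 t₀ := Metric.ball_mem_nhds t₀ hδ
  have ht₀ : t₀ ∈ Metric.ball t₀ δ := Metric.mem_ball_self hδ
  have hW'K : ∀ s ∈ Metric.ball t₀ δ, ∀ z ∉ K, W' s z = 0 := by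
    intro s hs z hz
    refine (hW s hs z).unique ((hasDerivAt_const s (0 : ℂ)).congr_of_eventuallyEq ?_)
    filter_upwards [Metric.isOpen_ball.mem_nhds hs] with r hr
    exact hWK r hr z hz
  have hW'c₀ : Continuous (W' t₀) := by
    rw [← continuousOn_univ]
    exact hW'c.comp (f := fun z => (t₀, z)) (by fun_prop) fun z _ => ⟨ht₀, mem_univ _⟩
  have hmem : ∀ s ∈ Metric.ball t₀ δ, MemLp (W s) 2 (volume : Measure (Cylinder d)) := fun s hs =>
    (hWc s).memLp_of_hasCompactSupport (HasCompactSupport.intro hK fun z hz => hWK s hs z hz)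
  have hmem' : MemLp (W' t₀) 2 (volume : Measure (Cylinder d)) :=
    hW'c₀.memLp_of_hasCompactSupport (HasCompactSupport.intro hK fun z hz => hW'K t₀ ht₀ z hz)
  have hunif : ∀ ε > 0, ∀ᶠ s in 𝓝 t₀, ∀ z ∈ K, ‖W' s z - W' t₀ z‖ < ε := by
    intro ε hε
    refine hK.eventually_forall_of_forall_eventually fun z _ => ?_
    have h1 : ContinuousAt (Function.uncurry W') (t₀, z) :=
      hW'c.continuousAt ((Metric.isOpen_ball.prod isOpen_univ).mem_nhds ⟨ht₀, mem_univ _⟩)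
    have h2 : ContinuousAt (fun q : ℝ × Cylinder d => ‖W' q.1 q.2 - W' t₀ q.2‖) (t₀, z) :=
      (ContinuousAt.sub h1 (hW'c₀.continuousAt.comp continuousAt_snd)).norm
    have h3 := h2.eventually (gt_mem_nhds (show ‖W' t₀ z - W' t₀ z‖ < ε by simpa using hε))
    exact h3
  set κ := (eLpNorm (K.indicator fun _ => (1 : ℂ)) 2 (volume : Measure (Cylinder d))).toReal with hκ
  have hκm : MemLp (K.indicator fun _ => (1 : ℂ)) 2 (volume : Measure (Cylinder d)) :=
    memLp_indicator_const 2 hK.measurableSet 1 (Or.inr hK.measure_lt_top.ne)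
  have hκ0 : 0 ≤ κ := ENNReal.toReal_nonneg
  have hmean : ∀ ε > 0, ∀ᶠ s in 𝓝 t₀, ∀ z, ‖W s z - W t₀ z - ((s - t₀ : ℝ) : ℂ) * W' t₀ z‖ ≤
      ε * |s - t₀| * ‖K.indicator (fun _ => (1 : ℂ)) z‖ := by
    intro ε hε
    obtain ⟨η, hη, hηs⟩ := Metric.eventually_nhds_iff_ball.1 ((hunif ε hε).and hball)
    filter_upwards [Metric.ball_mem_nhds t₀ hη] with s hs z
    by_cases hz : z ∈ K
    · rw [indicator_of_mem hz, norm_one, mul_one]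
      -- Mean value inequality for `W` minus its linear part, whose derivative `W' r z - W' t₀ z` is
      -- smaller than ε on the ball.
      have h := (convex_ball t₀ η).norm_image_sub_le_of_norm_hasDerivWithin_le
        (f := fun r : ℝ => W r z - ((r - t₀ : ℝ) : ℂ) * W' t₀ z)
        (f' := fun r => W' r z - W' t₀ z) (C := ε) (x := t₀) (y := s)
        (fun r hr => ?_) (fun r hr => ((hηs r hr).1 z hz).le) (Metric.mem_ball_self hη) hs
      · simp only [sub_self, Complex.ofReal_zero, zero_mul, sub_zero, Real.norm_eq_abs] at h
        rw [sub_right_comm]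
        exact h
      · have h1 : HasDerivAt (fun r : ℝ => ((r - t₀ : ℝ) : ℂ) * W' t₀ z) (1 * W' t₀ z) r :=
          (((hasDerivAt_id r).sub_const t₀).ofReal_comp.mul_const _)
        rw [one_mul] at h1
        exact ((hW r (hηs r hr).2 z).sub h1).hasDerivWithinAt
    · rw [hWK s (hηs s hs).2 z hz, hWK t₀ ht₀ z hz, hW'K t₀ ht₀ z hz]
      simp only [sub_self, mul_zero, norm_zero]
      positivity
  have h3 : HasDerivAt (fun s => ∫ z, u s z * (W s z - W t₀ z - ((s - t₀ : ℝ) : ℂ) * W' t₀ z))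
      0 t₀ := by
    rw [hasDerivAt_iff_isLittleO, Asymptotics.isLittleO_iff]
    intro c hc
    set B := ‖u t₀‖ + 1 with hB
    have hBpos : 0 < B := by positivity
    have hub : ∀ᶠ s in 𝓝 t₀, ‖u s‖ < B :=
      hu.norm.eventually (gt_mem_nhds (by rw [hB]; linarith))
    -- The denominator has κ + 1 because κ may vanish.
    filter_upwards [hmean (c / (B * (κ + 1))) (by positivity), hub, hball] with s hs hsB hsb
    have hm : MemLp (fun z => W s z - W t₀ z - ((s - t₀ : ℝ) : ℂ) * W' t₀ z) 2
        (volume : Measure (Cylinder d)) :=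
      ((hmem s hsb).sub (hmem t₀ ht₀)).sub (hmem'.const_mul _)
    have he : (eLpNorm (fun z => W s z - W t₀ z - ((s - t₀ : ℝ) : ℂ) * W' t₀ z) 2
        (volume : Measure (Cylinder d))).toReal ≤ c / (B * (κ + 1)) * |s - t₀| * κ := by
      have := eLpNorm_le_mul_eLpNorm_of_ae_le_mul (p := 2) (Eventually.of_forall hs :
        ∀ᵐ z ∂(volume : Measure (Cylinder d)), _)
      refine (ENNReal.toReal_mono (ENNReal.mul_ne_top ENNReal.ofReal_ne_top
        hκm.eLpNorm_ne_top) this).trans_eq ?_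
      rw [ENNReal.toReal_mul, ENNReal.toReal_ofReal (by positivity)]
    simp only [sub_self, Complex.ofReal_zero, zero_mul, mul_zero, integral_zero, sub_zero,
      smul_zero, Real.norm_eq_abs]
    refine (norm_integral_Lp_mul_le hm (u s)).trans ?_
    calc ‖u s‖ * _ ≤ B * (c / (B * (κ + 1)) * |s - t₀| * κ) := by gcongr
      _ = c * |s - t₀| * (κ / (κ + 1)) := by field_simp
      _ ≤ c * |s - t₀| * 1 := by
          gcongr
          rw [div_le_one (by linarith)]
          linarith
      _ = c * |s - t₀| := mul_one _
  -- The integral is merely continuous in s; the factor s - t₀ makes the product differentiable at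
  -- `t₀` all the same.
  have h4 : HasDerivAt (fun s : ℝ => ((s - t₀ : ℝ) : ℂ) * ∫ z, u s z * W' t₀ z)
      (∫ z, u t₀ z * W' t₀ z) t₀ := by
    rw [hasDerivAt_iff_tendsto_slope]
    have hc : ContinuousAt (fun s => ∫ z, u s z * W' t₀ z) t₀ :=
      (continuous_integral_Lp_mul hmem').continuousAt.comp hu
    refine (hc.tendsto.mono_left nhdsWithin_le_nhds).congr' ?_
    filter_upwards [self_mem_nhdsWithin] with s hs
    have hne : ((s - t₀ : ℝ) : ℂ) ≠ 0 := Complex.ofReal_ne_zero.2 (sub_ne_zero.2 hs)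
    rw [slope_def_module]
    simp only [sub_self, Complex.ofReal_zero, zero_mul, sub_zero]
    rw [Complex.real_smul, ← mul_assoc, Complex.ofReal_inv, inv_mul_cancel₀ hne, one_mul]
  have h5 := (hD.add h3).add h4
  rw [add_zero] at h5
  refine h5.congr_of_eventuallyEq ?_
  filter_upwards [hball] with s hs
  have i1 := integrable_mul_of_memLp_two (Lp.memLp (u s)) (hmem t₀ ht₀)
  have i2 := integrable_mul_of_memLp_two (Lp.memLp (u s)) (hmem s hs)
  have i3 := integrable_mul_of_memLp_two (Lp.memLp (u s)) hmem'
  have i4 := i3.const_mul ((s - t₀ : ℝ) : ℂ)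
  have i5 := (i2.sub i1).sub i4
  simp only [Pi.add_apply]
  rw [← integral_const_mul, ← integral_add i1 (i5.congr (Eventually.of_forall fun z => ?_)),
    ← integral_add _ i4]
  · refine integral_congr_ae (Eventually.of_forall fun z => ?_)
    simp only
    ring
  · refine (i1.add i5).congr (Eventually.of_forall fun z => ?_)
    simp only [Pi.add_apply, Pi.sub_apply]
    ring
  · simp only [Pi.sub_apply]
    ring

/-! ### Mollifiers on the cylinder -/

/-! ### The Laplacian under reflection, translation and complexification. -/

theorem laplacian_comp_neg {V F : Type*} [NormedAddCommGroup V] [InnerProductSpace ℝ V]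
    [FiniteDimensional ℝ V] [NormedAddCommGroup F] [NormedSpace ℝ F] {f : V → F}
    (hf : ContDiff ℝ ∞ f) (y : V) : (Δ (fun x => f (-x))) y = (Δ f) (-y) := by
  rw [InnerProductSpace.laplacian_eq_iteratedFDeriv_stdOrthonormalBasis,
    InnerProductSpace.laplacian_eq_iteratedFDeriv_stdOrthonormalBasis]
  refine Finset.sum_congr rfl fun i _ => ?_
  have h : (fun x => f (-x)) = f ∘ (-ContinuousLinearMap.id ℝ V) := by
    funext x; simp
  rw [h, ContinuousLinearMap.iteratedFDeriv_comp_right _ hf _ (i := 2) two_le_infty]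
  simp only [ContinuousMultilinearMap.compContinuousLinearMap_apply, neg_apply,
    ContinuousLinearMap.id_apply]
  have h2 := (iteratedFDeriv ℝ 2 f (-y)).map_smul_univ (fun _ => (-1 : ℝ))
    ![stdOrthonormalBasis ℝ V i, stdOrthonormalBasis ℝ V i]
  simp only [neg_smul, one_smul, Fin.prod_univ_two, mul_neg, mul_one, neg_neg] at h2
  exact h2

theorem laplacian_comp_sub {V F : Type*} [NormedAddCommGroup V] [InnerProductSpace ℝ V]
    [FiniteDimensional ℝ V] [NormedAddCommGroup F] [NormedSpace ℝ F] (f : V → F) (a y : V) :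
    (Δ (fun x => f (x - a))) y = (Δ f) (y - a) := by
  rw [InnerProductSpace.laplacian_eq_iteratedFDeriv_stdOrthonormalBasis,
    InnerProductSpace.laplacian_eq_iteratedFDeriv_stdOrthonormalBasis]
  refine Finset.sum_congr rfl fun i _ => ?_
  simp only [sub_eq_add_neg]
  rw [iteratedFDeriv_comp_add_right]

theorem laplacian_ofReal {V : Type*} [NormedAddCommGroup V] [InnerProductSpace ℝ V]
    [FiniteDimensional ℝ V] {f : V → ℝ} (hf : ContDiff ℝ ∞ f) (y : V) :
    (Δ (fun x => (f x : ℂ))) y = (((Δ f) y : ℝ) : ℂ) :=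
  (hf.of_le two_le_infty).contDiffAt.laplacian_CLM_comp_left (l := Complex.ofRealCLM)

theorem circleSecondDeriv_coe_eq_laplacian (β : AddCircle (2 * Real.pi) → ℂ) (s : ℝ) :
    circleSecondDeriv β (s : AddCircle (2 * Real.pi)) =
      (Δ (fun r : ℝ => β (r : AddCircle (2 * Real.pi)))) s := by
  rw [circleSecondDeriv_coe, InnerProductSpace.laplacian_eq_iteratedDeriv_real]

/-- An even nonnegative product test function of integral one. -/
structure Mollifier (d : ℕ) where
  /-- the Euclidean factor -/
  α : EuclideanSpace ℝ (Fin d) → ℝ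
  /-- the circle factor -/
  β : AddCircle (2 * Real.pi) → ℝ
  contDiff_α : ContDiff ℝ ∞ α
  hasCompactSupport_α : HasCompactSupport α
  contDiff_β : ContDiff ℝ ∞ fun s : ℝ => β (s : AddCircle (2 * Real.pi))
  nonneg_α : ∀ y, 0 ≤ α y
  nonneg_β : ∀ x, 0 ≤ β x
  even_α : ∀ y, α (-y) = α y
  even_β : ∀ x, β (-x) = β x
  integral_eq_one : ∫ z : Cylinder d, α z.1 * β z.2 = 1

namespace Mollifier

variable {d : ℕ} (k : Mollifier d)

/-- The kernel of a mollifier. -/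
noncomputable def kernel (z : Cylinder d) : ℂ := (k.α z.1 : ℂ) * (k.β z.2 : ℂ)

theorem contDiff_α' : ContDiff ℝ ∞ fun y => (k.α y : ℂ) :=
  Complex.ofRealCLM.contDiff.comp k.contDiff_α

theorem contDiff_β' : ContDiff ℝ ∞ fun s : ℝ => (k.β (s : AddCircle (2 * Real.pi)) : ℂ) :=
  Complex.ofRealCLM.contDiff.comp k.contDiff_β

theorem hasCompactSupport_α' : HasCompactSupport fun y => (k.α y : ℂ) :=
  k.hasCompactSupport_α.comp_left (g := fun r : ℝ => (r : ℂ)) Complex.ofReal_zero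

theorem continuous_β : Continuous k.β :=
  continuous_of_continuous_comp_coe k.contDiff_β.continuous

theorem continuous_kernel : Continuous k.kernel := by
  have h1 : Continuous fun y => (k.α y : ℂ) := k.contDiff_α'.continuous
  have h2 : Continuous fun x => (k.β x : ℂ) := Complex.continuous_ofReal.comp k.continuous_β
  exact (h1.comp continuous_fst).mul (h2.comp continuous_snd)

theorem hasCompactSupport_kernel : HasCompactSupport k.kernel :=
  hasCompactSupport_mul_snd (α := fun y => (k.α y : ℂ)) (fun x => (k.β x : ℂ))
    k.hasCompactSupport_α'

theorem kernel_eq_ofReal (z : Cylinder d) : k.kernel z = ((k.α z.1 * k.β z.2 : ℝ) : ℂ) := by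
  rw [kernel, Complex.ofReal_mul]

theorem conj_kernel (z : Cylinder d) : (starRingEnd ℂ) (k.kernel z) = k.kernel z := by
  rw [kernel_eq_ofReal, Complex.conj_ofReal]

theorem kernel_neg (z : Cylinder d) : k.kernel (-z) = k.kernel z := by
  rw [kernel, kernel, Prod.fst_neg, Prod.snd_neg, k.even_α, k.even_β]

theorem norm_kernel (z : Cylinder d) : ‖k.kernel z‖ = k.α z.1 * k.β z.2 := by
  rw [kernel_eq_ofReal, Complex.norm_real,
    Real.norm_of_nonneg (mul_nonneg (k.nonneg_α _) (k.nonneg_β _))]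

theorem integral_norm_kernel : ∫ z, ‖k.kernel z‖ = 1 := by
  simp only [norm_kernel, k.integral_eq_one]

theorem integrable_kernel : Integrable k.kernel :=
  k.continuous_kernel.integrable_of_hasCompactSupport k.hasCompactSupport_kernel

theorem lintegral_enorm_kernel : ∫⁻ z, ‖k.kernel z‖ₑ = 1 := by
  rw [← ofReal_integral_norm_eq_lintegral_enorm k.integrable_kernel, integral_norm_kernel,
    ENNReal.ofReal_one]

theorem integral_kernel : ∫ z, k.kernel z = 1 := by
  simp only [kernel_eq_ofReal]
  rw [integral_complex_ofReal, k.integral_eq_one, Complex.ofReal_one]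

/-- The Laplacian of the kernel of a mollifier. -/
noncomputable def lap (z : Cylinder d) : ℂ :=
  (((Δ k.α) z.1 : ℝ) : ℂ) * (k.β z.2 : ℂ) +
    (k.α z.1 : ℂ) * circleSecondDeriv (fun x => (k.β x : ℂ)) z.2

theorem continuous_lap : Continuous k.lap := by
  have h1 : Continuous fun y => (k.α y : ℂ) := k.contDiff_α'.continuous
  have h2 := k.continuous_β
  have h3 := continuous_circleSecondDeriv (β := fun x => (k.β x : ℂ)) k.contDiff_β'
  have h4 := continuous_laplacian k.contDiff_α'
  have h5 : (fun y => (((Δ k.α) y : ℝ) : ℂ)) = Δ fun y => (k.α y : ℂ) :=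
    funext fun y => (laplacian_ofReal k.contDiff_α y).symm
  rw [← h5] at h4
  unfold lap
  exact ((h4.comp continuous_fst).mul (Complex.continuous_ofReal.comp (h2.comp continuous_snd))).add
    ((h1.comp continuous_fst).mul (h3.comp continuous_snd))

theorem hasCompactSupport_lap : HasCompactSupport k.lap := by
  have h5 : (Δ fun y => (k.α y : ℂ)) = fun y => (((Δ k.α) y : ℝ) : ℂ) :=
    funext fun y => laplacian_ofReal k.contDiff_α y
  have h0 := hasCompactSupport_laplacian k.hasCompactSupport_α'
  rw [h5] at h0
  have h1 := hasCompactSupport_mul_snd (α := fun y => (((Δ k.α) y : ℝ) : ℂ)) (fun x => (k.β x : ℂ)) h0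
  have h2 := hasCompactSupport_mul_snd (α := fun y => (k.α y : ℂ))
    (circleSecondDeriv fun x => (k.β x : ℂ)) k.hasCompactSupport_α'
  exact h1.add h2

theorem integrable_lap : Integrable k.lap :=
  k.continuous_lap.integrable_of_hasCompactSupport k.hasCompactSupport_lap

/-- Reality and, with `lap_neg`, evenness of this kernel are all that the mass argument needs in
place of the self-adjointness of Δ. -/
theorem conj_lap (z : Cylinder d) : (starRingEnd ℂ) (k.lap z) = k.lap z := by
  obtain ⟨s, hs⟩ := QuotientAddGroup.mk_surjective z.2
  have h : circleSecondDeriv (fun x => (k.β x : ℂ)) z.2 =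
      (((Δ fun r : ℝ => k.β (r : AddCircle (2 * Real.pi))) s : ℝ) : ℂ) := by
    rw [← hs]
    exact (circleSecondDeriv_coe_eq_laplacian _ s).trans (laplacian_ofReal k.contDiff_β s)
  rw [lap, h]
  simp only [map_add, map_mul, Complex.conj_ofReal]

theorem lap_neg (z : Cylinder d) : k.lap (-z) = k.lap z := by
  obtain ⟨s, hs⟩ := QuotientAddGroup.mk_surjective z.2
  have h1 : (Δ k.α) (-z.1) = (Δ k.α) z.1 := by
    rw [← laplacian_comp_neg k.contDiff_α]
    simp only [k.even_α]
  have h2 : circleSecondDeriv (fun x => (k.β x : ℂ)) (-z.2) =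
      circleSecondDeriv (fun x => (k.β x : ℂ)) z.2 := by
    rw [← hs]
    have e := circleSecondDeriv_coe_eq_laplacian (fun x => (k.β x : ℂ)) (-s)
    rw [← laplacian_comp_neg k.contDiff_β'] at e
    simp only [AddCircle.coe_neg, k.even_β] at e
    exact e.trans (circleSecondDeriv_coe_eq_laplacian (fun x => (k.β x : ℂ)) s).symm
  rw [lap, lap, Prod.fst_neg, Prod.snd_neg, h1, h2, k.even_α, k.even_β]

theorem isTestFunction_kernel_sub (z : Cylinder d) :
    IsTestFunction fun z' : Cylinder d => k.kernel (z' - z) := by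
  obtain ⟨s, hs⟩ := QuotientAddGroup.mk_surjective z.2
  have h1 : ContDiff ℝ ∞ fun y => (k.α (y - z.1) : ℂ) :=
    k.contDiff_α'.comp (contDiff_id.sub contDiff_const)
  have h2 : ContDiff ℝ ∞ fun r : ℝ => (k.β ((r : AddCircle (2 * Real.pi)) - z.2) : ℂ) := by
    have := k.contDiff_β'.comp (contDiff_id.sub (contDiff_const (c := s)))
    rw [← hs]
    exact this
  exact isTestFunction_mul (α := fun y => (k.α (y - z.1) : ℂ)) (β := fun x => (k.β (x - z.2) : ℂ))
    h1 (k.hasCompactSupport_α'.comp_homeomorph (Homeomorph.subRight z.1)) h2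

/-- This puts the Laplacian of the mollified equation on the kernel, so that `u` is never
differentiated in space. -/
theorem cylinderLaplacian_kernel_sub (z z' : Cylinder d) :
    cylinderLaplacian (fun z' : Cylinder d => k.kernel (z' - z)) z' = k.lap (z' - z) := by
  have h1 : ContDiff ℝ ∞ fun y => (k.α (y - z.1) : ℂ) :=
    k.contDiff_α'.comp (contDiff_id.sub contDiff_const)
  have h := cylinderLaplacian_mul (fun x => (k.β (x - z.2) : ℂ)) h1 z'
  refine h.trans ?_
  rw [laplacian_comp_sub (fun y => (k.α y : ℂ)), laplacian_ofReal k.contDiff_α, lap, Prod.fst_sub,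
    Prod.snd_sub]
  congr 2
  simp only [circleSecondDeriv, add_sub_right_comm]

end Mollifier

/-! ### Even bump functions on the circle and existence of mollifiers. -/

/-- The cosine on the circle. -/
noncomputable def circleCos (x : AddCircle (2 * Real.pi)) : ℝ := (fourier 1 x : ℂ).re

theorem circleCos_coe (s : ℝ) : circleCos (s : AddCircle (2 * Real.pi)) = Real.cos s := by
  rw [circleCos, fourier_coe_apply]
  have h : 2 * (Real.pi : ℂ) * Complex.I * ((1 : ℤ) : ℂ) * s / ((2 * Real.pi : ℝ) : ℂ) =
      s * Complex.I := by
    have : (Real.pi : ℂ) ≠ 0 := Complex.ofReal_ne_zero.2 Real.pi_ne_zero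
    push_cast
    field_simp
  rw [h, Complex.exp_ofReal_mul_I_re]

theorem continuous_circleCos : Continuous circleCos :=
  Complex.continuous_re.comp (fourier 1).continuous

theorem circleCos_neg (x : AddCircle (2 * Real.pi)) : circleCos (-x) = circleCos x := by
  obtain ⟨s, rfl⟩ := QuotientAddGroup.mk_surjective x
  have := circleCos_coe (-s)
  rw [AddCircle.coe_neg, Real.cos_neg] at this
  exact this.trans (circleCos_coe s).symm

theorem circleCos_le_one (x : AddCircle (2 * Real.pi)) : circleCos x ≤ 1 := by
  obtain ⟨s, rfl⟩ := QuotientAddGroup.mk_surjective x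
  exact (circleCos_coe s).trans_le (Real.cos_le_one s)

theorem circleCos_eq_one {x : AddCircle (2 * Real.pi)} (h : circleCos x = 1) : x = 0 := by
  obtain ⟨s, rfl⟩ := QuotientAddGroup.mk_surjective x
  have h2 : Real.cos s = 1 := (circleCos_coe s).symm.trans h
  obtain ⟨n, hn⟩ := (Real.cos_eq_one_iff s).1 h2
  refine (AddCircle.coe_eq_zero_iff (2 * Real.pi)).2 ⟨n, ?_⟩
  rw [zsmul_eq_mul, hn]

theorem circleCos_zero : circleCos 0 = 1 := by
  have := circleCos_coe 0
  rwa [Real.cos_zero] at this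

/-- The bump is a smooth cut-off of cos x - c. Evenness and periodicity come from the cosine, which
attains 1 at the origin only. -/
theorem exists_circle_bump {U : Set (AddCircle (2 * Real.pi))} (hU : U ∈ 𝓝 0) :
    ∃ β : AddCircle (2 * Real.pi) → ℝ, (ContDiff ℝ ∞ fun s : ℝ => β (s : AddCircle (2 * Real.pi))) ∧
      (∀ x, 0 ≤ β x) ∧ (∀ x, β (-x) = β x) ∧ Function.support β ⊆ U ∧ ∫ x, β x = 1 := by
  -- By compactness the cosine attains its maximum off an open neighbourhood of 0 contained in `U`,
  -- and this maximum is below 1; it serves as c.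
  obtain ⟨c, hc1, hc⟩ : ∃ c < 1, ∀ x, c < circleCos x → x ∈ U := by
    obtain ⟨O, hOU, hO, h0⟩ := mem_nhds_iff.1 hU
    rcases (Oᶜ).eq_empty_or_nonempty with h | h
    · refine ⟨0, one_pos, fun x _ => hOU ?_⟩
      by_contra hx
      exact (h ▸ hx : x ∈ (∅ : Set _))
    · obtain ⟨x₀, hx₀, hmax⟩ := hO.isClosed_compl.isCompact.exists_isMaxOn h
        continuous_circleCos.continuousOn
      refine ⟨circleCos x₀, lt_of_le_of_ne (circleCos_le_one _) fun h1 => hx₀ ?_, fun x hx => ?_⟩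
      · rw [circleCos_eq_one h1]; exact h0
      · by_contra hxU
        exact absurd (hmax (show x ∈ Oᶜ from fun h => hxU (hOU h))) (not_le.2 hx)
  set f : AddCircle (2 * Real.pi) → ℝ := fun x => Real.smoothTransition (circleCos x - c) with hf
  have hfc : Continuous f := by
    have := continuous_circleCos
    have h2 : Continuous Real.smoothTransition := Real.smoothTransition.continuous
    fun_prop
  have hint : Integrable f := hfc.integrable_of_hasCompactSupport (HasCompactSupport.of_compactSpace f)
  have hpos : 0 < ∫ x, f x := by
    refine hfc.integral_pos_of_hasCompactSupport_nonneg_nonzero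
      (HasCompactSupport.of_compactSpace f) (fun x => Real.smoothTransition.nonneg _) (x := 0) ?_
    rw [hf]
    simp only [circleCos_zero]
    exact (Real.smoothTransition.pos_of_pos (by linarith)).ne'
  refine ⟨fun x => f x / ∫ x, f x, ?_, ?_, ?_, ?_, ?_⟩
  · refine ContDiff.div_const ?_ _
    simp only [hf, circleCos_coe]
    exact Real.smoothTransition.contDiff.comp (Real.contDiff_cos.sub contDiff_const)
  · exact fun x => div_nonneg (Real.smoothTransition.nonneg _) hpos.le
  · intro x
    simp only [hf, circleCos_neg]
  · intro x hx
    refine hc x ?_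
    by_contra hle
    refine hx ?_
    simp only [hf]
    rw [Real.smoothTransition.zero_of_nonpos (by linarith), zero_div]
  · rw [integral_div, div_self hpos.ne']

theorem exists_mollifier (d : ℕ) {U : Set (Cylinder d)} (hU : U ∈ 𝓝 0) :
    ∃ k : Mollifier d, Function.support k.kernel ⊆ U := by
  rw [show (0 : Cylinder d) = (0, 0) from rfl, nhds_prod_eq, mem_prod_iff] at hU
  obtain ⟨U₁, hU₁, U₂, hU₂, hUU⟩ := hU
  obtain ⟨ε, hε, hball⟩ := Metric.mem_nhds_iff.1 hU₁
  obtain ⟨β, h1, h2, h3, h4, h5⟩ := exists_circle_bump hU₂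
  let φ : ContDiffBump (0 : EuclideanSpace ℝ (Fin d)) := ⟨ε / 2, ε, by linarith, by linarith⟩
  refine ⟨⟨φ.normed volume, β, φ.contDiff_normed, φ.hasCompactSupport_normed, h1,
    φ.nonneg_normed, h2, φ.normed_neg, h3, ?_⟩, ?_⟩
  · rw [Measure.volume_eq_prod, integral_prod_mul (f := φ.normed volume), φ.integral_normed, h5,
      mul_one]
  · intro z hz
    rw [Function.mem_support, Mollifier.kernel] at hz
    refine hUU ⟨hball ?_, h4 fun h => hz (by simp [h])⟩
    have : z.1 ∈ Function.support (φ.normed volume) := fun h => hz (by simp [h])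
    rwa [φ.support_normed_eq] at this

/-! ### Invariance of the measure on the cylinder under translation and reflection. -/

instance isAddLeftInvariant_cylinder (d : ℕ) :
    (volume : Measure (Cylinder d)).IsAddLeftInvariant :=
  inferInstanceAs ((volume : Measure (EuclideanSpace ℝ (Fin d))).prod
    (volume : Measure (AddCircle (2 * Real.pi)))).IsAddLeftInvariant

instance isNegInvariant_prod {X Y : Type*} [AddGroup X] [AddGroup Y] [MeasurableSpace X]
    [MeasurableSpace Y] [MeasurableNeg X] [MeasurableNeg Y] (μ : Measure X) (ν : Measure Y)
    [SFinite μ] [SFinite ν] [μ.IsNegInvariant] [ν.IsNegInvariant] : (μ.prod ν).IsNegInvariant := by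
  refine ⟨?_⟩
  have h := Measure.map_prod_map μ ν (f := Neg.neg) (g := Neg.neg) measurable_neg measurable_neg
  rw [Measure.map_neg_eq_self, Measure.map_neg_eq_self] at h
  exact h.symm

instance isNegInvariant_cylinder (d : ℕ) : (volume : Measure (Cylinder d)).IsNegInvariant := by
  rw [Measure.volume_eq_prod]
  exact isNegInvariant_prod _ _

/-! ### Averages of translates -/

section Smear

set_option linter.unusedSectionVars false

variable {X : Type*} [AddCommGroup X] [TopologicalSpace X] [IsTopologicalAddGroup X]
  [MeasurableSpace X] [BorelSpace X] [SecondCountableTopology X]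
  {μ : Measure X} [SFinite μ] [μ.IsAddLeftInvariant]

/-- The average `∫ f(z + w) κ(w) dw` of the translates of `f`. -/
noncomputable def smear (μ : Measure X) (κ f : X → ℂ) (z : X) : ℂ := ∫ w, f (z + w) * κ w ∂μ

/-- The correlation `∫ conj f(z + w) g(z + w') dz`. -/
noncomputable def correlation (μ : Measure X) (f g : X → ℂ) (q : X × X) : ℂ :=
  ∫ z, (starRingEnd ℂ) (f (z + q.1)) * g (z + q.2) ∂μ

theorem smear_eq_integral_sub (κ f : X → ℂ) (z : X) :
    smear μ κ f z = ∫ w, f w * κ (w - z) ∂μ := by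
  have h := integral_add_left_eq_self (μ := μ) (fun w => f w * κ (w - z)) z
  simp only [add_sub_cancel_left] at h
  exact h

theorem stronglyMeasurable_smear {κ f : X → ℂ} (hκ : StronglyMeasurable κ)
    (hf : StronglyMeasurable f) : StronglyMeasurable (smear μ κ f) :=
  StronglyMeasurable.integral_prod_right
    ((hf.comp_measurable measurable_add).mul (hκ.comp_measurable measurable_snd))

/-- The translation z ↦ z + q.1 + q.2 exchanges the two shifts. -/
theorem correlation_neg (f : X → ℂ) (q : X × X) :
    correlation μ f f (-q) = (starRingEnd ℂ) (correlation μ f f q) := by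
  rw [correlation, correlation, ← integral_conj,
    ← integral_add_right_eq_self (μ := μ) _ (q.1 + q.2)]
  refine integral_congr_ae (Eventually.of_forall fun z => ?_)
  simp only [Prod.fst_neg, Prod.snd_neg, map_mul, Complex.conj_conj]
  rw [mul_comm]
  congr 2
  · abel_nf
  · abel_nf

variable {κ₁ κ₂ f g : X → ℂ}

/-- The integrand of the pairing of two averages, as a function of the point and the two shifts. -/
noncomputable def smearIntegrand (κ₁ κ₂ f g : X → ℂ) (z : X) (q : X × X) : ℂ :=
  (starRingEnd ℂ) (f (z + q.1) * κ₁ q.1) * (g (z + q.2) * κ₂ q.2)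

theorem measurable_smearIntegrand (h1 : Measurable κ₁) (h2 : Measurable κ₂)
    (hf : Measurable f) (hg : Measurable g) :
    Measurable (Function.uncurry (smearIntegrand κ₁ κ₂ f g)) := by
  unfold smearIntegrand Function.uncurry
  have hc : Measurable (starRingEnd ℂ) := RCLike.continuous_conj.measurable
  exact (hc.comp ((hf.comp (by fun_prop)).mul (h1.comp (by fun_prop)))).mul
    ((hg.comp (by fun_prop)).mul (h2.comp (by fun_prop)))

theorem lintegral_enorm_smearIntegrand_le (h1 : Measurable κ₁) (h2 : Measurable κ₂)
    (hf : Measurable f) (hg : Measurable g) {C : ENNReal}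
    (hC : ∀ q : X × X, ∫⁻ z, ‖f (z + q.1)‖ₑ * ‖g (z + q.2)‖ₑ ∂μ ≤ C) :
    ∫⁻ z, ∫⁻ q, ‖smearIntegrand κ₁ κ₂ f g z q‖ₑ ∂(μ.prod μ) ∂μ ≤
      (∫⁻ w, ‖κ₁ w‖ₑ ∂μ) * (∫⁻ w, ‖κ₂ w‖ₑ ∂μ) * C := by
  have hm := (measurable_smearIntegrand h1 h2 hf hg).enorm
  rw [lintegral_lintegral_swap hm.aemeasurable, ← lintegral_prod_mul h1.enorm.aemeasurable
    h2.enorm.aemeasurable, ← lintegral_mul_const _ (by fun_prop)]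
  refine lintegral_mono fun q => ?_
  calc ∫⁻ z, ‖smearIntegrand κ₁ κ₂ f g z q‖ₑ ∂μ
      = ∫⁻ z, ‖κ₁ q.1‖ₑ * ‖κ₂ q.2‖ₑ * (‖f (z + q.1)‖ₑ * ‖g (z + q.2)‖ₑ) ∂μ := by
        refine lintegral_congr fun z => ?_
        have hconj : ∀ w : ℂ, ‖(starRingEnd ℂ) w‖ₑ = ‖w‖ₑ := fun w => by
          rw [← ofReal_norm, RCLike.norm_conj, ofReal_norm]
        rw [smearIntegrand, enorm_mul, hconj, enorm_mul, enorm_mul]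
        ring
    _ = ‖κ₁ q.1‖ₑ * ‖κ₂ q.2‖ₑ * ∫⁻ z, ‖f (z + q.1)‖ₑ * ‖g (z + q.2)‖ₑ ∂μ :=
        lintegral_const_mul _ (by fun_prop)
    _ ≤ _ := by gcongr; exact hC q

theorem integral_smearIntegrand (z : X) :
    ∫ q, smearIntegrand κ₁ κ₂ f g z q ∂(μ.prod μ) =
      (starRingEnd ℂ) (smear μ κ₁ f z) * smear μ κ₂ g z := by
  rw [smear, smear, ← integral_conj, ← integral_prod_mul]
  rfl

theorem integrable_smearIntegrand (h1 : Measurable κ₁) (h2 : Measurable κ₂)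
    (h1i : Integrable κ₁ μ) (h2i : Integrable κ₂ μ)
    (hf : Measurable f) (hg : Measurable g) {C : ENNReal} (hCtop : C ≠ ⊤)
    (hC : ∀ q : X × X, ∫⁻ z, ‖f (z + q.1)‖ₑ * ‖g (z + q.2)‖ₑ ∂μ ≤ C) :
    Integrable (Function.uncurry (smearIntegrand κ₁ κ₂ f g)) (μ.prod (μ.prod μ)) := by
  refine ⟨(measurable_smearIntegrand h1 h2 hf hg).aestronglyMeasurable, ?_⟩
  rw [hasFiniteIntegral_iff_enorm, lintegral_prod _
    (measurable_smearIntegrand h1 h2 hf hg).enorm.aemeasurable]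
  refine (lintegral_enorm_smearIntegrand_le h1 h2 hf hg hC).trans_lt ?_
  exact ENNReal.mul_lt_top (ENNReal.mul_lt_top h1i.2 h2i.2) hCtop.lt_top

theorem lintegral_enorm_conj_smear_mul_smear_le (h1 : Measurable κ₁) (h2 : Measurable κ₂)
    (hf : Measurable f) (hg : Measurable g) {C : ENNReal}
    (hC : ∀ q : X × X, ∫⁻ z, ‖f (z + q.1)‖ₑ * ‖g (z + q.2)‖ₑ ∂μ ≤ C) :
    ∫⁻ z, ‖(starRingEnd ℂ) (smear μ κ₁ f z) * smear μ κ₂ g z‖ₑ ∂μ ≤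
      (∫⁻ w, ‖κ₁ w‖ₑ ∂μ) * (∫⁻ w, ‖κ₂ w‖ₑ ∂μ) * C := by
  refine (lintegral_mono fun z => ?_).trans (lintegral_enorm_smearIntegrand_le h1 h2 hf hg hC)
  rw [← integral_smearIntegrand]
  exact enorm_integral_le_lintegral_enorm _

theorem integrable_conj_smear_mul_smear (h1 : Measurable κ₁) (h2 : Measurable κ₂)
    (h1i : Integrable κ₁ μ) (h2i : Integrable κ₂ μ)
    (hf : Measurable f) (hg : Measurable g) {C : ENNReal} (hCtop : C ≠ ⊤)
    (hC : ∀ q : X × X, ∫⁻ z, ‖f (z + q.1)‖ₑ * ‖g (z + q.2)‖ₑ ∂μ ≤ C) :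
    Integrable (fun z => (starRingEnd ℂ) (smear μ κ₁ f z) * smear μ κ₂ g z) μ := by
  have h := (integrable_smearIntegrand h1 h2 h1i h2i hf hg hCtop hC).integral_prod_left
  refine h.congr (Eventually.of_forall fun z => ?_)
  exact integral_smearIntegrand z

/-- Fubini. Only the products of translates of `f` and `g` need a uniform integral bound, so the
statement covers both the pair (u, u) and the pair (u, |u|^{p-1}u), where the second function need
not be in L². -/
theorem integral_conj_smear_mul_smear (h1 : Measurable κ₁) (h2 : Measurable κ₂)
    (h1i : Integrable κ₁ μ) (h2i : Integrable κ₂ μ)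
    (hf : Measurable f) (hg : Measurable g) {C : ENNReal} (hCtop : C ≠ ⊤)
    (hC : ∀ q : X × X, ∫⁻ z, ‖f (z + q.1)‖ₑ * ‖g (z + q.2)‖ₑ ∂μ ≤ C) :
    Integrable (fun q : X × X => (starRingEnd ℂ) (κ₁ q.1) * κ₂ q.2 * correlation μ f g q)
      (μ.prod μ) ∧
    ∫ z, (starRingEnd ℂ) (smear μ κ₁ f z) * smear μ κ₂ g z ∂μ =
      ∫ q, (starRingEnd ℂ) (κ₁ q.1) * κ₂ q.2 * correlation μ f g q ∂(μ.prod μ) := by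
  have h := integrable_smearIntegrand h1 h2 h1i h2i hf hg hCtop hC
  have he : ∀ q : X × X, ∫ z, smearIntegrand κ₁ κ₂ f g z q ∂μ =
      (starRingEnd ℂ) (κ₁ q.1) * κ₂ q.2 * correlation μ f g q := by
    intro q
    rw [correlation, ← integral_const_mul]
    refine integral_congr_ae (Eventually.of_forall fun z => ?_)
    simp only [smearIntegrand, map_mul]
    ring
  refine ⟨h.integral_prod_right.congr (Eventually.of_forall he), ?_⟩
  simp only [← integral_smearIntegrand]
  rw [integral_integral_swap h]
  exact integral_congr_ae (Eventually.of_forall he)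

/-- The reflection q ↦ -q conjugates the correlation and fixes real even kernels, so the integral
equals its own conjugate. With the second kernel a Laplacian, this replaces an integration by parts.
-/
theorem integral_kernel_mul_correlation_im_eq_zero [μ.IsNegInvariant]
    (h1 : ∀ w, κ₁ (-w) = κ₁ w) (h2 : ∀ w, κ₂ (-w) = κ₂ w)
    (h1c : ∀ w, (starRingEnd ℂ) (κ₁ w) = κ₁ w) (h2c : ∀ w, (starRingEnd ℂ) (κ₂ w) = κ₂ w) :
    (∫ q, (starRingEnd ℂ) (κ₁ q.1) * κ₂ q.2 * correlation μ f f q ∂(μ.prod μ)).im = 0 := by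
  refine Complex.conj_eq_iff_im.1 ?_
  rw [← integral_conj, ← integral_neg_eq_self]
  refine integral_congr_ae (Eventually.of_forall fun q => ?_)
  simp only [map_mul, correlation_neg, Prod.fst_neg, Prod.snd_neg, h1, h2, h1c, h2c,
    Complex.conj_conj]

/-! ### Continuity of the correlation -/

/-- Since a b^r ≤ a^{r+1} + b^{r+1}, translation invariance gives a bound uniform in the shifts. It
is used with r = p for the nonlinear term and r = 1 for the mass. -/
theorem lintegral_enorm_mul_enorm_translate_le {r : ℝ} (hr : 0 < r) (hf : Measurable f)
    (hfg : ∀ z, ‖g z‖ₑ = ‖f z‖ₑ ^ r) (q : X × X) :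
    ∫⁻ z, ‖f (z + q.1)‖ₑ * ‖g (z + q.2)‖ₑ ∂μ ≤ 2 * ∫⁻ z, ‖f z‖ₑ ^ (r + 1) ∂μ := by
  have hy : ∀ a b : ENNReal, a * b ^ r ≤ a ^ (r + 1) + b ^ (r + 1) := by
    intro a b
    have e : ∀ c : ENNReal, c * c ^ r = c ^ (r + 1) := fun c => by
      rw [ENNReal.rpow_add_of_nonneg _ _ hr.le zero_le_one, ENNReal.rpow_one, mul_comm]
    rcases le_total a b with h | h
    · calc a * b ^ r ≤ b * b ^ r := by gcongr
        _ = b ^ (r + 1) := e b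
        _ ≤ _ := le_add_self
    · calc a * b ^ r ≤ a * a ^ r := by gcongr
        _ = a ^ (r + 1) := e a
        _ ≤ _ := le_self_add
  calc ∫⁻ z, ‖f (z + q.1)‖ₑ * ‖g (z + q.2)‖ₑ ∂μ
      ≤ ∫⁻ z, (‖f (z + q.1)‖ₑ ^ (r + 1) + ‖f (z + q.2)‖ₑ ^ (r + 1)) ∂μ :=
        lintegral_mono fun z => by rw [hfg]; exact hy _ _
    _ = 2 * ∫⁻ z, ‖f z‖ₑ ^ (r + 1) ∂μ := by
        rw [lintegral_add_left (by fun_prop),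
          lintegral_add_right_eq_self (μ := μ) (fun z => ‖f z‖ₑ ^ (r + 1)) q.1,
          lintegral_add_right_eq_self (μ := μ) (fun z => ‖f z‖ₑ ^ (r + 1)) q.2, two_mul]

variable [T2Space X] [μ.InnerRegularCompactLTTop] [IsLocallyFiniteMeasure μ]

theorem tendsto_eLpNorm_translate_sub {r : ENNReal} (hr1 : 1 ≤ r) (hr : r ≠ ⊤)
    (hf : MemLp f r μ) :
    Tendsto (fun w : X => eLpNorm (fun z => f (z + w) - f z) r μ) (𝓝 0) (𝓝 0) := by
  have : Fact (1 ≤ r) := ⟨hr1⟩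
  have hT : ∀ w : X, MeasurePreserving (fun z => z + w) μ μ := measurePreserving_add_right μ
  let T : X → C(X, X) := fun w => ⟨fun z => z + w, by fun_prop⟩
  have hTc : Continuous T := ContinuousMap.continuous_of_continuous_uncurry T (by
    change Continuous fun q : X × X => q.2 + q.1
    fun_prop)
  have h := (continuous_const (y := hf.toLp f)).compMeasurePreservingLp hTc hT hr
  have h0 := tendsto_iff_edist_tendsto_0.1 (h.tendsto 0)
  refine h0.congr fun w => ?_
  rw [Lp.edist_def]
  refine eLpNorm_congr_ae ?_
  have e1 := Lp.coeFn_compMeasurePreserving (hf.toLp f) (hT w)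
  have e2 := Lp.coeFn_compMeasurePreserving (hf.toLp f) (hT 0)
  have e3 := (hT w).quasiMeasurePreserving.ae_eq hf.coeFn_toLp
  filter_upwards [e1, e2, e3, hf.coeFn_toLp] with z h1 h2 h3 h4
  rw [Pi.sub_apply]
  have h1' : Lp.compMeasurePreserving (T w) (hT w) (hf.toLp f) z = (hf.toLp f) (z + w) := h1
  have h2' : Lp.compMeasurePreserving (T 0) (hT 0) (hf.toLp f) z = (hf.toLp f) (z + 0) := h2
  have h3' : (hf.toLp f) (z + w) = f (z + w) := h3
  rw [h1', h2', h3', add_zero, h4]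

theorem memLp_translate {r : ENNReal} (hf : MemLp f r μ) (w : X) :
    MemLp (fun z => f (z + w)) r μ :=
  hf.comp_measurePreserving (measurePreserving_add_right μ w)

theorem eLpNorm_translate {r : ENNReal} (hf : MemLp f r μ) (w : X) :
    eLpNorm (fun z => f (z + w)) r μ = eLpNorm f r μ :=
  eLpNorm_comp_measurePreserving hf.1 (measurePreserving_add_right μ w)

theorem enorm_integral_conj_mul_le {r s : ENNReal} [ENNReal.HolderTriple r s 1]
    (hf : MemLp f r μ) (hg : MemLp g s μ) :
    ‖∫ z, (starRingEnd ℂ) (f z) * g z ∂μ‖ₑ ≤ eLpNorm f r μ * eLpNorm g s μ := by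
  have hc : AEStronglyMeasurable (fun z => (starRingEnd ℂ) (f z)) μ :=
    RCLike.continuous_conj.comp_aestronglyMeasurable hf.1
  have h := eLpNorm_smul_le_mul_eLpNorm (p := r) (q := s) (r := 1) hg.1 hc
  rw [eLpNorm_one_eq_lintegral_enorm] at h
  refine (enorm_integral_le_lintegral_enorm _).trans (h.trans_eq ?_)
  congr 1
  exact eLpNorm_congr_norm_ae (Eventually.of_forall fun z => RCLike.norm_conj _)

theorem integrable_conj_mul {r s : ENNReal} [ENNReal.HolderTriple r s 1]
    (hf : MemLp f r μ) (hg : MemLp g s μ) :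
    Integrable (fun z => (starRingEnd ℂ) (f z) * g z) μ :=
  memLp_one_iff_integrable.1 (hg.smul (p := r) (q := s) (r := 1) hf.star)

/-- One factor is shifted at a time; Hölder's inequality then reduces the claim to continuity of
translations in L^r and L^s, both exponents being finite. -/
theorem continuousAt_correlation {r s : ENNReal} [ENNReal.HolderTriple r s 1] (hr1 : 1 ≤ r)
    (hr : r ≠ ⊤) (hs1 : 1 ≤ s) (hs : s ≠ ⊤) (hf : MemLp f r μ) (hg : MemLp g s μ) :
    ContinuousAt (correlation μ f g) 0 := by
  rw [ContinuousAt, tendsto_iff_edist_tendsto_0]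
  have hbound : ∀ q : X × X, edist (correlation μ f g q) (correlation μ f g 0) ≤
      eLpNorm (fun z => f (z + q.1) - f z) r μ * eLpNorm g s μ +
        eLpNorm f r μ * eLpNorm (fun z => g (z + q.2) - g z) s μ := by
    intro q
    have hf1 := memLp_translate hf q.1
    have hg1 := memLp_translate hg q.2
    have e : correlation μ f g q - correlation μ f g 0 =
        (∫ z, (starRingEnd ℂ) (f (z + q.1) - f z) * g (z + q.2) ∂μ) +
        ∫ z, (starRingEnd ℂ) (f z) * (g (z + q.2) - g z) ∂μ := by
      have i1 := integrable_conj_mul hf1 hg1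
      have i2 := integrable_conj_mul hf hg
      have i3 : Integrable (fun z => (starRingEnd ℂ) (f (z + q.1) - f z) * g (z + q.2)) μ :=
        integrable_conj_mul (hf1.sub hf) hg1
      have i4 : Integrable (fun z => (starRingEnd ℂ) (f z) * (g (z + q.2) - g z)) μ :=
        integrable_conj_mul hf (hg1.sub hg)
      rw [← integral_add i3 i4]
      simp only [correlation, Prod.fst_zero, Prod.snd_zero, add_zero]
      rw [← integral_sub i1 i2]
      refine integral_congr_ae (Eventually.of_forall fun z => ?_)
      simp only [map_sub]
      ring
    rw [edist_eq_enorm_sub, e]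
    refine (enorm_add_le _ _).trans (add_le_add ?_ ?_)
    · refine (enorm_integral_conj_mul_le (hf1.sub hf) hg1).trans_eq ?_
      rw [eLpNorm_translate hg]
      rfl
    · exact enorm_integral_conj_mul_le hf (hg1.sub hg)
  have hl1 : Tendsto (fun q : X × X => eLpNorm (fun z => f (z + q.1) - f z) r μ * eLpNorm g s μ)
      (𝓝 0) (𝓝 (0 * eLpNorm g s μ)) :=
    ENNReal.Tendsto.mul_const ((tendsto_eLpNorm_translate_sub hr1 hr hf).comp
      (continuous_fst.tendsto (0 : X × X))) (Or.inr hg.eLpNorm_ne_top)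
  have hl2 : Tendsto (fun q : X × X => eLpNorm f r μ * eLpNorm (fun z => g (z + q.2) - g z) s μ)
      (𝓝 0) (𝓝 (eLpNorm f r μ * 0)) :=
    ENNReal.Tendsto.const_mul ((tendsto_eLpNorm_translate_sub hs1 hs hg).comp
      (continuous_snd.tendsto (0 : X × X))) (Or.inr hf.eLpNorm_ne_top)
  have hl := hl1.add hl2
  rw [zero_mul, mul_zero, add_zero] at hl
  exact tendsto_of_tendsto_of_tendsto_of_le_of_le tendsto_const_nhds hl (fun _ => zero_le) hbound

end Smear

/-- The averages of a correlation against mollifiers that concentrate at the origin. -/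
theorem tendsto_integral_kernel_mul_of_continuousAt {d : ℕ} {k : ℕ → Mollifier d}
    (hk : ∀ U ∈ 𝓝 (0 : Cylinder d), ∀ᶠ j in atTop, Function.support (k j).kernel ⊆ U)
    {R : Cylinder d × Cylinder d → ℂ} (hR : ContinuousAt R 0)
    (hint : ∀ j, Integrable (fun q : Cylinder d × Cylinder d =>
      (starRingEnd ℂ) ((k j).kernel q.1) * (k j).kernel q.2 * R q) (volume.prod volume)) :
    Tendsto (fun j => ∫ q : Cylinder d × Cylinder d,
      (starRingEnd ℂ) ((k j).kernel q.1) * (k j).kernel q.2 * R q ∂(volume.prod volume))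
      atTop (𝓝 (R 0)) := by
  rw [Metric.tendsto_nhds]
  intro ε hε
  have h1 : ∀ᶠ q in 𝓝 (0 : Cylinder d × Cylinder d), dist (R q) (R 0) < ε / 2 :=
    hR.eventually (Metric.ball_mem_nhds _ (by positivity))
  rw [show (0 : Cylinder d × Cylinder d) = (0, 0) from rfl, nhds_prod_eq] at h1
  obtain ⟨U₁, hU₁, U₂, hU₂, hUR⟩ := mem_prod_iff.1 h1
  filter_upwards [hk U₁ hU₁, hk U₂ hU₂] with j hj₁ hj₂
  have i1 : Integrable (fun q : Cylinder d × Cylinder d =>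
      (starRingEnd ℂ) ((k j).kernel q.1) * (k j).kernel q.2) (volume.prod volume) := by
    simp only [(k j).conj_kernel]
    exact (k j).integrable_kernel.mul_prod (k j).integrable_kernel
  have e1 : ∫ q : Cylinder d × Cylinder d,
      (starRingEnd ℂ) ((k j).kernel q.1) * (k j).kernel q.2 ∂(volume.prod volume) = 1 := by
    simp only [(k j).conj_kernel]
    rw [integral_prod_mul, (k j).integral_kernel, one_mul]
  have e2 : ∫ q : Cylinder d × Cylinder d,
      ‖(k j).kernel q.1‖ * ‖(k j).kernel q.2‖ ∂(volume.prod volume) = 1 := by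
    rw [integral_prod_mul (f := fun q => ‖(k j).kernel q‖) (g := fun q => ‖(k j).kernel q‖),
      (k j).integral_norm_kernel, one_mul]
  have e3 : R 0 = ∫ q : Cylinder d × Cylinder d,
      (starRingEnd ℂ) ((k j).kernel q.1) * (k j).kernel q.2 * R 0 ∂(volume.prod volume) := by
    rw [integral_mul_const, e1, one_mul]
  rw [dist_eq_norm, e3, ← integral_sub (hint j) (i1.mul_const _)]
  have hle : ‖∫ q : Cylinder d × Cylinder d,
      ((starRingEnd ℂ) ((k j).kernel q.1) * (k j).kernel q.2 * R q -
      (starRingEnd ℂ) ((k j).kernel q.1) * (k j).kernel q.2 * R 0) ∂(volume.prod volume)‖ ≤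
      ∫ q : Cylinder d × Cylinder d,
        ‖(k j).kernel q.1‖ * ‖(k j).kernel q.2‖ * (ε / 2) ∂(volume.prod volume) := by
    have i2 := ((k j).integrable_kernel.norm.mul_prod (k j).integrable_kernel.norm).mul_const (ε / 2)
    refine norm_integral_le_of_norm_le i2 (Eventually.of_forall fun q => ?_)
    rw [← mul_sub, norm_mul, norm_mul, RCLike.norm_conj]
    by_cases hq : (k j).kernel q.1 = 0 ∨ (k j).kernel q.2 = 0
    · rcases hq with h | h <;> simp [h]
    · rw [not_or] at hq
      have : dist (R q) (R 0) < ε / 2 := hUR (mk_mem_prod (hj₁ hq.1) (hj₂ hq.2))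
      rw [dist_eq_norm] at this
      gcongr
  refine hle.trans_lt ?_
  rw [integral_mul_const, e2, one_mul]
  linarith

/-! ### Conservation of mass -/

theorem enorm_powerNonlinearity {p : ℝ} (hp : 1 < p) (z : ℂ) :
    ‖powerNonlinearity p z‖ₑ = ‖z‖ₑ ^ p := by
  rw [← ofReal_norm, ← ofReal_norm, norm_powerNonlinearity hp,
    ENNReal.ofReal_rpow_of_nonneg (norm_nonneg z) (by linarith)]

/-- Fatou's lemma along an almost everywhere convergent subsequence. It provides the measurability
in time of ∫|u(t)|^{p+1}, as `u` is continuous with values in L² only. -/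
theorem lowerSemicontinuous_lintegral_enorm_rpow {α : Type*} [MeasurableSpace α] {μ : Measure α}
    (r : ℝ) :
    LowerSemicontinuous fun f : Lp ℂ 2 μ => ∫⁻ z, ‖f z‖ₑ ^ r ∂μ := by
  rw [lowerSemicontinuous_iff_isClosed_preimage]
  intro y
  refine IsSeqClosed.isClosed fun f g hf hg => ?_
  obtain ⟨ns, _, hns⟩ := (tendstoInMeasure_of_tendsto_Lp hg).exists_seq_tendsto_ae
  have h1 : ∫⁻ z, ‖g z‖ₑ ^ r ∂μ ≤ ∫⁻ z, liminf (fun i => ‖f (ns i) z‖ₑ ^ r) atTop ∂μ := by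
    refine lintegral_mono_ae ?_
    filter_upwards [hns] with z hz
    have : Tendsto (fun i => ‖f (ns i) z‖ₑ ^ r) atTop (𝓝 (‖g z‖ₑ ^ r)) :=
      ((ENNReal.continuous_rpow_const.comp continuous_enorm).tendsto _).comp hz
    exact this.liminf_eq.ge
  refine h1.trans ((lintegral_liminf_le' fun i =>
    ((Lp.aestronglyMeasurable (f (ns i))).enorm.pow_const r)).trans ?_)
  refine liminf_le_of_le (by isBoundedDefault) fun b hb => ?_
  obtain ⟨i, hi⟩ := hb.exists
  exact hi.trans (hf (ns i))

theorem lintegral_enorm_rpow_two {α : Type*} [MeasurableSpace α] {μ : Measure α}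
    (f : Lp ℂ 2 μ) : ∫⁻ z, ‖f z‖ₑ ^ ((1 : ℝ) + 1) ∂μ = ‖f‖ₑ ^ 2 := by
  have h := eLpNorm_eq_lintegral_rpow_enorm_toReal (μ := μ) (f := f) (p := 2) (by norm_num)
    (by norm_num)
  rw [← Lp.enorm_def] at h
  rw [h, ← ENNReal.rpow_natCast, ← ENNReal.rpow_mul]
  norm_num

namespace IsNLSSolution

variable {d : ℕ} {p : ℝ} {u : ℝ → L2Cylinder d}

theorem continuous_smear_kernel (hu : IsNLSSolution d p u) {κ : Cylinder d → ℂ}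
    (hκ : Continuous κ) (hκc : HasCompactSupport κ) (z : Cylinder d) :
    Continuous fun t => smear volume κ (u t) z := by
  simp only [smear_eq_integral_sub]
  have h : MemLp (fun w => κ (w - z)) 2 (volume : Measure (Cylinder d)) :=
    (hκ.comp (continuous_id.sub continuous_const)).memLp_of_hasCompactSupport
      (hκc.comp_homeomorph (Homeomorph.subRight z))
  exact (continuous_integral_Lp_mul h).comp hu.continuous

theorem continuous_smear_powerNonlinearity (hu : IsNLSSolution d p u) (hp : 1 < p) (hp2 : p ≤ 2)
    {κ : Cylinder d → ℂ} (hκ : Continuous κ) (hκc : HasCompactSupport κ) (z : Cylinder d) :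
    Continuous fun t => smear volume κ (fun w => powerNonlinearity p (u t w)) z := by
  simp only [smear_eq_integral_sub]
  exact (continuous_integral_powerNonlinearity_mul hp hp2
    (hκ.comp (continuous_id.sub continuous_const))
      (hκc.comp_homeomorph (Homeomorph.subRight z))).comp hu.continuous

/-- At a fixed point z the average is a pairing with a translated kernel, so the mollified equation
is an ordinary differential equation in t. -/
theorem hasDerivAt_smear (hu : IsNLSSolution d p u) (hp : 1 < p) (hp2 : p ≤ 2) (k : Mollifier d)
    (z : Cylinder d) (t : ℝ) :
    HasDerivAt (fun s => smear volume k.kernel (u s) z)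
      (-Complex.I * (smear volume k.kernel (fun w => powerNonlinearity p (u t w)) z -
        smear volume k.lap (u t) z)) t := by
  have hΔ : cylinderLaplacian (fun z' : Cylinder d => k.kernel (z' - z)) =
      fun z' => k.lap (z' - z) := funext fun z' => k.cylinderLaplacian_kernel_sub z z'
  have h := hu.hasDerivAt_integral_mul hp hp2 (k.isTestFunction_kernel_sub z)
    (k.continuous_kernel.comp (continuous_id.sub continuous_const))
    (by rw [hΔ]; exact k.continuous_lap.comp (continuous_id.sub continuous_const))
    (by rw [hΔ]; exact k.hasCompactSupport_lap.comp_homeomorph (Homeomorph.subRight z)) t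
  simp only [smear_eq_integral_sub]
  rw [hΔ] at h
  exact h

theorem measurable_smear (hu : IsNLSSolution d p u) {κ : Cylinder d → ℂ}
    (hκ : Continuous κ) (hκc : HasCompactSupport κ) :
    Measurable (Function.uncurry fun t z => smear volume κ (u t) z) :=
  measurable_uncurry_of_continuous_of_measurable (u := fun t z => smear volume κ (u t) z)
    (fun z => hu.continuous_smear_kernel hκ hκc z) fun t =>
      (stronglyMeasurable_smear hκ.stronglyMeasurable (Lp.stronglyMeasurable (u t))).measurable

theorem measurable_smear_powerNonlinearity (hu : IsNLSSolution d p u) (hp : 1 < p) (hp2 : p ≤ 2)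
    {κ : Cylinder d → ℂ} (hκ : Continuous κ) (hκc : HasCompactSupport κ) :
    Measurable (Function.uncurry fun t z =>
      smear volume κ (fun w => powerNonlinearity p (u t w)) z) :=
  measurable_uncurry_of_continuous_of_measurable
    (u := fun t z => smear volume κ (fun w => powerNonlinearity p (u t w)) z)
    (fun z => hu.continuous_smear_powerNonlinearity hp hp2 hκ hκc z) fun t =>
      (stronglyMeasurable_smear hκ.stronglyMeasurable
        ((continuous_powerNonlinearity hp).comp_stronglyMeasurable
          (Lp.stronglyMeasurable (u t)))).measurable

theorem lintegral_translate_le (hp : 1 < p) (f : L2Cylinder d) (q : Cylinder d × Cylinder d) :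
    ∫⁻ z, ‖f (z + q.1)‖ₑ * ‖powerNonlinearity p (f (z + q.2))‖ₑ ≤
      2 * ∫⁻ z, ‖f z‖ₑ ^ (p + 1) :=
  lintegral_enorm_mul_enorm_translate_le (g := fun z => powerNonlinearity p (f z)) (by linarith)
    (Lp.stronglyMeasurable f).measurable (fun _ => enorm_powerNonlinearity hp _) q

theorem lintegral_translate_le' (f : L2Cylinder d) (q : Cylinder d × Cylinder d) :
    ∫⁻ z, ‖f (z + q.1)‖ₑ * ‖f (z + q.2)‖ₑ ≤ 2 * ‖f‖ₑ ^ 2 := by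
  rw [← lintegral_enorm_rpow_two]
  exact lintegral_enorm_mul_enorm_translate_le one_pos
    (Lp.stronglyMeasurable f).measurable (fun z => by rw [ENNReal.rpow_one]) q

theorem two_mul_enorm_sq_ne_top (f : L2Cylinder d) : 2 * ‖f‖ₑ ^ 2 ≠ ⊤ :=
  ENNReal.mul_ne_top (by norm_num) (ENNReal.pow_ne_top enorm_ne_top)

theorem lintegral_enorm_smear_powerNonlinearity_le (hp : 1 < p) (k : Mollifier d)
    (f : L2Cylinder d) :
    ∫⁻ z, ‖(starRingEnd ℂ) (smear volume k.kernel f z) *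
      smear volume k.kernel (fun w => powerNonlinearity p (f w)) z‖ₑ ≤
      2 * ∫⁻ z, ‖f z‖ₑ ^ (p + 1) := by
  have h := lintegral_enorm_conj_smear_mul_smear_le (μ := (volume : Measure (Cylinder d)))
    k.continuous_kernel.measurable k.continuous_kernel.measurable
    (Lp.stronglyMeasurable f).measurable ((continuous_powerNonlinearity hp).measurable.comp
      (Lp.stronglyMeasurable f).measurable) (lintegral_translate_le hp f)
  rw [k.lintegral_enorm_kernel, one_mul, one_mul] at h
  exact h

/-- The derivative of |V|² is integrated in time at each point and then in space. The Laplacian term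
pairs to a real number and drops out; only the imaginary part of the nonlinear pairing survives. -/
theorem mass_identity (hu : IsNLSSolution d p u) (hp : 1 < p) (hp2 : p ≤ 2) (k : Mollifier d)
    {a b : ℝ} (hab : a ≤ b) :
    (∫ z, ‖smear volume k.kernel (u b) z‖ ^ 2) - ∫ z, ‖smear volume k.kernel (u a) z‖ ^ 2 =
      ∫ t in a..b, 2 * (∫ z, (starRingEnd ℂ) (smear volume k.kernel (u t) z) *
        smear volume k.kernel (fun w => powerNonlinearity p (u t w)) z).im := by
  set V : ℝ → Cylinder d → ℂ := fun t z => smear volume k.kernel (u t) z with hV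
  set Q : ℝ → Cylinder d → ℂ := fun t z =>
    smear volume k.kernel (fun w => powerNonlinearity p (u t w)) z with hQ
  set Y : ℝ → Cylinder d → ℂ := fun t z => smear volume k.lap (u t) z with hY
  have hVm := hu.measurable_smear k.continuous_kernel k.hasCompactSupport_kernel
  have hYm := hu.measurable_smear k.continuous_lap k.hasCompactSupport_lap
  have hQm := hu.measurable_smear_powerNonlinearity hp hp2 k.continuous_kernel
    k.hasCompactSupport_kernel
  have hconj : Measurable (starRingEnd ℂ) := RCLike.continuous_conj.measurable
  have hVint : ∀ t, Integrable (fun z => ‖V t z‖ ^ 2) := by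
    intro t
    have h := integrable_conj_smear_mul_smear (μ := (volume : Measure (Cylinder d)))
      k.continuous_kernel.measurable k.continuous_kernel.measurable k.integrable_kernel
      k.integrable_kernel (Lp.stronglyMeasurable (u t)).measurable
      (Lp.stronglyMeasurable (u t)).measurable (two_mul_enorm_sq_ne_top (u t))
      (lintegral_translate_le' (u t))
    refine h.re.congr (Eventually.of_forall fun z => ?_)
    simp only
    rw [Complex.conj_mul', ← Complex.ofReal_pow]
    exact Complex.ofReal_re _
  have hVYint : ∀ t, Integrable (fun z => (starRingEnd ℂ) (V t z) * Y t z) := fun t =>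
    integrable_conj_smear_mul_smear (μ := (volume : Measure (Cylinder d)))
      k.continuous_kernel.measurable k.continuous_lap.measurable k.integrable_kernel
      k.integrable_lap (Lp.stronglyMeasurable (u t)).measurable
      (Lp.stronglyMeasurable (u t)).measurable (two_mul_enorm_sq_ne_top (u t))
      (lintegral_translate_le' (u t))
  have hVYreal : ∀ t, (∫ z, (starRingEnd ℂ) (V t z) * Y t z).im = 0 := by
    intro t
    rw [(integral_conj_smear_mul_smear (μ := (volume : Measure (Cylinder d)))
      k.continuous_kernel.measurable k.continuous_lap.measurable k.integrable_kernel
      k.integrable_lap (Lp.stronglyMeasurable (u t)).measurable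
      (Lp.stronglyMeasurable (u t)).measurable (two_mul_enorm_sq_ne_top (u t))
      (lintegral_translate_le' (u t))).2]
    exact integral_kernel_mul_correlation_im_eq_zero k.kernel_neg k.lap_neg k.conj_kernel k.conj_lap
  set μ := (volume : Measure ℝ).restrict (Ioc a b) with hμ
  -- Joint integrability of the nonlinear term rests on the space-time L^{p+1} bound; for the
  -- Laplacian term below, boundedness of the L² norm on [a, b] is enough.
  have hI1 : Integrable (Function.uncurry fun t z => (starRingEnd ℂ) (V t z) * Q t z)
      (μ.prod volume) := by
    have hm : Measurable (Function.uncurry fun t z => (starRingEnd ℂ) (V t z) * Q t z) :=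
      (hconj.comp hVm).mul hQm
    refine ⟨hm.aestronglyMeasurable, ?_⟩
    rw [hasFiniteIntegral_iff_enorm, lintegral_prod _ hm.enorm.aemeasurable]
    refine (lintegral_mono fun t =>
      lintegral_enorm_smear_powerNonlinearity_le hp k (u t)).trans_lt ?_
    rw [lintegral_const_mul' _ _ (by norm_num)]
    refine ENNReal.mul_lt_top (by norm_num) ?_
    exact (lintegral_mono_set Ioc_subset_Icc_self).trans_lt (hu.locally_Lp a b)
  have hI2 : Integrable (Function.uncurry fun t z => (starRingEnd ℂ) (V t z) * Y t z)
      (μ.prod volume) := by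
    have hm : Measurable (Function.uncurry fun t z => (starRingEnd ℂ) (V t z) * Y t z) :=
      (hconj.comp hVm).mul hYm
    obtain ⟨M, hM⟩ := (isCompact_Icc (a := a) (b := b)).bddAbove_image
      hu.continuous.norm.continuousOn
    refine ⟨hm.aestronglyMeasurable, ?_⟩
    rw [hasFiniteIntegral_iff_enorm, lintegral_prod _ hm.enorm.aemeasurable]
    refine (setLIntegral_mono' (g := fun _ => (∫⁻ w, ‖k.kernel w‖ₑ) * (∫⁻ w, ‖k.lap w‖ₑ) *
      (2 * ENNReal.ofReal M ^ 2)) measurableSet_Ioc fun t ht => ?_).trans_lt ?_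
    · refine (lintegral_enorm_conj_smear_mul_smear_le (μ := (volume : Measure (Cylinder d)))
        k.continuous_kernel.measurable k.continuous_lap.measurable
        (Lp.stronglyMeasurable (u t)).measurable (Lp.stronglyMeasurable (u t)).measurable
        (lintegral_translate_le' (u t))).trans ?_
      have : ‖u t‖ₑ ≤ ENNReal.ofReal M := by
        rw [← ofReal_norm]
        exact ENNReal.ofReal_le_ofReal (hM ⟨t, Ioc_subset_Icc_self ht, rfl⟩)
      gcongr
    · rw [setLIntegral_const]
      refine ENNReal.mul_lt_top (ENNReal.mul_lt_top (ENNReal.mul_lt_top k.integrable_kernel.2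
        k.integrable_lap.2) ?_) (by simp)
      exact ENNReal.mul_lt_top (by norm_num) (ENNReal.pow_lt_top ENNReal.ofReal_lt_top)
  have hI : Integrable (Function.uncurry fun t z =>
      2 * ((starRingEnd ℂ) (V t z) * (-Complex.I * (Q t z - Y t z))).re) (μ.prod volume) := by
    refine (((hI1.sub hI2).const_mul (-Complex.I)).re.const_mul 2).congr
      (Eventually.of_forall fun q => ?_)
    simp only [Function.uncurry, Pi.sub_apply, RCLike.re_to_complex]
    congr 2
    ring
  have hFTC : ∀ z, ‖V b z‖ ^ 2 - ‖V a z‖ ^ 2 =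
      ∫ t, 2 * ((starRingEnd ℂ) (V t z) * (-Complex.I * (Q t z - Y t z))).re ∂μ := by
    intro z
    have hVc := hu.continuous_smear_kernel k.continuous_kernel k.hasCompactSupport_kernel z
    have hYc := hu.continuous_smear_kernel k.continuous_lap k.hasCompactSupport_lap z
    have hQc := hu.continuous_smear_powerNonlinearity hp hp2 k.continuous_kernel
      k.hasCompactSupport_kernel z
    have hder : ∀ t ∈ uIcc a b, HasDerivAt (fun t => ‖V t z‖ ^ 2)
        (2 * ((starRingEnd ℂ) (V t z) * (-Complex.I * (Q t z - Y t z))).re) t := by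
      intro t _
      have h := (hu.hasDerivAt_smear hp hp2 k z t).norm_sq
      rw [Complex.inner, mul_comm (-Complex.I * _)] at h
      exact h
    have hcont : Continuous fun t =>
        2 * ((starRingEnd ℂ) (V t z) * (-Complex.I * (Q t z - Y t z))).re :=
      continuous_const.mul (Complex.continuous_re.comp
        ((Complex.continuous_conj.comp hVc).mul (continuous_const.mul (hQc.sub hYc))))
    rw [← intervalIntegral.integral_eq_sub_of_hasDerivAt hder (hcont.intervalIntegrable a b),
      intervalIntegral.integral_of_le hab]
  rw [← integral_sub (hVint b) (hVint a), integral_congr_ae (Eventually.of_forall hFTC),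
    ← integral_integral_swap hI, intervalIntegral.integral_of_le hab]
  refine integral_congr_ae ?_
  filter_upwards [hI1.prod_right_ae] with t ht
  have e1 : ∫ z, 2 * ((starRingEnd ℂ) (V t z) * (-Complex.I * (Q t z - Y t z))).re =
      2 * (∫ z, -Complex.I * ((starRingEnd ℂ) (V t z) * Q t z - (starRingEnd ℂ) (V t z) * Y t z)).re := by
    rw [integral_const_mul]
    congr 1
    have := integral_re (𝕜 := ℂ) (((ht.sub (hVYint t)).const_mul (-Complex.I)))
    refine Eq.trans ?_ this
    refine integral_congr_ae (Eventually.of_forall fun z => ?_)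
    simp only [Function.uncurry, Pi.sub_apply, RCLike.re_to_complex]
    congr 1
    ring
  have e2 := integral_sub ht (hVYint t)
  simp only [Function.uncurry] at e2
  rw [e1, integral_const_mul, e2]
  -- Re(-iw) = Im w, and the Laplacian part has no imaginary part.
  simp [hVYreal t]
  rfl

theorem integral_norm_smear_sq (k : Mollifier d) (f : L2Cylinder d) :
    Integrable (fun q : Cylinder d × Cylinder d => (starRingEnd ℂ) (k.kernel q.1) * k.kernel q.2 *
      correlation volume f f q) (volume.prod volume) ∧
    ((∫ z, ‖smear volume k.kernel f z‖ ^ 2 : ℝ) : ℂ) =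
      ∫ q : Cylinder d × Cylinder d, (starRingEnd ℂ) (k.kernel q.1) * k.kernel q.2 *
        correlation volume f f q ∂(volume.prod volume) := by
  have h := integral_conj_smear_mul_smear (μ := (volume : Measure (Cylinder d)))
      k.continuous_kernel.measurable k.continuous_kernel.measurable k.integrable_kernel
      k.integrable_kernel (Lp.stronglyMeasurable f).measurable
      (Lp.stronglyMeasurable f).measurable (two_mul_enorm_sq_ne_top f)
      (lintegral_translate_le' f)
  refine ⟨h.1, ?_⟩
  rw [← h.2, ← integral_complex_ofReal]
  refine integral_congr_ae (Eventually.of_forall fun z => ?_)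
  simp only
  rw [Complex.conj_mul', Complex.ofReal_pow]

theorem correlation_self_zero (f : L2Cylinder d) :
    correlation volume f f 0 = ((‖f‖ ^ 2 : ℝ) : ℂ) := by
  have h := inner_self_eq_norm_sq_to_K (𝕜 := ℂ) f
  rw [L2.inner_def] at h
  rw [Complex.ofReal_pow]
  refine Eq.trans ?_ h
  refine integral_congr_ae (Eventually.of_forall fun z => ?_)
  simp only [Prod.fst_zero, Prod.snd_zero, add_zero, RCLike.inner_apply]
  rw [mul_comm]

theorem exists_mollifier_seq (d : ℕ) : ∃ k : ℕ → Mollifier d,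
    ∀ U ∈ 𝓝 (0 : Cylinder d), ∀ᶠ j in atTop, Function.support (k j).kernel ⊆ U := by
  obtain ⟨U, hU⟩ := (𝓝 (0 : Cylinder d)).exists_antitone_basis
  choose k hk using fun j => exists_mollifier d (hU.1.mem_of_mem (i := j) trivial)
  refine ⟨k, fun W hW => ?_⟩
  obtain ⟨j, hj⟩ := hU.mem_iff.1 hW
  filter_upwards [eventually_ge_atTop j] with i hi
  exact (hk i).trans ((hU.2 hi).trans hj)

/-- As the kernels concentrate, the pairing tends to the correlation at 0, namely ∫|f|^{p+1}, which
is real. The dual exponents p + 1 and (p + 1)/p give the continuity of the correlation at 0. -/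
theorem tendsto_integral_smear_powerNonlinearity (hp : 1 < p) {k : ℕ → Mollifier d}
    (hk : ∀ U ∈ 𝓝 (0 : Cylinder d), ∀ᶠ j in atTop, Function.support (k j).kernel ⊆ U)
    {f : L2Cylinder d} (hf : ∫⁻ z, ‖f z‖ₑ ^ (p + 1) < ⊤) :
    Tendsto (fun j => (∫ z, (starRingEnd ℂ) (smear volume (k j).kernel f z) *
      smear volume (k j).kernel (fun w => powerNonlinearity p (f w)) z).im) atTop (𝓝 0) := by
  have hp0 : 0 < p := by linarith
  have hfm := (Lp.stronglyMeasurable f).measurable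
  have hNm : Measurable fun w => powerNonlinearity p (f w) :=
    (continuous_powerNonlinearity hp).measurable.comp hfm
  have h := fun j => integral_conj_smear_mul_smear (μ := (volume : Measure (Cylinder d)))
      (k j).continuous_kernel.measurable (k j).continuous_kernel.measurable (k j).integrable_kernel
      (k j).integrable_kernel hfm hNm (ENNReal.mul_ne_top (by norm_num) hf.ne)
      (lintegral_translate_le hp f)
  have hconj : (p + 1).HolderConjugate ((p + 1) / p) := by
    rw [Real.holderConjugate_iff]
    refine ⟨by linarith, ?_⟩
    field_simp
    ring
  have hH : ENNReal.HolderTriple (ENNReal.ofReal (p + 1)) (ENNReal.ofReal ((p + 1) / p)) 1 :=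
    hconj.ennrealOfReal
  have hm1 : MemLp f (ENNReal.ofReal (p + 1)) volume := by
    refine ⟨Lp.aestronglyMeasurable f, ?_⟩
    rw [eLpNorm_lt_top_iff_lintegral_rpow_enorm_lt_top (by simp; linarith) ENNReal.ofReal_ne_top,
      ENNReal.toReal_ofReal (by linarith)]
    exact hf
  have hm2 : MemLp (fun w => powerNonlinearity p (f w)) (ENNReal.ofReal ((p + 1) / p)) volume := by
    have hpos : 0 < (p + 1) / p := by positivity
    refine ⟨hNm.aestronglyMeasurable, ?_⟩
    rw [eLpNorm_lt_top_iff_lintegral_rpow_enorm_lt_top (by simpa using hpos) ENNReal.ofReal_ne_top,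
      ENNReal.toReal_ofReal hpos.le]
    refine lt_of_eq_of_lt (lintegral_congr fun z => ?_) hf
    rw [enorm_powerNonlinearity hp, ← ENNReal.rpow_mul]
    congr 1
    field_simp
  have hc := continuousAt_correlation (by rw [ENNReal.one_le_ofReal]; linarith)
    ENNReal.ofReal_ne_top (by rw [ENNReal.one_le_ofReal, le_div_iff₀ hp0]; linarith)
    ENNReal.ofReal_ne_top hm1 hm2
  have hlim := tendsto_integral_kernel_mul_of_continuousAt hk hc fun j => (h j).1
  have h0 : (correlation volume f (fun w => powerNonlinearity p (f w)) 0).im = 0 := by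
    refine Complex.conj_eq_iff_im.1 ?_
    rw [correlation, ← integral_conj]
    refine integral_congr_ae (Eventually.of_forall fun z => ?_)
    simp only [Prod.fst_zero, Prod.snd_zero, add_zero, powerNonlinearity, map_mul,
      Complex.conj_conj, Complex.conj_ofReal]
    ring
  have := (Complex.continuous_im.tendsto _).comp hlim
  rw [h0] at this
  refine this.congr fun j => ?_
  rw [Function.comp_apply, (h j).2]

/-- Passage to the limit in `mass_identity`: the left side tends to the difference of the masses,
the right side to 0 by dominated convergence in time, with majorant 4∫|u(t)|^{p+1}. -/
theorem norm_eq_of_le (hu : IsNLSSolution d p u) (hp : 1 < p) (hp2 : p ≤ 2) {a b : ℝ}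
    (hab : a ≤ b) : ‖u b‖ = ‖u a‖ := by
  obtain ⟨k, hk⟩ := exists_mollifier_seq d
  have hmass : ∀ t, Tendsto (fun j => ∫ z, ‖smear volume (k j).kernel (u t) z‖ ^ 2) atTop
      (𝓝 (‖u t‖ ^ 2)) := by
    intro t
    have hc := continuousAt_correlation (r := 2) (s := 2) (by norm_num) (by norm_num) (by norm_num)
      (by norm_num) (Lp.memLp (u t)) (Lp.memLp (u t))
    have hlim := tendsto_integral_kernel_mul_of_continuousAt hk hc fun j =>
      (integral_norm_smear_sq (k j) (u t)).1
    rw [correlation_self_zero] at hlim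
    have h2 := (Complex.continuous_re.tendsto _).comp hlim
    rw [Complex.ofReal_re] at h2
    refine h2.congr fun j => ?_
    rw [Function.comp_apply, ← (integral_norm_smear_sq (k j) (u t)).2, Complex.ofReal_re]
  set L : ℝ → ENNReal := fun t => ∫⁻ z, ‖u t z‖ₑ ^ (p + 1) with hL
  have hLm : Measurable L :=
    (LowerSemicontinuous.comp (lowerSemicontinuous_lintegral_enorm_rpow (p + 1))
      hu.continuous).measurable
  have hLfin : ∫⁻ t in Ioc a b, L t ≠ ⊤ :=
    ((lintegral_mono_set Ioc_subset_Icc_self).trans_lt (hu.locally_Lp a b)).ne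
  have hLae : ∀ᵐ t ∂(volume.restrict (Ioc a b)), L t < ⊤ := ae_lt_top hLm hLfin
  have hLint : Integrable (fun t => (L t).toReal) (volume.restrict (Ioc a b)) :=
    integrable_toReal_of_lintegral_ne_top hLm.aemeasurable hLfin
  have hdom : Tendsto (fun j => ∫ t in a..b, 2 * (∫ z, (starRingEnd ℂ)
      (smear volume (k j).kernel (u t) z) *
        smear volume (k j).kernel (fun w => powerNonlinearity p (u t w)) z).im) atTop
      (𝓝 (∫ t in a..b, (0 : ℝ))) := by
    simp only [intervalIntegral.integral_of_le hab]
    refine tendsto_integral_of_dominated_convergence (fun t => 2 * (2 * (L t).toReal))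
      (fun j => ?_) ((hLint.const_mul 2).const_mul 2) (fun j => ?_) ?_
    · have hconj : Measurable (starRingEnd ℂ) := RCLike.continuous_conj.measurable
      have hm : Measurable (Function.uncurry fun t z =>
          (starRingEnd ℂ) (smear volume (k j).kernel (u t) z) *
            smear volume (k j).kernel (fun w => powerNonlinearity p (u t w)) z) :=
        (hconj.comp (hu.measurable_smear (k j).continuous_kernel
        (k j).hasCompactSupport_kernel)).mul (hu.measurable_smear_powerNonlinearity hp hp2
          (k j).continuous_kernel (k j).hasCompactSupport_kernel)
      have h1 := hm.stronglyMeasurable.integral_prod_right (ν := (volume : Measure (Cylinder d)))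
      exact ((Complex.measurable_im.comp h1.measurable).const_mul 2).aestronglyMeasurable
    · filter_upwards [hLae] with t ht
      rw [norm_mul, Real.norm_ofNat, Real.norm_eq_abs]
      refine mul_le_mul_of_nonneg_left ?_ (by norm_num)
      refine (Complex.abs_im_le_norm _).trans ?_
      have h1 := (enorm_integral_le_lintegral_enorm _).trans
        (lintegral_enorm_smear_powerNonlinearity_le hp (k j) (u t))
      have h2 : (2 * L t) ≠ ⊤ := ENNReal.mul_ne_top (by norm_num) ht.ne
      have h3 := ENNReal.toReal_mono h2 h1
      rw [toReal_enorm, ENNReal.toReal_mul, ENNReal.toReal_ofNat] at h3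
      exact h3
    · filter_upwards [hLae] with t ht
      have := (tendsto_integral_smear_powerNonlinearity hp hk ht).const_mul 2
      rwa [mul_zero] at this
  rw [intervalIntegral.integral_zero] at hdom
  have hdiff := (hmass b).sub (hmass a)
  have := tendsto_nhds_unique (hdiff.congr fun j => hu.mass_identity hp hp2 (k j) hab) hdom
  have hsq : ‖u b‖ ^ 2 = ‖u a‖ ^ 2 := by linarith
  exact (pow_left_inj₀ (norm_nonneg _) (norm_nonneg _) two_ne_zero).1 hsq

/-- Conservation of mass. -/
theorem norm_eq (hu : IsNLSSolution d p u) (hp : 1 < p) (hp2 : p ≤ 2) (a b : ℝ) :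
    ‖u a‖ = ‖u b‖ := by
  rcases le_total a b with h | h
  · exact (hu.norm_eq_of_le hp hp2 h).symm
  · exact hu.norm_eq_of_le hp hp2 h

end IsNLSSolution

/-! ### Trigonometric sums on the torus `𝕋 × 𝕋` -/

/-- The character `(τ, x) ↦ e^{i(kτ + lx)}` of the two-dimensional torus. -/
noncomputable def torusChar (k : ℤ × ℤ)
    (q : AddCircle (2 * Real.pi) × AddCircle (2 * Real.pi)) : ℂ :=
  fourier k.1 q.1 * fourier k.2 q.2

theorem continuous_torusChar (k : ℤ × ℤ) : Continuous (torusChar k) := by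
  unfold torusChar
  fun_prop

theorem norm_torusChar (k : ℤ × ℤ) (q : AddCircle (2 * Real.pi) × AddCircle (2 * Real.pi)) :
    ‖torusChar k q‖ = 1 := by
  rw [torusChar, norm_mul, fourier_apply, fourier_apply, Circle.norm_coe, Circle.norm_coe, mul_one]

theorem torusChar_add (k l : ℤ × ℤ) (q : AddCircle (2 * Real.pi) × AddCircle (2 * Real.pi)) :
    torusChar (k + l) q = torusChar k q * torusChar l q := by
  simp only [torusChar, Prod.fst_add, Prod.snd_add, fourier_add]
  ring

theorem conj_torusChar (k : ℤ × ℤ) (q : AddCircle (2 * Real.pi) × AddCircle (2 * Real.pi)) :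
    (starRingEnd ℂ) (torusChar k q) = torusChar (-k) q := by
  simp only [torusChar, Prod.fst_neg, Prod.snd_neg, fourier_neg, map_mul]

theorem integral_fourier (n : ℤ) :
    ∫ x : AddCircle (2 * Real.pi), fourier n x = if n = 0 then ((2 * Real.pi : ℝ) : ℂ) else 0 := by
  split_ifs with h
  · subst h
    simp [measureReal_def, AddCircle.measure_univ, ENNReal.toReal_ofReal Real.pi_pos.le]
  · exact integral_eq_zero_of_add_right_eq_neg (fourier_add_half_inv_index h Real.two_pi_pos)

theorem integral_torusChar (k : ℤ × ℤ) :
    ∫ q, torusChar k q = if k = 0 then ((2 * Real.pi : ℝ) : ℂ) ^ 2 else 0 := by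
  unfold torusChar
  rw [Measure.volume_eq_prod, integral_prod_mul (f := fun x => fourier k.1 x)
    (g := fun x => fourier k.2 x), integral_fourier, integral_fourier]
  rcases k with ⟨a, b⟩
  by_cases ha : a = 0 <;> by_cases hb : b = 0 <;> simp [ha, hb, sq]

theorem memLp_of_continuous_torus {E : Type*} [NormedAddCommGroup E]
    {f : AddCircle (2 * Real.pi) × AddCircle (2 * Real.pi) → E} (hf : Continuous f)
    (r : ENNReal) : MemLp f r volume := by
  have := hf.memLp_of_hasCompactSupport (p := r) (μ := (volume : Measure
    (AddCircle (2 * Real.pi) × AddCircle (2 * Real.pi)))) (HasCompactSupport.of_compactSpace f)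
  exact this

theorem integrable_of_continuous_torus {E : Type*} [NormedAddCommGroup E]
    {f : AddCircle (2 * Real.pi) × AddCircle (2 * Real.pi) → E} (hf : Continuous f) :
    Integrable f volume :=
  memLp_one_iff_integrable.1 (memLp_of_continuous_torus hf 1)

theorem integral_torusChar_mul_conj (k l : ℤ × ℤ) :
    ∫ q, torusChar k q * (starRingEnd ℂ) (torusChar l q) =
      if k = l then ((2 * Real.pi : ℝ) : ℂ) ^ 2 else 0 := by
  simp only [conj_torusChar, ← torusChar_add, integral_torusChar, ← sub_eq_add_neg, sub_eq_zero]

/-- An `L²` bound for a sum of characters in which no frequency is taken more than `K` times. -/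
theorem integral_norm_sq_sum_torusChar_le {ι : Type*} (S : Finset ι) (b : ι → ℂ)
    (φ : ι → ℤ × ℤ) (K : ℕ) (hK : ∀ i ∈ S, (S.filter fun j => φ i = φ j).card ≤ K) :
    ∫ q, ‖∑ i ∈ S, b i * torusChar (φ i) q‖ ^ 2 ≤
      (2 * Real.pi) ^ 2 * (K * ∑ i ∈ S, ‖b i‖ ^ 2) := by
  have h1 : ((∫ q, ‖∑ i ∈ S, b i * torusChar (φ i) q‖ ^ 2 : ℝ) : ℂ) =
      ∑ i ∈ S, ∑ j ∈ S, b i * (starRingEnd ℂ) (b j) *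
        (if φ i = φ j then ((2 * Real.pi : ℝ) : ℂ) ^ 2 else 0) := by
    rw [← integral_complex_ofReal]
    have : ∀ q, ((‖∑ i ∈ S, b i * torusChar (φ i) q‖ ^ 2 : ℝ) : ℂ) =
        ∑ i ∈ S, ∑ j ∈ S, b i * (starRingEnd ℂ) (b j) *
          (torusChar (φ i) q * (starRingEnd ℂ) (torusChar (φ j) q)) := by
      intro q
      rw [Complex.ofReal_pow, ← Complex.mul_conj', map_sum, Finset.sum_mul_sum]
      refine Finset.sum_congr rfl fun i _ => Finset.sum_congr rfl fun j _ => ?_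
      rw [map_mul]
      ring
    simp only [this]
    have hint : ∀ i j, Integrable (fun q => b i * (starRingEnd ℂ) (b j) *
        (torusChar (φ i) q * (starRingEnd ℂ) (torusChar (φ j) q))) := fun i j =>
      (integrable_of_continuous_torus ((continuous_torusChar _).mul
        (Complex.continuous_conj.comp (continuous_torusChar _)))).const_mul _
    rw [integral_finsetSum _ fun i _ => integrable_finsetSum _ fun j _ => hint i j]
    refine Finset.sum_congr rfl fun i _ => ?_
    rw [integral_finsetSum _ fun j _ => hint i j]
    refine Finset.sum_congr rfl fun j _ => ?_
    rw [integral_const_mul, integral_torusChar_mul_conj]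
  -- Only pairs with equal frequencies survive, and |bᵢ||bⱼ| ≤ (|bᵢ|² + |bⱼ|²)/2. By symmetry both
  -- squares contribute the same total, in which each |bᵢ|² is counted at most K times.
  have h2 : ∫ q, ‖∑ i ∈ S, b i * torusChar (φ i) q‖ ^ 2 ≤
      ∑ i ∈ S, ∑ j ∈ S, if φ i = φ j then (2 * Real.pi) ^ 2 * ((‖b i‖ ^ 2 + ‖b j‖ ^ 2) / 2)
        else 0 := by
    refine (le_abs_self _).trans ?_
    rw [← Real.norm_eq_abs, ← Complex.norm_real, h1]
    refine (norm_sum_le _ _).trans (Finset.sum_le_sum fun i _ => (norm_sum_le _ _).trans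
      (Finset.sum_le_sum fun j _ => ?_))
    split_ifs with h
    · rw [norm_mul, norm_mul, RCLike.norm_conj, norm_pow, Complex.norm_real, Real.norm_eq_abs,
        sq_abs, mul_comm]
      gcongr
      nlinarith [sq_nonneg (‖b i‖ - ‖b j‖)]
    · simp
  refine h2.trans ?_
  have h3 : ∀ f : ι → ι → ℝ, (∑ i ∈ S, ∑ j ∈ S, if φ i = φ j then
      (2 * Real.pi) ^ 2 * ((‖b i‖ ^ 2 + ‖b j‖ ^ 2) / 2) else 0) =
      (2 * Real.pi) ^ 2 * ∑ i ∈ S, ∑ j ∈ S, if φ i = φ j then ‖b i‖ ^ 2 else 0 := by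
    intro f
    have e1 : ∀ i j, (if φ i = φ j then (2 * Real.pi) ^ 2 * ((‖b i‖ ^ 2 + ‖b j‖ ^ 2) / 2) else 0) =
        (2 * Real.pi) ^ 2 / 2 * (if φ i = φ j then ‖b i‖ ^ 2 else 0) +
          (2 * Real.pi) ^ 2 / 2 * (if φ j = φ i then ‖b j‖ ^ 2 else 0) := by
      intro i j
      by_cases h : φ i = φ j
      · rw [if_pos h, if_pos h, if_pos h.symm]; ring
      · rw [if_neg h, if_neg h, if_neg fun h' => h h'.symm]; ring
    simp only [e1, Finset.sum_add_distrib, ← Finset.mul_sum]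
    rw [Finset.sum_comm (f := fun i j => if φ j = φ i then ‖b j‖ ^ 2 else 0)]
    ring
  rw [h3 fun _ _ => 0, Finset.mul_sum S _ (K : ℝ)]
  refine mul_le_mul_of_nonneg_left (Finset.sum_le_sum fun i hi => ?_) (by positivity)
  rw [← Finset.sum_filter, Finset.sum_const, nsmul_eq_mul]
  exact mul_le_mul_of_nonneg_right (by exact_mod_cast hK i hi) (sq_nonneg _)

theorem eLpNorm_sum_torusChar_le {ι : Type*} (S : Finset ι) (b : ι → ℂ)
    (φ : ι → ℤ × ℤ) (K : ℕ) (hK : ∀ i ∈ S, (S.filter fun j => φ i = φ j).card ≤ K) :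
    eLpNorm (fun q => ∑ i ∈ S, b i * torusChar (φ i) q) 2 volume ≤
      ENNReal.ofReal (2 * Real.pi * Real.sqrt (K * ∑ i ∈ S, ‖b i‖ ^ 2)) := by
  have hc : Continuous fun q => ∑ i ∈ S, b i * torusChar (φ i) q :=
    continuous_finsetSum _ fun i _ => continuous_const.mul (continuous_torusChar _)
  rw [(memLp_of_continuous_torus hc 2).eLpNorm_eq_integral_rpow_norm (by norm_num) (by norm_num)]
  refine ENNReal.ofReal_le_ofReal ?_
  have h := integral_norm_sq_sum_torusChar_le S b φ K hK
  have e : Real.sqrt ((2 * Real.pi) ^ 2 * (K * ∑ i ∈ S, ‖b i‖ ^ 2)) =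
      2 * Real.pi * Real.sqrt (K * ∑ i ∈ S, ‖b i‖ ^ 2) := by
    rw [Real.sqrt_mul (by positivity), Real.sqrt_sq Real.two_pi_pos.le]
  rw [← e]
  have := Real.sqrt_le_sqrt h
  rw [Real.sqrt_eq_rpow] at this
  simpa using this

/-- The space-time wave `e^{inx - in²τ}`. -/
noncomputable def torusWave (n : ℤ) : AddCircle (2 * Real.pi) × AddCircle (2 * Real.pi) → ℂ :=
  torusChar (-n ^ 2, n)

theorem continuous_torusWave (n : ℤ) : Continuous (torusWave n) := continuous_torusChar _

theorem eLpNorm_sum_torusWave_le (s : Finset ℤ) (c : ℤ → ℂ) :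
    eLpNorm (fun q => ∑ n ∈ s, c n * torusWave n q) 2 volume ≤
      ENNReal.ofReal (2 * Real.pi * Real.sqrt (∑ n ∈ s, ‖c n‖ ^ 2)) := by
  have h := eLpNorm_sum_torusChar_le s c (fun n => (-n ^ 2, n)) 1 fun i _ => by
    refine (Finset.card_le_card (t := {i}) fun j hj => ?_).trans (Finset.card_singleton i).le
    have := (Finset.mem_filter.1 hj).2
    simp only [Prod.mk.injEq] at this
    simp [this.2]
  rw [Nat.cast_one, one_mul] at h
  exact h

/-- Zygmund's `L⁴` estimate for sums of the waves `e^{inx - in²τ}`. -/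
theorem eLpNorm_sum_torusWave_sq_le (s : Finset ℤ) (c : ℤ → ℂ) :
    eLpNorm (fun q => (∑ n ∈ s, c n * torusWave n q) ^ 2) 2 volume ≤
      ENNReal.ofReal (2 * Real.pi * Real.sqrt (2 * (∑ n ∈ s, ‖c n‖ ^ 2) ^ 2)) := by
  have h := eLpNorm_sum_torusChar_le (s ×ˢ s) (fun i => c i.1 * c i.2)
    (fun i => (-i.1 ^ 2, i.1) + (-i.2 ^ 2, i.2)) 2 fun i _ => by
      refine (Finset.card_le_card (t := {i, i.swap}) fun j hj => ?_).trans Finset.card_le_two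
      have h := (Finset.mem_filter.1 hj).2
      obtain ⟨n, m⟩ := i
      obtain ⟨n', m'⟩ := j
      simp only [Prod.mk_add_mk, Prod.mk.injEq] at h
      -- Equal sums and equal sums of squares determine a pair of integers up to order, whence the
      -- multiplicity 2.
      have h3 : (n' - n) * (n' - m) = 0 := by
        have : m' = n + m - n' := by linarith [h.2]
        rw [this] at h
        nlinarith [h.1]
      simp only [Prod.swap_prod_mk, Finset.mem_insert, Finset.mem_singleton, Prod.mk.injEq]
      rcases mul_eq_zero.1 h3 with h4 | h4
      · exact Or.inl ⟨by linarith, by linarith [h.2]⟩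
      · exact Or.inr ⟨by linarith, by linarith [h.2]⟩
  have e1 : ∀ q, (∑ n ∈ s, c n * torusWave n q) ^ 2 = ∑ i ∈ s ×ˢ s, c i.1 * c i.2 *
      torusChar ((-i.1 ^ 2, i.1) + (-i.2 ^ 2, i.2)) q := by
    intro q
    rw [sq, Finset.sum_mul_sum, Finset.sum_product]
    refine Finset.sum_congr rfl fun n _ => Finset.sum_congr rfl fun m _ => ?_
    rw [torusChar_add, torusWave, torusWave]
    ring
  have e2 : ∑ i ∈ s ×ˢ s, ‖c i.1 * c i.2‖ ^ 2 = (∑ n ∈ s, ‖c n‖ ^ 2) ^ 2 := by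
    rw [sq (∑ n ∈ s, ‖c n‖ ^ 2), Finset.sum_mul_sum, Finset.sum_product]
    simp only [norm_mul, mul_pow]
  simp only [e1]
  rw [e2] at h
  exact_mod_cast h

theorem integral_sum_torusWave_mul_conj (s : Finset ℤ) (c : ℤ → ℂ) {n : ℤ} (hn : n ∈ s) :
    ∫ q, (∑ m ∈ s, c m * torusWave m q) * (starRingEnd ℂ) (torusWave n q) =
      c n * ((2 * Real.pi : ℝ) : ℂ) ^ 2 := by
  have hint : ∀ m, Integrable (fun q => c m * (torusWave m q * (starRingEnd ℂ) (torusWave n q))) :=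
    fun m => (integrable_of_continuous_torus ((continuous_torusWave _).mul
        (Complex.continuous_conj.comp (continuous_torusWave _)))).const_mul _
  simp only [Finset.sum_mul, mul_assoc]
  rw [integral_finsetSum _ fun m _ => hint m, Finset.sum_eq_single n]
  · rw [integral_const_mul, torusWave, integral_torusChar_mul_conj, if_pos rfl]
  · intro m _ hmn
    rw [integral_const_mul, torusWave, torusWave, integral_torusChar_mul_conj, if_neg, mul_zero]
    simp [hmn]
  · exact fun h => absurd hn h

/-- A sum of waves `∑ cₙ e^{inx - in²τ}` for which `|F|^{p-1} F` is orthogonal to all waves is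
zero. -/
theorem eq_zero_of_forall_integral_powerNonlinearity_mul_conj_torusWave {p : ℝ} (hp : 1 < p)
    (hp2 : p ≤ 2) {c : ℤ → ℂ} (hc : Summable fun n => ‖c n‖ ^ 2) {s : ℕ → Finset ℤ}
    (hs : Monotone s) (hs' : Tendsto s atTop atTop)
    {F : AddCircle (2 * Real.pi) × AddCircle (2 * Real.pi) → ℂ} (hFm : Measurable F)
    (hF : ∀ᵐ q, Tendsto (fun j => ∑ n ∈ s j, c n * torusWave n q) atTop (𝓝 (F q)))
    (h0 : ∀ n, ∫ q, powerNonlinearity p (F q) * (starRingEnd ℂ) (torusWave n q) = 0) (n : ℤ) :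
    c n = 0 := by
  set Fs : ℕ → AddCircle (2 * Real.pi) × AddCircle (2 * Real.pi) → ℂ :=
    fun j q => ∑ n ∈ s j, c n * torusWave n q with hFs
  have hFc : ∀ j, Continuous (Fs j) := fun j =>
    continuous_finsetSum _ fun i _ => continuous_const.mul (continuous_torusWave _)
  set A := ∑' n, ‖c n‖ ^ 2 with hA
  -- F lies in L⁴: Fatou's lemma carries Zygmund's bound over from the partial sums.
  have hsq : MemLp (fun q => F q ^ 2) 2 volume := by
    refine ⟨(hFm.pow_const 2).aestronglyMeasurable, ?_⟩
    refine (Lp.eLpNorm_lim_le_liminf_eLpNorm (f := fun j q => Fs j q ^ 2)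
      (fun j => ((hFc j).pow 2).aestronglyMeasurable) _ (hF.mono fun q hq => hq.pow 2)).trans_lt ?_
    have hb : ∀ j, eLpNorm (fun q => Fs j q ^ 2) 2 volume ≤
        ENNReal.ofReal (2 * Real.pi * Real.sqrt (2 * A ^ 2)) := fun j => by
      refine (eLpNorm_sum_torusWave_sq_le (s j) c).trans (ENNReal.ofReal_le_ofReal ?_)
      have : ∑ n ∈ s j, ‖c n‖ ^ 2 ≤ A := hc.sum_le_tsum _ fun _ _ => sq_nonneg _
      gcongr
    refine lt_of_le_of_lt ?_ (ENNReal.ofReal_lt_top (r := 2 * Real.pi * Real.sqrt (2 * A ^ 2)))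
    refine liminf_le_of_le (by isBoundedDefault) fun b hb' => ?_
    obtain ⟨i, hi⟩ := hb'.exists
    exact hi.trans (hb i)
  have hone : MemLp (fun _ : AddCircle (2 * Real.pi) × AddCircle (2 * Real.pi) => (1 : ℝ)) 2
      volume := memLp_of_continuous_torus continuous_const 2
  -- From |F|^p ≤ 2|F| + |F|² ≤ 3 + 3|F|². Membership in L² is what allows the pairing with F below.
  have hN : MemLp (fun q => powerNonlinearity p (F q)) 2 volume := by
    refine ((hone.const_mul 3).add (hsq.norm.const_mul 3)).of_le
      ((continuous_powerNonlinearity hp).measurable.comp hFm).aestronglyMeasurable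
      (Eventually.of_forall fun q => ?_)
    refine (norm_powerNonlinearity_le hp hp2 _).trans (le_trans ?_ (le_abs_self _))
    simp only [Pi.add_apply, norm_pow]
    nlinarith [sq_nonneg (‖F q‖ - 1), norm_nonneg (F q)]
  -- Fatou's lemma again, applied to differences of partial sums, whose L² norms are bounded by
  -- tails of the coefficient series.
  have hdist : Tendsto (fun j => (eLpNorm (fun q => F q - Fs j q) 2 volume).toReal) atTop
      (𝓝 0) := by
    have hb : ∀ j, eLpNorm (fun q => F q - Fs j q) 2 volume ≤
        ENNReal.ofReal (2 * Real.pi * Real.sqrt (A - ∑ n ∈ s j, ‖c n‖ ^ 2)) := by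
      intro j
      refine (Lp.eLpNorm_lim_le_liminf_eLpNorm (f := fun k q => Fs k q - Fs j q)
        (fun k => ((hFc k).sub (hFc j)).aestronglyMeasurable) _
          (hF.mono fun q hq => hq.sub_const _)).trans ?_
      refine liminf_le_of_le (by isBoundedDefault) fun b hb' => ?_
      obtain ⟨k, hk, hjk⟩ := (hb'.and (eventually_ge_atTop j)).exists
      refine hk.trans ?_
      have e : (fun q => Fs k q - Fs j q) = fun q => ∑ n ∈ s k \ s j, c n * torusWave n q := by
        funext q
        rw [hFs, sub_eq_iff_eq_add]
        exact (Finset.sum_sdiff (hs hjk)).symm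
      rw [e]
      refine (eLpNorm_sum_torusWave_le _ _).trans (ENNReal.ofReal_le_ofReal ?_)
      have h1 : ∑ n ∈ s k, ‖c n‖ ^ 2 ≤ A := hc.sum_le_tsum _ fun _ _ => sq_nonneg _
      have h2 := Finset.sum_sdiff (f := fun n => ‖c n‖ ^ 2) (hs hjk)
      have h3 : ∑ n ∈ s k \ s j, ‖c n‖ ^ 2 ≤ A - ∑ n ∈ s j, ‖c n‖ ^ 2 := by linarith
      gcongr
    have ht : Tendsto (fun j => 2 * Real.pi * Real.sqrt (A - ∑ n ∈ s j, ‖c n‖ ^ 2)) atTop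
        (𝓝 0) := by
      have h1 : Tendsto (fun j => A - ∑ n ∈ s j, ‖c n‖ ^ 2) atTop (𝓝 (A - A)) :=
        tendsto_const_nhds.sub (hc.hasSum.comp hs')
      have h2 := ((Real.continuous_sqrt.tendsto _).comp h1).const_mul (2 * Real.pi)
      simpa using h2
    refine squeeze_zero (fun _ => ENNReal.toReal_nonneg) (fun j => ?_) ht
    exact ENNReal.toReal_le_of_le_ofReal (by positivity) (hb j)
  have hFsm : ∀ j, MemLp (Fs j) 2 volume := fun j => memLp_of_continuous_torus (hFc j) 2
  have hFm2 : MemLp F 2 volume := by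
    refine (hone.add hsq.norm).of_le hFm.aestronglyMeasurable (Eventually.of_forall fun q => ?_)
    refine le_trans ?_ (le_abs_self _)
    simp only [Pi.add_apply, norm_pow]
    nlinarith [sq_nonneg (‖F q‖ - 1), norm_nonneg (F q)]
  have hFstar : MemLp (fun q => (starRingEnd ℂ) (F q)) 2 volume := hFm2.star
  have hFsstar : ∀ j, MemLp (fun q => (starRingEnd ℂ) (Fs j q)) 2 volume := fun j => (hFsm j).star
  have hdm : ∀ j, MemLp (fun q => F q - Fs j q) 2 volume := fun j => hFm2.sub (hFsm j)
  have hconj : ∀ j, MemLp (fun q => (starRingEnd ℂ) (F q - Fs j q)) 2 volume := fun j => (hdm j).star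
  have hzero : ∀ j, ∫ q, powerNonlinearity p (F q) * (starRingEnd ℂ) (Fs j q) = 0 := by
    intro j
    have hint : ∀ n, Integrable (fun q => (starRingEnd ℂ) (c n) *
        (powerNonlinearity p (F q) * (starRingEnd ℂ) (torusWave n q))) := fun n =>
      (integrable_mul_of_memLp_two hN (memLp_of_continuous_torus
        (Complex.continuous_conj.comp (continuous_torusWave n)) 2)).const_mul _
    have e : ∀ q, powerNonlinearity p (F q) * (starRingEnd ℂ) (Fs j q) =
        ∑ n ∈ s j, (starRingEnd ℂ) (c n) *
          (powerNonlinearity p (F q) * (starRingEnd ℂ) (torusWave n q)) := by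
      intro q
      simp only [hFs, map_sum, map_mul, Finset.mul_sum]
      exact Finset.sum_congr rfl fun n _ => by ring
    simp only [e]
    rw [integral_finsetSum _ fun n _ => hint n]
    refine Finset.sum_eq_zero fun n _ => ?_
    rw [integral_const_mul, h0, mul_zero]
  -- Orthogonality to every partial sum passes to the limit F, so that ∫|F|^{p+1} = 0.
  have hpair : ∫ q, powerNonlinearity p (F q) * (starRingEnd ℂ) (F q) = 0 := by
    have hb : ∀ j, ‖∫ q, powerNonlinearity p (F q) * (starRingEnd ℂ) (F q)‖ ≤
        (eLpNorm (fun q => powerNonlinearity p (F q)) 2 volume).toReal *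
          (eLpNorm (fun q => F q - Fs j q) 2 volume).toReal := by
      intro j
      have e : ∫ q, powerNonlinearity p (F q) * (starRingEnd ℂ) (F q) =
          ∫ q, powerNonlinearity p (F q) * (starRingEnd ℂ) (F q - Fs j q) := by
        rw [← sub_zero (∫ q, powerNonlinearity p (F q) * (starRingEnd ℂ) (F q)), ← hzero j,
          ← integral_sub (integrable_mul_of_memLp_two hN hFstar)
            (integrable_mul_of_memLp_two hN (hFsstar j))]
        refine integral_congr_ae (Eventually.of_forall fun q => ?_)
        simp only [map_sub, mul_sub]
      rw [e]
      refine (norm_integral_mul_le_eLpNorm hN (hconj j)).trans (le_of_eq ?_)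
      congr 2
      exact eLpNorm_congr_norm_ae (Eventually.of_forall fun q => RCLike.norm_conj _)
    have := ge_of_tendsto' (hdist.const_mul
      (eLpNorm (fun q => powerNonlinearity p (F q)) 2 volume).toReal) hb
    rw [mul_zero] at this
    exact norm_le_zero_iff.1 this
  have hF0 : F =ᵐ[volume] 0 := by
    have e : ∀ q, powerNonlinearity p (F q) * (starRingEnd ℂ) (F q) =
        ((‖F q‖ ^ (p - 1) * ‖F q‖ ^ 2 : ℝ) : ℂ) := by
      intro q
      rw [powerNonlinearity, mul_assoc, Complex.mul_conj']
      push_cast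
      rfl
    have hint := integrable_mul_of_memLp_two hN hFstar
    have hint' : Integrable (fun q => ‖F q‖ ^ (p - 1) * ‖F q‖ ^ 2) :=
      hint.re.congr (Eventually.of_forall fun q => by
        simp only
        rw [e q]
        exact Complex.ofReal_re _)
    simp only [e] at hpair
    rw [integral_complex_ofReal] at hpair
    have h1 := (integral_eq_zero_iff_of_nonneg (fun q => by positivity) hint').1
      (by exact_mod_cast hpair)
    filter_upwards [h1] with q hq
    by_contra hne
    have : 0 < ‖F q‖ := norm_pos_iff.2 hne
    have : 0 < ‖F q‖ ^ (p - 1) * ‖F q‖ ^ 2 := by positivity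
    exact this.ne' hq
  -- As F = 0, the partial sums tend to 0 in L², while c n is up to (2π)² their coefficient along
  -- the n-th wave.
  have hlim : ∀ᶠ j in atTop, ‖c n * ((2 * Real.pi : ℝ) : ℂ) ^ 2‖ ≤
      (eLpNorm (fun q => F q - Fs j q) 2 volume).toReal *
        (eLpNorm (fun q => (starRingEnd ℂ) (torusWave n q)) 2 volume).toReal := by
    filter_upwards [hs'.eventually_ge_atTop {n}] with j hj
    rw [← integral_sum_torusWave_mul_conj (s j) c (hj (Finset.mem_singleton_self n))]
    have hw : MemLp (fun q => (starRingEnd ℂ) (torusWave n q)) 2 volume :=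
      memLp_of_continuous_torus (Complex.continuous_conj.comp (continuous_torusWave n)) 2
    refine (norm_integral_mul_le_eLpNorm (hFsm j) hw).trans (le_of_eq ?_)
    congr 2
    refine eLpNorm_congr_norm_ae ?_
    filter_upwards [hF0] with q hq
    rw [hq, Pi.zero_apply, zero_sub, norm_neg]
  have h1 := ge_of_tendsto (hdist.mul_const _) hlim
  rw [zero_mul, norm_le_zero_iff, mul_eq_zero] at h1
  refine h1.resolve_right (pow_ne_zero _ ?_)
  exact_mod_cast Real.two_pi_pos.ne'

/-! ### Sums over the Fourier modes of the cylinder -/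

section ModeSums

variable {d : ℕ}

theorem summable_modeEmbedding {f : ℤ → L2Euclidean d} (hf : Summable fun n => ‖f n‖ ^ 2) :
    Summable fun n => modeEmbedding d n (f n) :=
  ((orthogonalFamily_modeEmbedding d).summable_iff_norm_sq_summable f).2 hf

theorem norm_tsum_modeEmbedding_sq {f : ℤ → L2Euclidean d} (hf : Summable fun n => ‖f n‖ ^ 2) :
    ‖∑' n, modeEmbedding d n (f n)‖ ^ 2 = ∑' n, ‖f n‖ ^ 2 := by
  have h1 : Tendsto (fun s : Finset ℤ => ‖∑ n ∈ s, modeEmbedding d n (f n)‖ ^ 2) atTop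
      (𝓝 (‖∑' n, modeEmbedding d n (f n)‖ ^ 2)) :=
    ((summable_modeEmbedding hf).hasSum.norm).pow 2
  simp only [(orthogonalFamily_modeEmbedding d).norm_sum f] at h1
  exact tendsto_nhds_unique h1 hf.hasSum

/-- Orthogonality of the modes turns the squared norm into a series of squares, to which dominated
convergence for series applies. -/
theorem tendsto_norm_tsum_modeEmbedding_zero {α : Type*} {l : Filter α}
    {e : α → ℤ → L2Euclidean d} {b : ℤ → ℝ} (hb : Summable fun n => b n ^ 2)
    (he : ∀ n, Tendsto (fun x => e x n) l (𝓝 0)) (heb : ∀ x n, ‖e x n‖ ≤ b n) :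
    Tendsto (fun x => ‖∑' n, modeEmbedding d n (e x n)‖) l (𝓝 0) := by
  have hle : ∀ x n, ‖e x n‖ ^ 2 ≤ b n ^ 2 := fun x n =>
    pow_le_pow_left₀ (norm_nonneg _) (heb x n) 2
  have hs : ∀ x, Summable fun n => ‖e x n‖ ^ 2 := fun x =>
    hb.of_nonneg_of_le (fun _ => sq_nonneg _) (hle x)
  have h : Tendsto (fun x => ∑' n, ‖e x n‖ ^ 2) l (𝓝 (∑' _ : ℤ, (0 : ℝ))) := by
    refine tendsto_tsum_of_dominated_convergence hb (fun n => ?_)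
      (Eventually.of_forall fun x n => ?_)
    · simpa using ((he n).norm.pow 2)
    · rw [Real.norm_of_nonneg (sq_nonneg _)]
      exact hle x n
  rw [tsum_zero] at h
  have h2 := (Real.continuous_sqrt.tendsto _).comp h
  rw [Real.sqrt_zero] at h2
  refine h2.congr fun x => ?_
  rw [Function.comp_apply, ← norm_tsum_modeEmbedding_sq (hs x), Real.sqrt_sq (norm_nonneg _)]

theorem tsum_modeEmbedding_sub {f g : ℤ → L2Euclidean d} (hf : Summable fun n => ‖f n‖ ^ 2)
    (hg : Summable fun n => ‖g n‖ ^ 2) :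
    ∑' n, modeEmbedding d n (f n - g n) =
      ∑' n, modeEmbedding d n (f n) - ∑' n, modeEmbedding d n (g n) := by
  simp only [map_sub]
  exact (summable_modeEmbedding hf).tsum_sub (summable_modeEmbedding hg)

/-- The function `∑ₙ e^{-in²τ} aₙ(y) e^{inx} / √(2π)`, which is periodic in time. -/
noncomputable def profile (a : ℤ → L2Euclidean d) (τ : AddCircle (2 * Real.pi)) : L2Cylinder d :=
  ∑' n : ℤ, modeEmbedding d n (fourier (-n ^ 2) τ • a n)

theorem norm_fourier_smul (n : ℤ) (τ : AddCircle (2 * Real.pi)) (f : L2Euclidean d) :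
    ‖fourier n τ • f‖ = ‖f‖ := by
  rw [norm_smul, fourier_apply, Circle.norm_coe, one_mul]

variable {a : ℤ → L2Euclidean d}

theorem summable_norm_sq_fourier_smul (ha : Summable fun n => ‖a n‖ ^ 2)
    (τ : AddCircle (2 * Real.pi)) : Summable fun n => ‖fourier (-n ^ 2) τ • a n‖ ^ 2 := by
  simpa only [norm_fourier_smul] using ha

theorem norm_profile_sq (ha : Summable fun n => ‖a n‖ ^ 2) (τ : AddCircle (2 * Real.pi)) :
    ‖profile a τ‖ ^ 2 = ∑' n, ‖a n‖ ^ 2 := by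
  rw [profile, norm_tsum_modeEmbedding_sq (summable_norm_sq_fourier_smul ha τ)]
  simp only [norm_fourier_smul]

theorem norm_profile (ha : Summable fun n => ‖a n‖ ^ 2) (τ : AddCircle (2 * Real.pi)) :
    ‖profile a τ‖ = Real.sqrt (∑' n, ‖a n‖ ^ 2) := by
  rw [← norm_profile_sq ha τ, Real.sqrt_sq (norm_nonneg _)]

theorem continuous_profile (ha : Summable fun n => ‖a n‖ ^ 2) : Continuous (profile a) := by
  refine continuous_iff_continuousAt.2 fun τ => tendsto_iff_norm_sub_tendsto_zero.2 ?_
  have h := tendsto_norm_tsum_modeEmbedding_zero (l := 𝓝 τ)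
    (e := fun σ n => fourier (-n ^ 2) σ • a n - fourier (-n ^ 2) τ • a n) (b := fun n => 2 * ‖a n‖)
    (by simpa only [mul_pow] using ha.mul_left (2 ^ 2)) (fun n => ?_) (fun σ n => ?_)
  · refine h.congr fun σ => ?_
    rw [tsum_modeEmbedding_sub (summable_norm_sq_fourier_smul ha σ)
      (summable_norm_sq_fourier_smul ha τ)]
    rfl
  · have hc : Continuous fun σ : AddCircle (2 * Real.pi) => fourier (-n ^ 2) σ • a n :=
      (fourier (-n ^ 2)).continuous.smul continuous_const
    have := (hc.tendsto τ).sub_const (fourier (-n ^ 2) τ • a n)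
    rwa [sub_self] at this
  · refine (norm_sub_le _ _).trans (le_of_eq ?_)
    rw [norm_fourier_smul, norm_fourier_smul]
    ring

theorem coeFn_modeEmbedding (n : ℤ) (f : L2Euclidean d) :
    modeEmbedding d n f =ᵐ[volume] modeFun n f := (memLp_modeFun n f).coeFn_toLp

/-- The sum of the modes in `s` of the profile, as a function on `ℝ^d × (𝕋 × 𝕋)`. -/
noncomputable def profileSum (a : ℤ → L2Euclidean d) (s : Finset ℤ)
    (q : EuclideanSpace ℝ (Fin d) × (AddCircle (2 * Real.pi) × AddCircle (2 * Real.pi))) : ℂ :=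
  ∑ n ∈ s, a n q.1 / (Real.sqrt (2 * Real.pi) : ℂ) * torusWave n q.2

theorem measurable_profileSum (a : ℤ → L2Euclidean d) (s : Finset ℤ) :
    Measurable (profileSum a s) := by
  unfold profileSum
  refine Finset.measurable_fun_sum s fun n _ => Measurable.mul (Measurable.div_const ?_ _)
    ((continuous_torusWave n).measurable.comp measurable_snd)
  exact (Lp.stronglyMeasurable (a n)).measurable.comp measurable_fst

theorem coeFn_sum_modeEmbedding_fourier_smul (a : ℤ → L2Euclidean d) (s : Finset ℤ)
    (τ : AddCircle (2 * Real.pi)) :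
    (∑ n ∈ s, modeEmbedding d n (fourier (-n ^ 2) τ • a n) : L2Cylinder d) =ᵐ[volume]
      fun z => profileSum a s (z.1, (τ, z.2)) := by
  have h1 : ∀ n : ℤ, (modeEmbedding d n (fourier (-n ^ 2) τ • a n) : Cylinder d → ℂ) =ᵐ[volume]
      fun z => a n z.1 / (Real.sqrt (2 * Real.pi) : ℂ) * torusWave n (τ, z.2) := by
    intro n
    rw [map_smul]
    filter_upwards [Lp.coeFn_smul (fourier (-n ^ 2) τ) (modeEmbedding d n (a n)),
      coeFn_modeEmbedding n (a n)] with z h1 h2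
    rw [h1, Pi.smul_apply, h2, smul_eq_mul, modeFun, torusWave, torusChar]
    ring
  have h2 := (ae_all_iff (ι := ℤ)).2 h1
  have h3 := Lp.coeFn_finsetSum (μ := (volume : Measure (Cylinder d))) s
    fun n => modeEmbedding d n (fourier (-n ^ 2) τ • a n)
  filter_upwards [h2, h3] with z hz h3
  rw [h3]
  simp only [Finset.sum_apply, profileSum]
  exact Finset.sum_congr rfl fun n _ => hz n

/-- The reordering `𝕋 × (ℝ^d × 𝕋) → ℝ^d × (𝕋 × 𝕋)` of the variables. -/
def moveTime (d : ℕ) (q : AddCircle (2 * Real.pi) × Cylinder d) :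
    EuclideanSpace ℝ (Fin d) × (AddCircle (2 * Real.pi) × AddCircle (2 * Real.pi)) :=
  (q.2.1, (q.1, q.2.2))

theorem measurePreserving_moveTime (d : ℕ) : MeasurePreserving (moveTime d) volume volume := by
  have h1 : MeasurePreserving (MeasurableEquiv.prodAssoc (α := AddCircle (2 * Real.pi))
    (β := EuclideanSpace ℝ (Fin d)) (γ := AddCircle (2 * Real.pi))).symm volume volume :=
    (measurePreserving_prodAssoc volume volume volume).symm
  have h2 : MeasurePreserving (Prod.map Prod.swap id :
      (AddCircle (2 * Real.pi) × EuclideanSpace ℝ (Fin d)) × AddCircle (2 * Real.pi) → _)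
      volume volume :=
    (Measure.measurePreserving_swap (μ := volume) (ν := volume)).prod (MeasurePreserving.id volume)
  have h3 : MeasurePreserving (MeasurableEquiv.prodAssoc (α := EuclideanSpace ℝ (Fin d))
    (β := AddCircle (2 * Real.pi)) (γ := AddCircle (2 * Real.pi))) volume volume :=
    measurePreserving_prodAssoc volume volume volume
  exact h3.comp (h2.comp h1)

theorem measurePreserving_moveTime_symm (d : ℕ) : MeasurePreserving
    (fun q : EuclideanSpace ℝ (Fin d) × (AddCircle (2 * Real.pi) × AddCircle (2 * Real.pi)) =>
      ((q.2.1, (q.1, q.2.2)) : AddCircle (2 * Real.pi) × Cylinder d)) volume volume := by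
  have h1 : MeasurePreserving (MeasurableEquiv.prodAssoc (α := EuclideanSpace ℝ (Fin d))
    (β := AddCircle (2 * Real.pi)) (γ := AddCircle (2 * Real.pi))).symm volume volume :=
    (measurePreserving_prodAssoc volume volume volume).symm
  have h2 : MeasurePreserving (Prod.map Prod.swap id :
      (EuclideanSpace ℝ (Fin d) × AddCircle (2 * Real.pi)) × AddCircle (2 * Real.pi) → _)
      volume volume :=
    (Measure.measurePreserving_swap (μ := volume) (ν := volume)).prod (MeasurePreserving.id volume)
  have h3 : MeasurePreserving (MeasurableEquiv.prodAssoc (α := AddCircle (2 * Real.pi))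
    (β := EuclideanSpace ℝ (Fin d)) (γ := AddCircle (2 * Real.pi))) volume volume :=
    measurePreserving_prodAssoc volume volume volume
  exact h3.comp (h2.comp h1)

/-- Tails this small make the partial sums converge almost everywhere and not only in L². One
sequence of sets serves all τ, because rotating the modes does not change their norms. -/
theorem exists_fast_finset_seq (ha : Summable fun n => ‖a n‖ ^ 2) :
    ∃ s : ℕ → Finset ℤ, Monotone s ∧ Tendsto s atTop atTop ∧
      ∀ j, ∑' n, ‖a n‖ ^ 2 - ∑ n ∈ s j, ‖a n‖ ^ 2 < ((1 / 2 : ℝ) ^ j) ^ 2 := by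
  set I : ℕ → Finset ℤ := fun m => Finset.Icc (-(m : ℤ)) m with hI
  have hmono : Monotone I := fun m k hmk => Finset.Icc_subset_Icc (by omega) (by omega)
  have htop : Tendsto I atTop atTop := tendsto_atTop_finset_of_monotone hmono fun n =>
    ⟨n.natAbs, by simp only [hI, Finset.mem_Icc]; omega⟩
  have h1 : Tendsto (fun m => ∑' n, ‖a n‖ ^ 2 - ∑ n ∈ I m, ‖a n‖ ^ 2) atTop (𝓝 0) := by
    have := (tendsto_const_nhds (x := ∑' n, ‖a n‖ ^ 2)).sub (ha.hasSum.comp htop)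
    rwa [sub_self] at this
  obtain ⟨φ, hφ, hφ'⟩ := extraction_forall_of_eventually (P := fun j m =>
    ∑' n, ‖a n‖ ^ 2 - ∑ n ∈ I m, ‖a n‖ ^ 2 < ((1 / 2 : ℝ) ^ j) ^ 2) fun j =>
      h1.eventually_lt_const (by positivity)
  exact ⟨I ∘ φ, hmono.comp hφ.monotone, htop.comp hφ.tendsto_atTop, hφ'⟩

theorem ae_tendsto_profileSum (ha : Summable fun n => ‖a n‖ ^ 2) {s : ℕ → Finset ℤ}
    (hs : Monotone s) (hs' : Tendsto s atTop atTop)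
    (hfast : ∀ j, ∑' n, ‖a n‖ ^ 2 - ∑ n ∈ s j, ‖a n‖ ^ 2 < ((1 / 2 : ℝ) ^ j) ^ 2)
    (τ : AddCircle (2 * Real.pi)) :
    ∀ᵐ z : Cylinder d, Tendsto (fun j => profileSum a (s j) (z.1, (τ, z.2))) atTop
      (𝓝 (profile a τ z)) := by
  set P : ℕ → L2Cylinder d := fun j => ∑ n ∈ s j, modeEmbedding d n (fourier (-n ^ 2) τ • a n)
    with hP
  have hlim : Tendsto P atTop (𝓝 (profile a τ)) :=
    (summable_modeEmbedding (summable_norm_sq_fourier_smul ha τ)).hasSum.comp hs'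
  have hsub : ∀ j k, j ≤ k → ‖P k - P j‖ < (1 / 2 : ℝ) ^ j := by
    intro j k hjk
    have h1 : ‖P k - P j‖ ^ 2 = ∑ n ∈ s k \ s j, ‖a n‖ ^ 2 := by
      have h2 : P k - P j = ∑ n ∈ s k \ s j, modeEmbedding d n (fourier (-n ^ 2) τ • a n) := by
        rw [sub_eq_iff_eq_add]
        exact (Finset.sum_sdiff (hs hjk)).symm
      rw [h2, (orthogonalFamily_modeEmbedding d).norm_sum fun n => fourier (-n ^ 2) τ • a n]
      simp only [norm_fourier_smul]
    have h2 := Finset.sum_sdiff (f := fun n => ‖a n‖ ^ 2) (hs hjk)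
    have h3 : ∑ n ∈ s k, ‖a n‖ ^ 2 ≤ ∑' n, ‖a n‖ ^ 2 := ha.sum_le_tsum _ fun _ _ => sq_nonneg _
    have h4 := hfast j
    exact lt_of_pow_lt_pow_left₀ 2 (by positivity) (by linarith)
  -- Two partial sums beyond N are both within 2^{-N} of the N-th one, hence within 2 · 2^{-N} of
  -- each other, which is summable.
  have hex : ∀ᵐ z : Cylinder d, ∃ l, Tendsto (fun j => P j z) atTop (𝓝 l) := by
    refine Lp.ae_tendsto_of_cauchy_eLpNorm (p := 2) (f := fun j => (P j : Cylinder d → ℂ))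
      (fun j => Lp.aestronglyMeasurable (P j)) (by norm_num)
      (B := fun N => ENNReal.ofReal (2 * (1 / 2 : ℝ) ^ N)) ?_ ?_
    · have hsum : Summable fun N : ℕ => 2 * (1 / 2 : ℝ) ^ N := summable_geometric_two.mul_left 2
      rw [← ENNReal.ofReal_tsum_of_nonneg (fun N => by positivity) hsum]
      exact ENNReal.ofReal_ne_top
    · intro N n m hn hm
      rw [← eLpNorm_congr_ae (Lp.coeFn_sub (P n) (P m)), ← Lp.enorm_def, ← ofReal_norm]
      refine (ENNReal.ofReal_lt_ofReal_iff (by positivity)).2 ?_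
      have h1 := hsub N n hn
      have h2 := hsub N m hm
      have h3 : P n - P m = (P n - P N) - (P m - P N) := by abel
      rw [h3]
      refine (norm_sub_le _ _).trans_lt ?_
      linarith
  -- A subsequence identifies the pointwise limit with the L² limit.
  obtain ⟨ns, hns, hsubseq⟩ := (tendstoInMeasure_of_tendsto_Lp hlim).exists_seq_tendsto_ae
  have hcoe := (ae_all_iff (ι := ℕ)).2 fun j => coeFn_sum_modeEmbedding_fourier_smul a (s j) τ
  filter_upwards [hex, hsubseq, hcoe] with z h1 h2 h3
  obtain ⟨l, hl⟩ := h1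
  rw [tendsto_nhds_unique h2 (hl.comp hns.tendsto_atTop)]
  exact hl.congr h3

/-- A jointly measurable representative of the profile. -/
theorem exists_measurable_profile (ha : Summable fun n => ‖a n‖ ^ 2) :
    ∃ s : ℕ → Finset ℤ, Monotone s ∧ Tendsto s atTop atTop ∧
      ∃ F : EuclideanSpace ℝ (Fin d) × (AddCircle (2 * Real.pi) × AddCircle (2 * Real.pi)) → ℂ,
        Measurable F ∧
        (∀ᵐ q, Tendsto (fun j => profileSum a (s j) q) atTop (𝓝 (F q))) ∧
        ∀ᵐ τ, (fun z : Cylinder d => F (z.1, (τ, z.2))) =ᵐ[volume] profile a τ := by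
  obtain ⟨s, hs, hs', hfast⟩ := exists_fast_finset_seq ha
  refine ⟨s, hs, hs', ?_⟩
  -- For each τ the profile is only an L² class, with no joint measurability built in. The
  -- convergence set of the explicit partial sums is measurable and, by Fubini, of full measure;
  -- their limit is the representative sought.
  have h1 : MeasurableSet {q | ∃ l, Tendsto (fun j => profileSum a (s j) q) atTop (𝓝 l)} :=
    measurableSet_exists_tendsto fun j => measurable_profileSum a (s j)
  have h2 : ∀ᵐ q : AddCircle (2 * Real.pi) × Cylinder d,
      q ∈ moveTime d ⁻¹' {q | ∃ l, Tendsto (fun j => profileSum a (s j) q) atTop (𝓝 l)} := by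
    rw [Measure.volume_eq_prod, Measure.ae_prod_mem_iff_ae_ae_mem
      ((measurePreserving_moveTime d).measurable h1)]
    refine Eventually.of_forall fun τ => ?_
    filter_upwards [ae_tendsto_profileSum ha hs hs' hfast τ] with z hz
    exact ⟨_, hz⟩
  have h3 : ∀ᵐ q, ∃ l, Tendsto (fun j => profileSum a (s j) q) atTop (𝓝 l) :=
    (measurePreserving_moveTime_symm d).quasiMeasurePreserving.ae h2
  obtain ⟨F, hFm, hF⟩ := measurable_limit_of_tendsto_metrizable_ae
    (fun j => (measurable_profileSum a (s j)).aemeasurable) h3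
  refine ⟨F, hFm, hF, ?_⟩
  have h4 := (measurePreserving_moveTime d).quasiMeasurePreserving.ae hF
  rw [Measure.volume_eq_prod] at h4
  filter_upwards [Measure.ae_ae_of_ae_prod h4] with τ hτ
  filter_upwards [hτ, ae_tendsto_profileSum ha hs hs' hfast τ] with z h5 h6
  exact tendsto_nhds_unique h5 h6

end ModeSums

/-! ### The resonant system of the profile has no nontrivial zero -/

theorem conj_torusWave {n : ℤ} (τ x : AddCircle (2 * Real.pi)) :
    (starRingEnd ℂ) (torusWave n (τ, x)) = fourier (n ^ 2) τ * fourier (-n) x := by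
  rw [torusWave, conj_torusChar, torusChar]
  simp only [Prod.fst_neg, Prod.snd_neg, neg_neg]

theorem norm_torusWave (n : ℤ) (q : AddCircle (2 * Real.pi) × AddCircle (2 * Real.pi)) :
    ‖torusWave n q‖ = 1 := norm_torusChar _ q

section

variable {d : ℕ} {a : ℤ → L2Euclidean d}
  {F : EuclideanSpace ℝ (Fin d) × (AddCircle (2 * Real.pi) × AddCircle (2 * Real.pi)) → ℂ}

/-- The L² norm of the profile does not depend on τ, and the circle has finite measure. -/
theorem memLp_of_ae_eq_profile (ha : Summable fun n => ‖a n‖ ^ 2) (hFm : Measurable F)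
    (hF : ∀ᵐ τ, (fun z : Cylinder d => F (z.1, (τ, z.2))) =ᵐ[volume] profile a τ) :
    MemLp F 2 volume := by
  refine ⟨hFm.aestronglyMeasurable, ?_⟩
  rw [eLpNorm_lt_top_iff_lintegral_rpow_enorm_lt_top (by norm_num) (by norm_num)]
  have hFe : Measurable fun q => ‖F q‖ₑ ^ (2 : ENNReal).toReal := hFm.enorm.pow_const _
  rw [← (measurePreserving_moveTime d).lintegral_comp hFe, Measure.volume_eq_prod,
    lintegral_prod (fun q => ‖F (moveTime d q)‖ₑ ^ (2 : ENNReal).toReal)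
      (hFe.comp (measurePreserving_moveTime d).measurable).aemeasurable]
  have h1 : ∀ᵐ τ : AddCircle (2 * Real.pi),
      ∫⁻ z : Cylinder d, ‖F (moveTime d (τ, z))‖ₑ ^ (2 : ENNReal).toReal ≤
        ENNReal.ofReal (Real.sqrt (∑' n, ‖a n‖ ^ 2)) ^ 2 := by
    filter_upwards [hF] with τ hτ
    rw [← norm_profile ha τ, ofReal_norm, ← lintegral_enorm_rpow_two]
    refine le_of_eq (lintegral_congr_ae ?_)
    filter_upwards [hτ] with z hz
    have : F (moveTime d (τ, z)) = profile a τ z := hz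
    rw [this]
    norm_num
  refine (lintegral_mono_ae h1).trans_lt ?_
  rw [lintegral_const]
  exact ENNReal.mul_lt_top (ENNReal.pow_lt_top ENNReal.ofReal_lt_top) (measure_lt_top _ _)

/-- The nonlinearity is at most 2|F| + |F|²: the linear part is paired with `κ` in L², the quadratic
part with `κ` bounded. -/
theorem integrable_powerNonlinearity_mul_fst_mul_conj {p : ℝ} (hp : 1 < p) (hp2 : p ≤ 2)
    (hFm : Measurable F) (hF2 : MemLp F 2 volume) {κ : EuclideanSpace ℝ (Fin d) → ℂ}
    (hκ : MemLp κ 2 volume) {M : ℝ} (hM : ∀ ξ, ‖κ ξ‖ ≤ M) (n : ℤ) :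
    Integrable fun q => κ q.1 * (powerNonlinearity p (F q) * (starRingEnd ℂ) (torusWave n q.2)) := by
  have hκ' : MemLp (fun q : EuclideanSpace ℝ (Fin d) ×
      (AddCircle (2 * Real.pi) × AddCircle (2 * Real.pi)) => κ q.1) 2 volume := hκ.comp_fst volume
  have h1 := (integrable_mul_of_memLp_two hκ' hF2).norm
  have h2 : Integrable fun q => ‖F q‖ ^ 2 := hF2.integrable_norm_pow (by norm_num)
  refine ((h1.const_mul 2).add (h2.const_mul M)).mono' (hκ'.1.mul
    ((((continuous_powerNonlinearity hp).measurable.comp hFm).mul ((Complex.continuous_conj.comp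
      (continuous_torusWave n)).measurable.comp measurable_snd)).aestronglyMeasurable))
      (Eventually.of_forall fun q => ?_)
  rw [norm_mul, norm_mul, RCLike.norm_conj, norm_torusWave, mul_one, Pi.add_apply, norm_mul]
  have h3 := mul_le_mul_of_nonneg_left (norm_powerNonlinearity_le hp hp2 (F q))
    (norm_nonneg (κ q.1))
  have h4 := mul_le_mul_of_nonneg_right (hM q.1) (sq_nonneg ‖F q‖)
  nlinarith

/-- If the nonlinearity of the profile is orthogonal to all waves `χ(ξ) e^{inx - in²τ}`, then the
profile vanishes. -/
theorem eq_zero_of_forall_integral_powerNonlinearity_profile {p : ℝ} (hp : 1 < p) (hp2 : p ≤ 2)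
    (ha : Summable fun n => ‖a n‖ ^ 2)
    (h0 : ∀ χ : EuclideanSpace ℝ (Fin d) → ℝ, ContDiff ℝ ∞ χ → HasCompactSupport χ → ∀ n : ℤ,
      ∫ τ, (∫ z, powerNonlinearity p (profile a τ z) * ((χ z.1 : ℂ) * fourier (-n) z.2)) *
        fourier (n ^ 2) τ = 0) (n : ℤ) : a n = 0 := by
  obtain ⟨s, hs, hs', F, hFm, hlim, hF⟩ := exists_measurable_profile ha
  have hF2 := memLp_of_ae_eq_profile ha hFm hF
  -- The coefficient of the nonlinearity along the n-th wave at fixed ξ. The hypothesis says that it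
  -- vanishes as a distribution in ξ; being locally integrable, it vanishes almost everywhere.
  set Θ : ℤ → EuclideanSpace ℝ (Fin d) → ℂ := fun n ξ =>
    ∫ q, powerNonlinearity p (F (ξ, q)) * (starRingEnd ℂ) (torusWave n q) with hΘ
  have hΘ0 : ∀ n, ∀ᵐ ξ, Θ n ξ = 0 := by
    intro n
    have hloc : LocallyIntegrable (Θ n) volume := by
      rw [locallyIntegrable_iff]
      intro K hK
      have hκ : MemLp (K.indicator fun _ => (1 : ℂ)) 2 (volume : Measure
          (EuclideanSpace ℝ (Fin d))) :=
        memLp_indicator_const 2 hK.measurableSet 1 (Or.inr hK.measure_lt_top.ne)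
      have h := (integrable_powerNonlinearity_mul_fst_mul_conj hp hp2 hFm hF2 hκ (M := 1)
        (fun ξ => (norm_indicator_le_norm_self _ _).trans (by simp)) n).integral_prod_left
      rw [← integrable_indicator_iff hK.measurableSet]
      refine h.congr (Eventually.of_forall fun ξ => ?_)
      simp only [integral_const_mul]
      by_cases hξ : ξ ∈ K
      · rw [indicator_of_mem hξ, indicator_of_mem hξ, one_mul]
      · rw [indicator_of_notMem hξ, indicator_of_notMem hξ, zero_mul]
    refine ae_eq_zero_of_integral_contDiff_smul_eq_zero hloc fun χ hχ hχc => ?_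
    have hχ' : Continuous fun ξ => (χ ξ : ℂ) := Complex.continuous_ofReal.comp hχ.continuous
    have hχc' : HasCompactSupport fun ξ => (χ ξ : ℂ) := hχc.comp_left Complex.ofReal_zero
    obtain ⟨M, hM⟩ := hχ'.bounded_above_of_compact_support hχc'
    have hint := integrable_powerNonlinearity_mul_fst_mul_conj hp hp2 hFm hF2
      (hχ'.memLp_of_hasCompactSupport hχc') hM n
    have e1 : ∫ ξ, χ ξ • Θ n ξ = ∫ q : EuclideanSpace ℝ (Fin d) ×
        (AddCircle (2 * Real.pi) × AddCircle (2 * Real.pi)),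
          (χ q.1 : ℂ) * (powerNonlinearity p (F q) * (starRingEnd ℂ) (torusWave n q.2)) := by
      rw [Measure.volume_eq_prod, integral_prod _ hint]
      refine integral_congr_ae (Eventually.of_forall fun ξ => ?_)
      simp only [integral_const_mul, Complex.real_smul, hΘ]
    have hmp := measurePreserving_moveTime d
    have hint' : Integrable fun q : AddCircle (2 * Real.pi) × Cylinder d =>
        (χ (moveTime d q).1 : ℂ) * (powerNonlinearity p (F (moveTime d q)) *
          (starRingEnd ℂ) (torusWave n (moveTime d q).2)) :=
      hmp.integrable_comp_of_integrable hint
    have e2 : ∫ q : EuclideanSpace ℝ (Fin d) ×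
        (AddCircle (2 * Real.pi) × AddCircle (2 * Real.pi)),
          (χ q.1 : ℂ) * (powerNonlinearity p (F q) * (starRingEnd ℂ) (torusWave n q.2)) =
        ∫ q, (χ (moveTime d q).1 : ℂ) * (powerNonlinearity p (F (moveTime d q)) *
          (starRingEnd ℂ) (torusWave n (moveTime d q).2)) := by
      rw [← hmp.map_eq]
      exact integral_map hmp.measurable.aemeasurable (by rw [hmp.map_eq]; exact hint.1)
    rw [e1, e2, Measure.volume_eq_prod, integral_prod _ hint', ← h0 χ hχ hχc n]
    refine integral_congr_ae ?_
    filter_upwards [hF] with τ hτ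
    rw [← integral_mul_const]
    refine integral_congr_ae ?_
    filter_upwards [hτ] with z hz
    have : F (moveTime d (τ, z)) = profile a τ z := hz
    simp only [this]
    simp only [moveTime, conj_torusWave]
    ring
  -- Tonelli: the integral over ξ of Σ|aₙ(ξ)|² is the finite sum of the ‖aₙ‖². The torus result can
  -- then be applied at almost every ξ.
  have hsum : ∀ᵐ ξ, Summable fun n => ‖a n ξ‖ ^ 2 := by
    have h1 : ∫⁻ ξ, ∑' n, ‖a n ξ‖ₑ ^ 2 ≠ ⊤ := by
      rw [lintegral_tsum fun n => (Lp.aestronglyMeasurable (a n)).enorm.pow_const 2]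
      have h2 : ∀ n, ∫⁻ ξ, ‖a n ξ‖ₑ ^ 2 = ENNReal.ofReal (‖a n‖ ^ 2) := by
        intro n
        have := lintegral_enorm_rpow_two (a n)
        rw [ENNReal.ofReal_pow (norm_nonneg _), ofReal_norm, ← this]
        norm_num
      simp only [h2]
      rw [← ENNReal.ofReal_tsum_of_nonneg (fun n => sq_nonneg _) ha]
      exact ENNReal.ofReal_ne_top
    have hm : AEMeasurable (fun ξ => ∑' n, ‖a n ξ‖ₑ ^ 2) volume :=
      AEMeasurable.tsum fun n => (Lp.aestronglyMeasurable (a n)).enorm.pow_const 2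
    filter_upwards [ae_lt_top' hm h1] with ξ hξ
    have := ENNReal.summable_toReal hξ.ne
    simpa only [ENNReal.toReal_pow, toReal_enorm] using this
  have hlim' : ∀ᵐ ξ, ∀ᵐ q, Tendsto (fun j => profileSum a (s j) (ξ, q)) atTop (𝓝 (F (ξ, q))) := by
    rw [Measure.volume_eq_prod] at hlim
    exact Measure.ae_ae_of_ae_prod hlim
  rw [Lp.eq_zero_iff_ae_eq_zero]
  filter_upwards [hsum, hlim', (ae_all_iff (ι := ℤ)).2 hΘ0] with ξ h1 h2 h3
  have hpi : (Real.sqrt (2 * Real.pi) : ℂ) ≠ 0 := by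
    exact_mod_cast (Real.sqrt_pos.2 Real.two_pi_pos).ne'
  have h4 : Summable fun n => ‖a n ξ / (Real.sqrt (2 * Real.pi) : ℂ)‖ ^ 2 := by
    simp only [norm_div, div_pow]
    exact h1.div_const _
  have := eq_zero_of_forall_integral_powerNonlinearity_mul_conj_torusWave hp hp2 h4 hs hs'
    (hFm.comp measurable_prodMk_left) h2 h3 n
  exact (div_eq_zero_iff.1 this).resolve_right hpi

end

/-! ### The Laplacian of a modulated profile -/

/-- The quadratic phase `e^{-iθ|y|²}`. -/
noncomputable def quadraticPhase {V : Type*} [NormedAddCommGroup V] (θ : ℝ) (y : V) : ℂ :=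
  Complex.exp ((-(θ * ‖y‖ ^ 2) : ℝ) * Complex.I)

section QuadraticPhase

variable {V : Type*} [NormedAddCommGroup V] [InnerProductSpace ℝ V]

theorem contDiff_quadraticPhase (θ : ℝ) : ContDiff ℝ ∞ (quadraticPhase (V := V) θ) := by
  unfold quadraticPhase
  have h : ContDiff ℝ ∞ fun y : V => (-(θ * ‖y‖ ^ 2) : ℝ) :=
    (contDiff_const.mul (contDiff_norm_sq ℝ)).neg
  exact Complex.contDiff_exp.comp ((Complex.ofRealCLM.contDiff.comp h).mul contDiff_const)

theorem fderiv_quadraticPhase (θ : ℝ) (y v : V) :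
    fderiv ℝ (quadraticPhase θ) y v =
      -(2 * θ * Complex.I) * ((inner ℝ y v : ℝ) : ℂ) * quadraticPhase θ y := by
  have h1 : HasFDerivAt (fun y : V => (-(θ * ‖y‖ ^ 2) : ℝ)) _ y :=
    ((hasStrictFDerivAt_norm_sq y).hasFDerivAt.const_mul θ).neg
  have h2 := ((Complex.ofRealCLM.hasFDerivAt.comp y h1).mul_const Complex.I).cexp
  have h3 : fderiv ℝ (quadraticPhase θ) y = _ := h2.fderiv
  rw [h3]
  simp [quadraticPhase]
  ring

theorem fderiv_comp_smul_apply {f : V → ℂ} (hf : ContDiff ℝ ∞ f) (c : ℝ) (y v : V) :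
    fderiv ℝ (fun x => f (c • x)) y v = c * fderiv ℝ f (c • y) v := by
  have h := (hf.differentiable (by simp) (c • y)).hasFDerivAt.comp y
    ((hasFDerivAt_id y).const_smul c)
  have h2 : fderiv ℝ (fun x => f (c • x)) y = _ := h.fderiv
  rw [h2]
  simp

end QuadraticPhase

section Laplacian

variable {V : Type*} [NormedAddCommGroup V] [InnerProductSpace ℝ V] [FiniteDimensional ℝ V]

theorem laplacian_eq_sum_fderiv {f : V → ℂ} (hf : ContDiff ℝ ∞ f) (y : V) :
    (Δ f) y = ∑ i, fderiv ℝ (fun x => fderiv ℝ f x (stdOrthonormalBasis ℝ V i)) y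
      (stdOrthonormalBasis ℝ V i) := by
  rw [InnerProductSpace.laplacian_eq_iteratedFDeriv_stdOrthonormalBasis]
  refine Finset.sum_congr rfl fun i _ => ?_
  rw [iteratedFDeriv_two_apply]
  have h : DifferentiableAt ℝ (fderiv ℝ f) y :=
    ((hf.fderiv_right (m := ∞) (by simp)).differentiable (by simp)).differentiableAt
  rw [fderiv_clm_apply h (by fun_prop)]
  simp

theorem laplacian_mul {f g : V → ℂ} (hf : ContDiff ℝ ∞ f) (hg : ContDiff ℝ ∞ g) (y : V) :
    (Δ (fun x => f x * g x)) y = (Δ f) y * g y +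
      2 * ∑ i, fderiv ℝ f y (stdOrthonormalBasis ℝ V i) * fderiv ℝ g y (stdOrthonormalBasis ℝ V i) +
        f y * (Δ g) y := by
  rw [laplacian_eq_sum_fderiv (hf.mul hg), laplacian_eq_sum_fderiv hf, laplacian_eq_sum_fderiv hg,
    Finset.sum_mul, Finset.mul_sum, Finset.mul_sum, ← Finset.sum_add_distrib,
    ← Finset.sum_add_distrib]
  refine Finset.sum_congr rfl fun i _ => ?_
  set e := stdOrthonormalBasis ℝ V i
  have hfd : ∀ x, DifferentiableAt ℝ f x := fun x => (hf.differentiable (by simp)) x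
  have hgd : ∀ x, DifferentiableAt ℝ g x := fun x => (hg.differentiable (by simp)) x
  have hf' : DifferentiableAt ℝ (fun x => fderiv ℝ f x e) y :=
    (((hf.fderiv_right (m := ∞) (by simp)).clm_apply contDiff_const).differentiable (by simp)) y
  have hg' : DifferentiableAt ℝ (fun x => fderiv ℝ g x e) y :=
    (((hg.fderiv_right (m := ∞) (by simp)).clm_apply contDiff_const).differentiable (by simp)) y
  have h1 : (fun x => fderiv ℝ (fun x => f x * g x) x e) =
      fun x => f x * fderiv ℝ g x e + g x * fderiv ℝ f x e := by
    funext x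
    rw [fderiv_fun_mul (hfd x) (hgd x)]
    simp
  rw [h1, fderiv_fun_add ((hfd y).fun_mul hg') ((hgd y).fun_mul hf'), fderiv_fun_mul (hfd y) hg',
    fderiv_fun_mul (hgd y) hf']
  simp only [add_apply, smul_apply, smul_eq_mul]
  ring

theorem laplacian_comp_smul {f : V → ℂ} (hf : ContDiff ℝ ∞ f) (c : ℝ) (y : V) :
    (Δ (fun x => f (c • x))) y = (c : ℂ) ^ 2 * (Δ f) (c • y) := by
  have hfc : ContDiff ℝ ∞ fun x => f (c • x) := hf.comp (contDiff_const_smul c)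
  rw [laplacian_eq_sum_fderiv hfc, laplacian_eq_sum_fderiv hf, Finset.mul_sum]
  refine Finset.sum_congr rfl fun i _ => ?_
  set e := stdOrthonormalBasis ℝ V i
  have hf' : ContDiff ℝ ∞ fun x => fderiv ℝ f x e :=
    (hf.fderiv_right (m := ∞) (by simp)).clm_apply contDiff_const
  simp only [fderiv_comp_smul_apply hf]
  have hfc' : ContDiff ℝ ∞ fun x => fderiv ℝ f (c • x) e := hf'.comp (contDiff_const_smul c)
  rw [fderiv_const_mul (hfc'.differentiable (by simp) y),
    smul_apply, fderiv_comp_smul_apply hf', smul_eq_mul]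
  ring

theorem laplacian_quadraticPhase (θ : ℝ) (y : V) :
    (Δ (quadraticPhase (V := V) θ)) y = (-(2 * θ * Complex.I) * Module.finrank ℝ V -
      4 * θ ^ 2 * ‖y‖ ^ 2) * quadraticPhase θ y := by
  rw [laplacian_eq_sum_fderiv (contDiff_quadraticPhase θ)]
  have h : ∀ i, fderiv ℝ (fun x => fderiv ℝ (quadraticPhase θ) x (stdOrthonormalBasis ℝ V i)) y
      (stdOrthonormalBasis ℝ V i) = -(2 * θ * Complex.I) * quadraticPhase θ y -
        4 * θ ^ 2 * quadraticPhase θ y *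
          (((inner ℝ y (stdOrthonormalBasis ℝ V i)) ^ 2 : ℝ) : ℂ) := by
    intro i
    set e := stdOrthonormalBasis ℝ V i
    have hen : ‖e‖ = 1 := (stdOrthonormalBasis ℝ V).norm_eq_one i
    simp only [fderiv_quadraticPhase]
    have h1 : HasFDerivAt (fun x : V => ((inner ℝ x e : ℝ) : ℂ)) _ y :=
      Complex.ofRealCLM.hasFDerivAt.comp y ((hasFDerivAt_id y).inner ℝ (hasFDerivAt_const e y))
    have h2 := (h1.const_mul (-(2 * θ * Complex.I))).mul
      ((contDiff_quadraticPhase θ).differentiable (by simp) y).hasFDerivAt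
    have h3 : fderiv ℝ (fun x : V => -(2 * θ * Complex.I) * ((inner ℝ x e : ℝ) : ℂ) *
      quadraticPhase θ x) y = _ := h2.fderiv
    rw [h3]
    simp [fderiv_quadraticPhase, hen]
    ring_nf
    simp only [Complex.I_sq]
    ring
  simp only [h]
  rw [Finset.sum_sub_distrib, Finset.sum_const, ← Finset.mul_sum, ← Complex.ofReal_sum,
    (stdOrthonormalBasis ℝ V).sum_sq_inner_left y]
  simp
  ring

end Laplacian

/-! ### Wave packets -/

section Packet

variable {d : ℕ}

/-- The wave packet `e^{-i|y|²/(4t)} χ(y / (4πt))`. -/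
noncomputable def packet (χ : EuclideanSpace ℝ (Fin d) → ℂ) (t : ℝ)
    (y : EuclideanSpace ℝ (Fin d)) : ℂ :=
  quadraticPhase (1 / (4 * t)) y * χ ((4 * Real.pi * t)⁻¹ • y)

/-- The time derivative of the wave packet. -/
noncomputable def packetDeriv (χ : EuclideanSpace ℝ (Fin d) → ℂ) (t : ℝ)
    (y : EuclideanSpace ℝ (Fin d)) : ℂ :=
  quadraticPhase (1 / (4 * t)) y * (Complex.I * (‖y‖ ^ 2 / (4 * t ^ 2)) * χ ((4 * Real.pi * t)⁻¹ • y) -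
    (1 / t) * fderiv ℝ χ ((4 * Real.pi * t)⁻¹ • y) ((4 * Real.pi * t)⁻¹ • y))

variable {χ : EuclideanSpace ℝ (Fin d) → ℂ}

theorem contDiff_packet (hχ : ContDiff ℝ ∞ χ) (t : ℝ) : ContDiff ℝ ∞ (packet χ t) :=
  (contDiff_quadraticPhase _).mul (hχ.comp (contDiff_const_smul _))

theorem hasCompactSupport_packet (hχ : HasCompactSupport χ) {t : ℝ} (ht : 0 < t) :
    HasCompactSupport (packet χ t) := by
  have : HasCompactSupport fun y => χ ((4 * Real.pi * t)⁻¹ • y) :=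
    hχ.comp_homeomorph (Homeomorph.smulOfNeZero (4 * Real.pi * t)⁻¹ (by positivity))
  exact this.mul_left

theorem hasDerivAt_packet (hχ : ContDiff ℝ ∞ χ) {t : ℝ} (ht : 0 < t)
    (y : EuclideanSpace ℝ (Fin d)) :
    HasDerivAt (fun s => packet χ s y) (packetDeriv χ t y) t := by
  have hpi := Real.pi_pos
  have h1 : HasDerivAt (fun s : ℝ => -(1 / (4 * s) * ‖y‖ ^ 2)) (‖y‖ ^ 2 / (4 * t ^ 2)) t := by
    have h := ((((hasDerivAt_id t).const_mul 4).inv (by simp; positivity)).mul_const (‖y‖ ^ 2)).neg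
    simp only [id, ← one_div] at h
    refine h.congr_deriv ?_
    field_simp
  have h2 := ((h1.ofReal_comp).mul_const Complex.I).cexp
  have h3 : HasDerivAt (fun s : ℝ => (4 * Real.pi * s)⁻¹ • y)
      (-(1 / t) • (4 * Real.pi * t)⁻¹ • y) t := by
    have h := (((hasDerivAt_id t).const_mul (4 * Real.pi)).inv (by simp; positivity)).smul_const y
    simp only [id] at h
    refine h.congr_deriv ?_
    rw [smul_smul]
    congr 1
    field_simp
  have h4 := (hχ.differentiable (by simp) ((4 * Real.pi * t)⁻¹ • y)).hasFDerivAt.comp_hasDerivAt t h3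
  refine (h2.mul h4).congr_deriv ?_
  rw [packetDeriv, quadraticPhase, map_smul]
  simp only [Function.comp_apply, Complex.real_smul]
  push_cast
  ring

/-- The packet is an approximate solution of the adjoint free equation: the terms in |y|² and the
transport terms cancel. What is left is the growth rate d/(2t) due to the missing factor t^{-d/2},
and an error with the integrable factor t^{-2}. -/
theorem packetDeriv_add_laplacian (hχ : ContDiff ℝ ∞ χ) {t : ℝ} (ht : 0 < t)
    (y : EuclideanSpace ℝ (Fin d)) :
    packetDeriv χ t y + Complex.I * (Δ (packet χ t)) y =
      (d / (2 * t)) * packet χ t y + Complex.I * ((4 * Real.pi * t : ℝ) : ℂ)⁻¹ ^ 2 *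
        packet (Δ χ) t y := by
  have hpi := Real.pi_pos
  set c := (4 * Real.pi * t)⁻¹ with hc
  have hχc : ContDiff ℝ ∞ fun x => χ (c • x) := hχ.comp (contDiff_const_smul c)
  have h1 : (Δ (packet χ t)) y = _ := laplacian_mul (contDiff_quadraticPhase (1 / (4 * t))) hχc y
  have h2 : ∑ i, fderiv ℝ (quadraticPhase (1 / (4 * t))) y
      (stdOrthonormalBasis ℝ (EuclideanSpace ℝ (Fin d)) i) *
        fderiv ℝ (fun x => χ (c • x)) y (stdOrthonormalBasis ℝ (EuclideanSpace ℝ (Fin d)) i) =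
      -(2 * (1 / (4 * t) : ℝ) * Complex.I) * quadraticPhase (1 / (4 * t)) y *
        fderiv ℝ χ (c • y) (c • y) := by
    have h3 : fderiv ℝ χ (c • y) (c • y) =
        ∑ i, ((inner ℝ y (stdOrthonormalBasis ℝ (EuclideanSpace ℝ (Fin d)) i) : ℝ) : ℂ) *
          (c * fderiv ℝ χ (c • y) (stdOrthonormalBasis ℝ (EuclideanSpace ℝ (Fin d)) i)) := by
      conv_lhs => rw [map_smul, ← (stdOrthonormalBasis ℝ (EuclideanSpace ℝ (Fin d))).sum_repr' y]
      rw [map_sum, Finset.smul_sum]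
      refine Finset.sum_congr rfl fun i _ => ?_
      rw [(stdOrthonormalBasis ℝ (EuclideanSpace ℝ (Fin d))).sum_repr' y, map_smul,
        Complex.real_smul, Complex.real_smul, real_inner_comm]
      ring
    rw [h3, Finset.mul_sum]
    refine Finset.sum_congr rfl fun i _ => ?_
    rw [fderiv_quadraticPhase, fderiv_comp_smul_apply hχ]
    ring
  rw [h1, h2, laplacian_comp_smul hχ, laplacian_quadraticPhase, finrank_euclideanSpace,
    Fintype.card_fin, packet, packet, packetDeriv, ← hc, ← Complex.ofReal_inv, ← hc]
  generalize quadraticPhase (1 / (4 * t)) y = E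
  generalize fderiv ℝ χ (c • y) (c • y) = D
  generalize χ (c • y) = X
  generalize (Δ χ) (c • y) = L
  have ht' : (t : ℂ) ≠ 0 := Complex.ofReal_ne_zero.2 ht.ne'
  push_cast
  field_simp
  ring_nf
  simp only [Complex.I_sq]
  ring

theorem continuousOn_packetDeriv (hχ : ContDiff ℝ ∞ χ) :
    ContinuousOn (Function.uncurry (packetDeriv χ)) (Ioi 0 ×ˢ univ) := by
  have hpi := Real.pi_pos
  have ht : ∀ q ∈ (Ioi (0 : ℝ) ×ˢ (univ : Set (EuclideanSpace ℝ (Fin d)))), q.1 ≠ 0 :=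
    fun q hq => (mem_Ioi.1 hq.1).ne'
  have h0 : ContinuousOn (fun q : ℝ × EuclideanSpace ℝ (Fin d) => (4 * Real.pi * q.1)⁻¹ • q.2)
      (Ioi 0 ×ˢ univ) :=
    ((continuousOn_const.mul continuousOn_fst).inv₀ fun q hq => mul_ne_zero (by positivity)
      (ht q hq)).smul continuousOn_snd
  have h1 : ContinuousOn (fun q : ℝ × EuclideanSpace ℝ (Fin d) =>
      quadraticPhase (1 / (4 * q.1)) q.2) (Ioi 0 ×ˢ univ) := by
    unfold quadraticPhase
    refine Complex.continuous_exp.comp_continuousOn (ContinuousOn.mul ?_ continuousOn_const)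
    refine Complex.continuous_ofReal.comp_continuousOn (ContinuousOn.neg (ContinuousOn.mul ?_
      (by fun_prop)))
    exact continuousOn_const.div (by fun_prop) fun q hq => mul_ne_zero (by norm_num) (ht q hq)
  have h2 := hχ.continuous.comp_continuousOn h0
  have h3 := (hχ.continuous_fderiv (by simp)).comp_continuousOn h0
  have h4 : ContinuousOn (fun q : ℝ × EuclideanSpace ℝ (Fin d) =>
      Complex.I * ((‖q.2‖ : ℂ) ^ 2 / (4 * (q.1 : ℂ) ^ 2))) (Ioi 0 ×ˢ univ) := by
    refine continuousOn_const.mul (ContinuousOn.div (by fun_prop) (by fun_prop) fun q hq => ?_)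
    exact mul_ne_zero (by norm_num) (pow_ne_zero 2 (Complex.ofReal_ne_zero.2 (ht q hq)))
  have h5 : ContinuousOn (fun q : ℝ × EuclideanSpace ℝ (Fin d) => (1 / (q.1 : ℂ)))
      (Ioi 0 ×ˢ univ) :=
    ContinuousOn.div continuousOn_const (by fun_prop) fun q hq =>
      Complex.ofReal_ne_zero.2 (ht q hq)
  exact h1.mul ((h4.mul h2).sub (h5.mul (h3.clm_apply h0)))

end Packet

/-! ### Wave packets tested against a solution -/

theorem hasDerivAt_fourier_coe (n : ℤ) (s : ℝ) :
    HasDerivAt (fun r : ℝ => fourier n (r : AddCircle (2 * Real.pi)))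
      (Complex.I * n * fourier n (s : AddCircle (2 * Real.pi))) s := by
  refine (hasDerivAt_fourier (2 * Real.pi) n s).congr_deriv ?_
  have : (Real.pi : ℂ) ≠ 0 := Complex.ofReal_ne_zero.2 Real.pi_ne_zero
  push_cast
  field_simp

theorem contDiff_fourier_coe (n : ℤ) :
    ContDiff ℝ ∞ fun s : ℝ => (fourier n (s : AddCircle (2 * Real.pi)) : ℂ) := by
  simp only [fourier_coe_apply]
  refine Complex.contDiff_exp.comp (ContDiff.div_const (contDiff_const.mul ?_) _)
  exact Complex.ofRealCLM.contDiff

theorem circleSecondDeriv_fourier (n : ℤ) (x : AddCircle (2 * Real.pi)) :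
    circleSecondDeriv (fun x => fourier n x) x = -(n : ℂ) ^ 2 * fourier n x := by
  obtain ⟨s, rfl⟩ := QuotientAddGroup.mk_surjective x
  refine (circleSecondDeriv_coe _ s).trans ?_
  rw [iteratedDeriv_succ, iteratedDeriv_one]
  have h : deriv (fun r : ℝ => (fourier n (r : AddCircle (2 * Real.pi)) : ℂ)) =
      fun r : ℝ => Complex.I * n * fourier n (r : AddCircle (2 * Real.pi)) :=
    funext fun r => (hasDerivAt_fourier_coe n r).deriv
  rw [h, ((hasDerivAt_fourier_coe n s).const_mul (Complex.I * n)).deriv]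
  change _ = -(n : ℂ) ^ 2 * fourier n (s : AddCircle (2 * Real.pi))
  linear_combination (n : ℂ) ^ 2 * fourier n (s : AddCircle (2 * Real.pi)) * Complex.I_sq

section

variable {d : ℕ} {p : ℝ} {u : ℝ → L2Cylinder d} {χ : EuclideanSpace ℝ (Fin d) → ℂ}

theorem continuous_mul_fourier (hχ : Continuous χ) (n : ℤ) :
    Continuous fun z : Cylinder d => χ z.1 * fourier n z.2 := by
  fun_prop

theorem memLp_mul_fourier (hχ : Continuous χ) (hχc : HasCompactSupport χ) (n : ℤ) :
    MemLp (fun z : Cylinder d => χ z.1 * fourier n z.2) 2 volume :=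
  (continuous_mul_fourier hχ n).memLp_of_hasCompactSupport (hasCompactSupport_mul_snd _ hχc)

/-- At times s ≤ 2t the packet lives where |y| ≤ 4πsR ≤ 8πtR, so one compact set serves all times
near t, as the moving test function requires. -/
theorem packet_eq_zero {t s R : ℝ} (hR : 0 < R) (hχR : tsupport χ ⊆ Metric.closedBall 0 R)
    (ht : 0 < t) (hs : s ∈ Metric.ball t (t / 2)) {y : EuclideanSpace ℝ (Fin d)}
    (hy : y ∉ Metric.closedBall (0 : EuclideanSpace ℝ (Fin d)) (8 * Real.pi * t * R)) :
    packet χ s y = 0 := by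
  have hpi := Real.pi_pos
  rw [Metric.mem_ball, Real.dist_eq, abs_lt] at hs
  have hs0 : 0 < s := by linarith [hs.1]
  have hχ0 : χ ((4 * Real.pi * s)⁻¹ • y) = 0 := by
    refine image_eq_zero_of_notMem_tsupport fun h => hy ?_
    have h1 := hχR h
    rw [mem_closedBall_zero_iff, norm_smul, Real.norm_of_nonneg (by positivity),
      inv_mul_le_iff₀ (by positivity)] at h1
    rw [mem_closedBall_zero_iff]
    refine h1.trans ?_
    have : s ≤ 2 * t := by linarith [hs.2]
    calc 4 * Real.pi * s * R ≤ 4 * Real.pi * (2 * t) * R := by gcongr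
      _ = 8 * Real.pi * t * R := by ring
  rw [packet, hχ0, mul_zero]

/-- The Laplacian of the packet enters once through the equation and once, with opposite sign,
through the motion of the packet. After this cancellation only the rate d/(2t), the frequency n² of
the mode and the t^{-2} error accompany the nonlinear term. -/
theorem IsNLSSolution.hasDerivAt_integral_packet (hu : IsNLSSolution d p u) (hp : 1 < p)
    (hp2 : p ≤ 2) (hχ : ContDiff ℝ ∞ χ) (hχc : HasCompactSupport χ) (n : ℤ) {t : ℝ} (ht : 0 < t) :
    HasDerivAt (fun s => ∫ z, u s z * (packet χ s z.1 * fourier n z.2))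
      (-Complex.I * (∫ z, powerNonlinearity p (u t z) * (packet χ t z.1 * fourier n z.2)) +
        (d / (2 * t) - Complex.I * n ^ 2) * (∫ z, u t z * (packet χ t z.1 * fourier n z.2)) +
        Complex.I * ((4 * Real.pi * t : ℝ) : ℂ)⁻¹ ^ 2 *
          ∫ z, u t z * (packet (Δ χ) t z.1 * fourier n z.2)) t := by
  obtain ⟨R, hR, hχR⟩ := hχc.isCompact.isBounded.subset_closedBall_lt 0 0
  have hφ := contDiff_packet hχ t
  have hφc := hasCompactSupport_packet hχc ht
  have hLc : Continuous (packet (Δ χ) t) :=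
    (contDiff_quadraticPhase _).continuous.mul
      ((continuous_laplacian hχ).comp (continuous_const_smul _))
  have hLcs := hasCompactSupport_packet (hasCompactSupport_laplacian hχc) ht
  have hlap : cylinderLaplacian (fun z : Cylinder d => packet χ t z.1 * fourier n z.2) =
      fun z => (Δ (packet χ t)) z.1 * fourier n z.2 -
        n ^ 2 * (packet χ t z.1 * fourier n z.2) := by
    funext z
    rw [cylinderLaplacian_mul (fun x => (fourier n x : ℂ)) hφ z, circleSecondDeriv_fourier]
    ring
  have hΔc := continuous_laplacian hφ
  have hΔcs := hasCompactSupport_laplacian hφc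
  have hc1 := continuous_mul_fourier (d := d) hΔc n
  have hc2 := continuous_mul_fourier (d := d) hφ.continuous n
  have hs1 : HasCompactSupport fun z : Cylinder d => (Δ (packet χ t)) z.1 * fourier n z.2 :=
    hasCompactSupport_mul_snd _ hΔcs
  have hs2 : HasCompactSupport fun z : Cylinder d => packet χ t z.1 * fourier n z.2 :=
    hasCompactSupport_mul_snd _ hφc
  have hlc : Continuous fun z : Cylinder d => (Δ (packet χ t)) z.1 * fourier n z.2 -
      (n : ℂ) ^ 2 * (packet χ t z.1 * fourier n z.2) := hc1.sub (continuous_const.mul hc2)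
  have hls : HasCompactSupport fun z : Cylinder d => (Δ (packet χ t)) z.1 * fourier n z.2 -
      (n : ℂ) ^ 2 * (packet χ t z.1 * fourier n z.2) := hs1.sub hs2.mul_left
  have hD := hu.hasDerivAt_integral_mul hp hp2
    (isTestFunction_mul hφ hφc (contDiff_fourier_coe n)) hc2 (by rw [hlap]; exact hlc)
    (by rw [hlap]; exact hls) t
  rw [hlap] at hD
  have hmove := hasDerivAt_integral_mul_of_moving_test (u := u) (t₀ := t) hu.continuous.continuousAt
    (W := fun s z => packet χ s z.1 * fourier n z.2)
    (W' := fun s z => packetDeriv χ s z.1 * fourier n z.2)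
    (K := Metric.closedBall (0 : EuclideanSpace ℝ (Fin d)) (8 * Real.pi * t * R) ×ˢ univ)
    ((isCompact_closedBall _ _).prod isCompact_univ) (δ := t / 2) (by positivity)
    (fun s hs z hz => by
      rw [packet_eq_zero hR hχR ht hs fun h => hz ⟨h, mem_univ _⟩, zero_mul])
    (fun s hs z => by
      rw [Metric.mem_ball, Real.dist_eq, abs_lt] at hs
      exact (hasDerivAt_packet hχ (by linarith [hs.1]) z.1).mul_const _)
    (fun s => continuous_mul_fourier (contDiff_packet hχ s).continuous n)
    (by
      have h1 : ContinuousOn (fun q : ℝ × Cylinder d => packetDeriv χ q.1 q.2.1)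
          (Metric.ball t (t / 2) ×ˢ univ) :=
        (continuousOn_packetDeriv hχ).comp (f := fun q : ℝ × Cylinder d => (q.1, q.2.1))
          (by fun_prop) fun q hq => by
            have hs := hq.1
            rw [Metric.mem_ball, Real.dist_eq, abs_lt] at hs
            exact ⟨mem_Ioi.2 (by linarith [hs.1]), mem_univ _⟩
      exact h1.mul (by fun_prop))
    hD
  refine hmove.congr_deriv ?_
  have hder : packetDeriv χ t = fun y => (d / (2 * t)) * packet χ t y +
      Complex.I * ((4 * Real.pi * t : ℝ) : ℂ)⁻¹ ^ 2 * packet (Δ χ) t y -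
        Complex.I * (Δ (packet χ t)) y := by
    funext y
    rw [← packetDeriv_add_laplacian hχ ht]
    ring
  have hi1 := integrable_mul_of_memLp_two (Lp.memLp (u t)) (hc1.memLp_of_hasCompactSupport hs1)
  have hi2 := integrable_mul_of_memLp_two (Lp.memLp (u t)) (hc2.memLp_of_hasCompactSupport hs2)
  have hi3 := integrable_mul_of_memLp_two (Lp.memLp (u t)) (memLp_mul_fourier hLc hLcs n)
  have hi23 : ∀ a b : ℂ, Integrable fun z => a * (u t z * (packet χ t z.1 * fourier n z.2)) +
      b * (u t z * (packet (Δ χ) t z.1 * fourier n z.2)) := fun a b =>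
    (hi2.const_mul a).add (hi3.const_mul b)
  have e1 : ∫ z, u t z * ((Δ (packet χ t)) z.1 * fourier n z.2 -
      (n : ℂ) ^ 2 * (packet χ t z.1 * fourier n z.2)) =
      (∫ z, u t z * ((Δ (packet χ t)) z.1 * fourier n z.2)) -
        (n : ℂ) ^ 2 * ∫ z, u t z * (packet χ t z.1 * fourier n z.2) := by
    rw [← integral_const_mul, ← integral_sub hi1 (hi2.const_mul _)]
    exact integral_congr_ae (Eventually.of_forall fun z => by ring)
  have e2 : ∫ z, u t z * (packetDeriv χ t z.1 * fourier n z.2) =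
      (d / (2 * t)) * (∫ z, u t z * (packet χ t z.1 * fourier n z.2)) +
      Complex.I * ((4 * Real.pi * t : ℝ) : ℂ)⁻¹ ^ 2 *
        (∫ z, u t z * (packet (Δ χ) t z.1 * fourier n z.2)) -
      Complex.I * ∫ z, u t z * ((Δ (packet χ t)) z.1 * fourier n z.2) := by
    rw [← integral_const_mul, ← integral_const_mul, ← integral_const_mul,
      ← integral_add (hi2.const_mul _) (hi3.const_mul _),
      ← integral_sub (hi23 _ _) (hi1.const_mul _)]
    refine integral_congr_ae (Eventually.of_forall fun z => ?_)
    simp only [hder]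
    ring
  rw [e1, e2]
  ring

theorem lensWeight_eq (d : ℕ) {t : ℝ} (ht : 1 ≤ t) (ξ : EuclideanSpace ℝ (Fin d)) :
    lensWeight d t ξ = ((lensScale t ^ ((d : ℝ) / 2) : ℝ) : ℂ) *
      quadraticPhase (1 / (4 * t)) (lensScale t • ξ) := by
  have ht0 : 0 < t := by linarith
  rw [lensWeight, quadraticPhase, norm_smul, Real.norm_of_nonneg (lensScale_pos t).le,
    lensScale_of_one_le ht]
  congr 4
  field_simp

theorem packet_lensScale_smul {t : ℝ} (ht : 1 ≤ t) (ξ : EuclideanSpace ℝ (Fin d)) :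
    packet χ t (lensScale t • ξ) = quadraticPhase (1 / (4 * t)) (lensScale t • ξ) * χ ξ := by
  rw [packet, ← lensScale_of_one_le ht, inv_smul_smul₀ (lensScale_pos t).ne']

/-- The substitution y = 4πtξ freezes the moving packet into χ. Half of the Jacobian (4πt)^d goes
into the lens weight, the other half stays in front. -/
theorem integral_mul_packet_eq (v : Cylinder d → ℂ) {t : ℝ} (ht : 1 ≤ t) (n : ℤ) :
    ∫ z, v z * (packet χ t z.1 * fourier n z.2) = ((lensScale t ^ ((d : ℝ) / 2) : ℝ) : ℂ) *
      ∫ z : Cylinder d, lensWeight d t z.1 * v (lensScale t • z.1, z.2) *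
        (χ z.1 * fourier n z.2) := by
  rw [(cylinderLensData d t).integral_eq]
  have h1 : ((((cylinderLensData d t).modulus : ℝ) ^ 2 : ℝ) : ℂ) =
      ((lensScale t ^ ((d : ℝ) / 2) : ℝ) : ℂ) * ((lensScale t ^ ((d : ℝ) / 2) : ℝ) : ℂ) := by
    rw [← sq, ← Complex.ofReal_pow]
    rfl
  rw [h1, mul_assoc, ← integral_const_mul]
  congr 1
  refine integral_congr_ae (Eventually.of_forall fun z => ?_)
  change _ * (v (lensScale t • z.1, z.2) * (packet χ t (lensScale t • z.1) * fourier n z.2)) = _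
  simp only
  rw [packet_lensScale_smul ht, lensWeight_eq d ht]
  ring

theorem integral_Lp_mul_packet_eq (f : L2Cylinder d) {t : ℝ} (ht : 1 ≤ t) (n : ℤ) :
    ∫ z, f z * (packet χ t z.1 * fourier n z.2) = ((lensScale t ^ ((d : ℝ) / 2) : ℝ) : ℂ) *
      ∫ z, cylinderLens d t f z * (χ z.1 * fourier n z.2) := by
  rw [integral_mul_packet_eq _ ht]
  congr 1
  refine integral_congr_ae ?_
  filter_upwards [coeFn_cylinderLens d t f] with z hz
  rw [hz]

/-- The nonlinearity commutes with phases and is homogeneous of degree p, so a weight of modulus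
(4πt)^{d/2} passes through it at the price of its (p-1)-st power. This is the source of the exponent
d(p-1)/2. -/
theorem integral_powerNonlinearity_mul_packet_eq (f : L2Cylinder d) {t : ℝ} (ht : 1 ≤ t) (n : ℤ) :
    ∫ z, powerNonlinearity p (f z) * (packet χ t z.1 * fourier n z.2) =
      ((lensScale t ^ ((d : ℝ) / 2) : ℝ) : ℂ) *
        (((lensScale t ^ (-((d : ℝ) / 2 * (p - 1))) : ℝ) : ℂ) *
          ∫ z, powerNonlinearity p (cylinderLens d t f z) * (χ z.1 * fourier n z.2)) := by
  rw [integral_mul_packet_eq (fun z => powerNonlinearity p (f z)) ht]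
  congr 1
  rw [← integral_const_mul]
  refine integral_congr_ae ?_
  filter_upwards [coeFn_cylinderLens d t f] with z hz
  have hc := lensScale_pos t
  rw [hz, powerNonlinearity, powerNonlinearity, norm_mul, norm_lensWeight,
    Real.mul_rpow (Real.rpow_nonneg hc.le _) (norm_nonneg _), ← Real.rpow_mul hc.le,
    Real.rpow_neg hc.le]
  have : ((lensScale t ^ ((d : ℝ) / 2 * (p - 1)) : ℝ) : ℂ) ≠ 0 :=
    Complex.ofReal_ne_zero.2 (Real.rpow_pos_of_pos hc _).ne'
  generalize lensScale t ^ ((d : ℝ) / 2 * (p - 1)) = q at this ⊢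
  push_cast
  field_simp

theorem hasDerivAt_rpow_neg_scale (κ : ℝ) {t : ℝ} (ht : 0 < t) :
    HasDerivAt (fun s : ℝ => (4 * Real.pi * s) ^ (-κ)) (-(κ / t) * (4 * Real.pi * t) ^ (-κ)) t := by
  have hpi := Real.pi_pos
  have h0 : 0 < 4 * Real.pi * t := by positivity
  have h := ((hasDerivAt_id t).const_mul (4 * Real.pi)).rpow_const (p := -κ) (Or.inl h0.ne')
  refine h.congr_deriv ?_
  simp only [id]
  rw [Real.rpow_sub_one h0.ne']
  field_simp

/-- The amplitude of a solution along the wave packets, in the rotating frame of the `n`-th mode. -/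
noncomputable def amplitude (χ : EuclideanSpace ℝ (Fin d) → ℂ) (n : ℤ) (u : ℝ → L2Cylinder d)
    (t : ℝ) : ℂ :=
  fourier (n ^ 2) (t : AddCircle (2 * Real.pi)) *
    ∫ z, cylinderLens d t (u t) z * (χ z.1 * fourier (-n) z.2)

/-- The normalisation (4πt)^{-d/2} cancels the rate d/(2t), and the rotation e^{in²t} cancels the
frequency of the mode. -/
theorem IsNLSSolution.hasDerivAt_amplitude (hu : IsNLSSolution d p u) (hp : 1 < p)
    (hp2 : p ≤ 2) (hχ : ContDiff ℝ ∞ χ) (hχc : HasCompactSupport χ) (n : ℤ) {t : ℝ} (ht : 1 < t) :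
    HasDerivAt (amplitude χ n u)
      (fourier (n ^ 2) (t : AddCircle (2 * Real.pi)) * (-Complex.I *
        (((4 * Real.pi * t) ^ (-((d : ℝ) / 2 * (p - 1))) : ℝ) : ℂ) *
          (∫ z, powerNonlinearity p (cylinderLens d t (u t) z) * (χ z.1 * fourier (-n) z.2)) +
        Complex.I * ((4 * Real.pi * t : ℝ) : ℂ)⁻¹ ^ 2 *
          ∫ z, cylinderLens d t (u t) z * ((Δ χ) z.1 * fourier (-n) z.2))) t := by
  have hpi := Real.pi_pos
  have ht0 : 0 < t := by linarith
  have h0 : 0 < 4 * Real.pi * t := by positivity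
  have hJ := hu.hasDerivAt_integral_packet hp hp2 hχ hχc (-n) ht0
  have hw := (hasDerivAt_rpow_neg_scale ((d : ℝ) / 2) ht0).ofReal_comp
  have hinv : ∀ s : ℝ, 1 ≤ s → (((4 * Real.pi * s) ^ (-((d : ℝ) / 2)) : ℝ) : ℂ) *
      ((lensScale s ^ ((d : ℝ) / 2) : ℝ) : ℂ) = 1 := by
    intro s hs
    rw [lensScale_of_one_le hs, ← Complex.ofReal_mul, ← Real.rpow_add (by positivity)]
    simp
  have hF := (hasDerivAt_fourier_coe (n ^ 2) t).mul (hw.mul hJ)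
  have heq : amplitude χ n u =ᶠ[𝓝 t] fun s => fourier (n ^ 2) (s : AddCircle (2 * Real.pi)) *
      ((((4 * Real.pi * s) ^ (-((d : ℝ) / 2)) : ℝ) : ℂ) *
        ∫ z, u s z * (packet χ s z.1 * fourier (-n) z.2)) := by
    -- The strict inequality 1 < t leaves a whole neighbourhood on which the dilation factor is 4πs.
    filter_upwards [lt_mem_nhds ht] with s hs
    rw [integral_Lp_mul_packet_eq _ hs.le, ← mul_assoc (((_ : ℝ) : ℂ)), hinv s hs.le, one_mul,
      amplitude]
  refine (hF.congr_of_eventuallyEq heq).congr_deriv ?_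
  simp only [Pi.mul_apply]
  rw [integral_Lp_mul_packet_eq _ ht.le, integral_Lp_mul_packet_eq _ ht.le,
    integral_powerNonlinearity_mul_packet_eq _ ht.le]
  rw [lensScale_of_one_le ht.le]
  have hinv' := hinv t ht.le
  rw [lensScale_of_one_le ht.le] at hinv'
  have ht' : (t : ℂ) ≠ 0 := Complex.ofReal_ne_zero.2 ht0.ne'
  generalize ∫ z, powerNonlinearity p (cylinderLens d t (u t) z) * (χ z.1 * fourier (-n) z.2) = N
  generalize ∫ z, cylinderLens d t (u t) z * (χ z.1 * fourier (-n) z.2) = P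
  generalize ∫ z, cylinderLens d t (u t) z * ((Δ χ) z.1 * fourier (-n) z.2) = L
  rw [Complex.ofReal_mul (-((d : ℝ) / 2 / t))]
  generalize (((4 * Real.pi * t) ^ (-((d : ℝ) / 2)) : ℝ) : ℂ) = w at hinv' ⊢
  generalize (((4 * Real.pi * t) ^ ((d : ℝ) / 2) : ℝ) : ℂ) = a at hinv' ⊢
  generalize (((4 * Real.pi * t) ^ (-((d : ℝ) / 2 * (p - 1))) : ℝ) : ℂ) = q
  generalize ((4 * Real.pi * t : ℝ) : ℂ)⁻¹ = c
  generalize fourier (n ^ 2) (t : AddCircle (2 * Real.pi)) = e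
  push_cast
  linear_combination (e * (-Complex.I * q * N + Complex.I * c ^ 2 * L)) * hinv'

end

/-! ### Free solutions in the lens picture -/

section

variable {d : ℕ}

/-- Read off from the convergence of the propagator series at time 0, since phases and propagators
preserve the norm of each mode. -/
theorem summable_norm_modeCoefficient_sq (h : L2Cylinder d) :
    Summable fun n => ‖modeCoefficient d n h‖ ^ 2 := by
  have := ((orthogonalFamily_modeEmbedding d).summable_iff_norm_sq_summable _).1
    (summable_cylinderPropagator d 0 h)
  simpa only [norm_smul, Complex.norm_exp_ofReal_mul_I, one_mul, norm_euclideanPropagator]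
    using this

/-- The Fourier modes of the asymptotic profile of the free solution `e^{itΔ} h`. -/
noncomputable def profileMode (h : L2Cylinder d) (n : ℤ) : L2Euclidean d :=
  lensPhase d • 𝓕 (modeCoefficient d n h)

theorem norm_profileMode (h : L2Cylinder d) (n : ℤ) :
    ‖profileMode h n‖ = ‖lensPhase d‖ * ‖modeCoefficient d n h‖ := by
  rw [profileMode, norm_smul, Lp.norm_fourier_eq]

theorem summable_norm_profileMode_sq (h : L2Cylinder d) :
    Summable fun n => ‖profileMode h n‖ ^ 2 := by
  simp only [norm_profileMode, mul_pow]
  exact (summable_norm_modeCoefficient_sq h).mul_left _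

theorem fourier_neg_sq_coe (n : ℤ) (t : ℝ) :
    (fourier (-n ^ 2) (t : AddCircle (2 * Real.pi)) : ℂ) =
      Complex.exp ((-(t * (n : ℝ) ^ 2) : ℝ) * Complex.I) := by
  rw [fourier_coe_apply]
  congr 1
  have : (Real.pi : ℂ) ≠ 0 := Complex.ofReal_ne_zero.2 Real.pi_ne_zero
  push_cast
  field_simp

/-- The phase e^{-itn²} is common to both sides and factors out of each mode, which leaves the
Euclidean asymptotics. Isometry gives the time-independent square-summable bound needed to sum over
the modes. -/
theorem tendsto_cylinderLens_cylinderPropagator (h : L2Cylinder d) :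
    Tendsto (fun t : ℝ => ‖cylinderLens d t (cylinderPropagator d t h) -
      profile (profileMode h) (t : AddCircle (2 * Real.pi))‖) atTop (𝓝 0) := by
  have hlim := tendsto_norm_tsum_modeEmbedding_zero (d := d) (l := (atTop : Filter ℝ))
    (e := fun t n => Complex.exp ((-(t * (n : ℝ) ^ 2) : ℝ) * Complex.I) •
      (euclideanLens d t (euclideanPropagator d t (modeCoefficient d n h)) - profileMode h n))
    (b := fun n => (1 + ‖lensPhase d‖) * ‖modeCoefficient d n h‖)
    (by simpa only [mul_pow] using (summable_norm_modeCoefficient_sq h).mul_left _)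
    (fun n => by
      rw [tendsto_zero_iff_norm_tendsto_zero]
      simp only [norm_smul, Complex.norm_exp_ofReal_mul_I, one_mul]
      exact tendsto_euclideanLens_propagator d (modeCoefficient d n h))
    (fun t n => by
      rw [norm_smul, Complex.norm_exp_ofReal_mul_I, one_mul]
      refine (norm_sub_le _ _).trans (le_of_eq ?_)
      rw [LinearIsometry.norm_map, norm_euclideanPropagator, norm_profileMode]
      ring)
  refine hlim.congr fun t => ?_
  have h1 : cylinderLens d t (cylinderPropagator d t h) = ∑' n : ℤ, modeEmbedding d n
      (Complex.exp ((-(t * (n : ℝ) ^ 2) : ℝ) * Complex.I) •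
        euclideanLens d t (euclideanPropagator d t (modeCoefficient d n h))) := by
    have := (cylinderLens d t).toContinuousLinearMap.map_tsum (summable_cylinderPropagator d t h)
    refine this.trans (tsum_congr fun n => ?_)
    rw [LinearIsometry.coe_toContinuousLinearMap, cylinderLens_modeEmbedding, map_smul]
  have hs : Summable fun n : ℤ => ‖Complex.exp ((-(t * (n : ℝ) ^ 2) : ℝ) * Complex.I) •
      euclideanLens d t (euclideanPropagator d t (modeCoefficient d n h))‖ ^ 2 := by
    simpa only [norm_smul, Complex.norm_exp_ofReal_mul_I, one_mul, LinearIsometry.norm_map,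
      norm_euclideanPropagator] using summable_norm_modeCoefficient_sq h
  rw [h1, profile, ← tsum_modeEmbedding_sub hs
    (summable_norm_sq_fourier_smul (summable_norm_profileMode_sq h) _)]
  simp only [fourier_neg_sq_coe, smul_sub]

end

/-! ### A drift argument -/

/-- If a bounded function has the derivative `(4πt)^{-α} G(t)` with `α ≤ 1`, and `G` is asymptotic to
a periodic function, then this function has mean zero. -/
theorem integral_eq_zero_of_bounded_of_hasDerivAt {f G H : ℝ → ℂ} {α M : ℝ} (hα0 : 0 ≤ α)
    (hα1 : α ≤ 1)
    (hf : ∀ t, 1 < t → HasDerivAt f ((((4 * Real.pi * t) ^ (-α) : ℝ) : ℂ) * G t) t)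
    (hM : ∀ t, 1 < t → ‖f t‖ ≤ M) (hH : Continuous H) (hper : Function.Periodic H (2 * Real.pi))
    (hGH : Tendsto (fun t => G t - H t) atTop (𝓝 0)) : ∫ t in (0 : ℝ)..2 * Real.pi, H t = 0 := by
  by_contra hne
  have hpi := Real.pi_pos
  set m : ℂ := (∫ t in (0 : ℝ)..2 * Real.pi, H t) / ((2 * Real.pi : ℝ) : ℂ) with hm
  have hm0 : m ≠ 0 := div_ne_zero hne (Complex.ofReal_ne_zero.2 (by positivity))
  have hmpos : 0 < ‖m‖ := norm_pos_iff.2 hm0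
  have hHm : Continuous fun t => H t - m := hH.sub continuous_const
  -- A primitive of H - m is periodic, hence bounded. Subtracting wΨ from f removes the oscillation
  -- of H and keeps its mean m.
  set Ψ : ℝ → ℂ := fun t => ∫ s in (0 : ℝ)..t, (H s - m) with hΨ
  have hΨd : ∀ t, HasDerivAt Ψ (H t - m) t := fun t =>
    intervalIntegral.integral_hasDerivAt_right (hHm.intervalIntegrable _ _)
      (hHm.stronglyMeasurableAtFilter _ _) hHm.continuousAt
  have hmean : ∫ s in (0 : ℝ)..2 * Real.pi, (H s - m) = 0 := by
    rw [intervalIntegral.integral_sub (hH.intervalIntegrable _ _)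
      (continuous_const.intervalIntegrable _ _), intervalIntegral.integral_const, sub_zero,
      Complex.real_smul, hm, mul_div_cancel₀ _ (Complex.ofReal_ne_zero.2 (by positivity)),
      sub_self]
  have hΨper : Function.Periodic Ψ (2 * Real.pi) := by
    intro t
    have hp' : Function.Periodic (fun s => H s - m) (2 * Real.pi) := fun s => by
      simp only [hper s]
    have h1 := hp'.intervalIntegral_add_eq t 0
    rw [zero_add, hmean] at h1
    have h2 := intervalIntegral.integral_add_adjacent_intervals (a := 0) (b := t)
      (c := t + 2 * Real.pi) (hHm.intervalIntegrable (μ := volume) _ _)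
      (hHm.intervalIntegrable _ _)
    rw [h1, add_zero] at h2
    exact h2.symm
  have hΨc : Continuous Ψ := continuous_iff_continuousAt.2 fun t => (hΨd t).continuousAt
  obtain ⟨B, hB⟩ : ∃ B, ∀ t, ‖Ψ t‖ ≤ B := by
    obtain ⟨B, hB⟩ := (hΨper.isBounded_of_continuous (by positivity) hΨc).exists_norm_le
    exact ⟨B, fun t => hB _ ⟨t, rfl⟩⟩
  set w : ℝ → ℝ := fun t => (4 * Real.pi * t) ^ (-α) with hw
  have hx : ∀ t : ℝ, 1 < t → 1 ≤ 4 * Real.pi * t := fun t ht => by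
    nlinarith [Real.pi_gt_three]
  have hw0 : ∀ t, 1 < t → 0 < w t := fun t ht =>
    Real.rpow_pos_of_pos (by linarith [hx t ht]) _
  have hw1 : ∀ t, 1 < t → w t ≤ 1 := fun t ht =>
    Real.rpow_le_one_of_one_le_of_nonpos (hx t ht) (by linarith)
  have hwl : ∀ t, 1 < t → 1 / (4 * Real.pi * t) ≤ w t := fun t ht => by
    rw [one_div, ← Real.rpow_neg_one]
    exact Real.rpow_le_rpow_of_exponent_le (hx t ht) (by linarith)
  -- With this error, (f - wΨ)' = w(m + E); the term α/t comes from differentiating w.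
  set E : ℝ → ℂ := fun t => (G t - H t) + ((α / t : ℝ) : ℂ) * Ψ t with hE
  have hE0 : Tendsto E atTop (𝓝 0) := by
    have h1 : Tendsto (fun t : ℝ => ((α / t : ℝ) : ℂ) * Ψ t) atTop (𝓝 0) := by
      have h2 : Tendsto (fun t : ℝ => |α / t| * B) atTop (𝓝 0) := by
        have h3 : Tendsto (fun t : ℝ => α / t) atTop (𝓝 0) := tendsto_const_nhds.div_atTop tendsto_id
        simpa using h3.abs.mul_const B
      refine squeeze_zero_norm (fun t => ?_) h2
      rw [norm_mul, Complex.norm_real, Real.norm_eq_abs]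
      exact mul_le_mul_of_nonneg_left (hB t) (abs_nonneg _)
    have h2 := hGH.add h1
    rwa [add_zero] at h2
  have hsmall : ∀ᶠ t in atTop, ‖E t‖ ≤ ‖m‖ / 2 := by
    have := hE0.norm
    rw [norm_zero] at this
    exact (this.eventually_lt_const (by positivity)).mono fun t ht => ht.le
  obtain ⟨T, hT1, hT⟩ : ∃ T, 1 < T ∧ ∀ t, T ≤ t → ‖E t‖ ≤ ‖m‖ / 2 := by
    obtain ⟨T, hT⟩ := eventually_atTop.1 hsmall
    exact ⟨max T 2, lt_max_of_lt_right (by norm_num), fun t ht => hT t ((le_max_left _ _).trans ht)⟩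
  set g : ℝ → ℝ := fun t => ((starRingEnd ℂ) m * (f t - (w t : ℂ) * Ψ t)).re with hg
  have hgd : ∀ t, 1 < t → HasDerivAt g (w t * (‖m‖ ^ 2 + ((starRingEnd ℂ) m * E t).re)) t := by
    intro t ht
    have ht0 : (0 : ℝ) < t := by linarith
    have h1 := ((hf t ht).sub ((hasDerivAt_rpow_neg_scale α ht0).ofReal_comp.mul (hΨd t))).const_mul
      ((starRingEnd ℂ) m)
    have h2 := Complex.reCLM.hasFDerivAt.comp_hasDerivAt t h1
    refine h2.congr_deriv ?_
    have h3 : (starRingEnd ℂ) m * ((((4 * Real.pi * t) ^ (-α) : ℝ) : ℂ) * G t -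
        (((-(α / t) * (4 * Real.pi * t) ^ (-α) : ℝ) : ℂ) * Ψ t +
          (((4 * Real.pi * t) ^ (-α) : ℝ) : ℂ) * (H t - m))) =
        ((w t : ℝ) : ℂ) * (((‖m‖ ^ 2 : ℝ) : ℂ) + (starRingEnd ℂ) m * E t) := by
      rw [Complex.ofReal_pow, ← Complex.conj_mul', hE, hw]
      push_cast
      ring
    rw [h3, Complex.reCLM_apply, Complex.re_ofReal_mul, Complex.add_re, Complex.ofReal_re]
  -- Once ‖E‖ ≤ ‖m‖/2, g' ≥ w‖m‖²/2 ≥ ‖m‖²/(8πt) = κ/t, the second inequality because α ≤ 1. So g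
  -- grows at least like κ log t, although it is bounded.
  set κ : ℝ := ‖m‖ ^ 2 / (8 * Real.pi) with hκ
  have hκ0 : 0 < κ := by positivity
  have hmono : MonotoneOn (fun t => g t - κ * Real.log t) (Ici T) := by
    have hd : ∀ t, T ≤ t → HasDerivAt (fun t => g t - κ * Real.log t)
        (w t * (‖m‖ ^ 2 + ((starRingEnd ℂ) m * E t).re) - κ * t⁻¹) t := fun t ht =>
      (hgd t (by linarith)).sub ((Real.hasDerivAt_log (by linarith)).const_mul κ)
    refine monotoneOn_of_deriv_nonneg (convex_Ici T)
      (fun t ht => (hd t ht).continuousAt.continuousWithinAt)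
      (fun t ht => (hd t (interior_subset ht)).differentiableAt.differentiableWithinAt)
      fun t ht => ?_
    have ht' : T ≤ t := interior_subset ht
    have ht1 : 1 < t := by linarith
    rw [(hd t ht').deriv]
    have h1 : -(‖m‖ * (‖m‖ / 2)) ≤ ((starRingEnd ℂ) m * E t).re := by
      have h2 := (abs_le.1 (Complex.abs_re_le_norm ((starRingEnd ℂ) m * E t))).1
      rw [norm_mul, RCLike.norm_conj] at h2
      have h3 := mul_le_mul_of_nonneg_left (hT t ht') hmpos.le
      linarith
    have h4 : κ * t⁻¹ = 1 / (4 * Real.pi * t) * (‖m‖ ^ 2 / 2) := by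
      have : t ≠ 0 := by linarith
      rw [hκ]
      field_simp
      norm_num
    have h5 : 1 / (4 * Real.pi * t) * (‖m‖ ^ 2 / 2) ≤ w t * (‖m‖ ^ 2 / 2) :=
      mul_le_mul_of_nonneg_right (hwl t ht1) (by positivity)
    have h6 : w t * (‖m‖ ^ 2 / 2) ≤ w t * (‖m‖ ^ 2 + ((starRingEnd ℂ) m * E t).re) :=
      mul_le_mul_of_nonneg_left (by nlinarith) (hw0 t ht1).le
    linarith
  have hgb : ∀ t, 1 < t → |g t| ≤ ‖m‖ * (M + B) := by
    intro t ht
    refine (Complex.abs_re_le_norm _).trans ?_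
    rw [norm_mul, RCLike.norm_conj]
    refine mul_le_mul_of_nonneg_left ((norm_sub_le _ _).trans (add_le_add (hM t ht) ?_)) hmpos.le
    rw [norm_mul, Complex.norm_real, Real.norm_of_nonneg (hw0 t ht).le]
    exact (mul_le_of_le_one_left (norm_nonneg _) (hw1 t ht)).trans (hB t)
  have hbd : ∀ t, T ≤ t → Real.log t ≤ (2 * (‖m‖ * (M + B)) + κ * Real.log T) / κ := by
    intro t ht
    have h1 := hmono (mem_Ici.2 le_rfl) (mem_Ici.2 ht) ht
    have h2 := (abs_le.1 (hgb t (by linarith))).2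
    have h3 := (abs_le.1 (hgb T hT1)).1
    simp only at h1
    rw [le_div_iff₀ hκ0]
    linarith
  obtain ⟨t, ht1, ht2⟩ := ((Real.tendsto_log_atTop.eventually_gt_atTop
    ((2 * (‖m‖ * (M + B)) + κ * Real.log T) / κ)).and (eventually_ge_atTop T)).exists
  exact absurd (hbd t ht2) (not_le.2 ht1)

/-! ### Absence of scattering -/

section

variable {d : ℕ} {p : ℝ} {u : ℝ → L2Cylinder d}

/-- The drift argument applied to the amplitude. Conservation of mass bounds the amplitude, and it
also bounds the norms in the local Lipschitz estimate that replaces the solution by the profile. The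
condition p ≤ 1 + 2/d is exactly α ≤ 1. -/
theorem IsNLSSolution.integral_powerNonlinearity_profile_eq_zero (hd : 1 ≤ d)
    (hu : IsNLSSolution d p u) (hp : 1 < p) (hp2 : p ≤ 2) (hp_long : p ≤ 1 + 2 / (d : ℝ))
    {a : ℤ → L2Euclidean d} (ha : Summable fun n => ‖a n‖ ^ 2)
    (hclose : Tendsto (fun t : ℝ => ‖cylinderLens d t (u t) -
      profile a (t : AddCircle (2 * Real.pi))‖) atTop (𝓝 0))
    {χ : EuclideanSpace ℝ (Fin d) → ℂ} (hχ : ContDiff ℝ ∞ χ) (hχc : HasCompactSupport χ) (n : ℤ) :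
    ∫ τ, (∫ z, powerNonlinearity p (profile a τ z) * (χ z.1 * fourier (-n) z.2)) *
      fourier (n ^ 2) τ = 0 := by
  have hpi := Real.pi_pos
  have hd0 : (0 : ℝ) < d := by exact_mod_cast hd
  set α : ℝ := (d : ℝ) / 2 * (p - 1) with hα
  have hα0 : 0 ≤ α := mul_nonneg (by positivity) (by linarith)
  have hα1 : α ≤ 1 := by
    have h1 : p - 1 ≤ 2 / d := by linarith
    calc α ≤ (d : ℝ) / 2 * (2 / d) := by rw [hα]; gcongr
      _ = 1 := by field_simp
  set U : ℝ → L2Cylinder d := fun t => cylinderLens d t (u t) with hU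
  have hUn : ∀ t, ‖U t‖ = ‖u 0‖ := fun t => by
    rw [hU, LinearIsometry.norm_map]
    exact hu.norm_eq hp hp2 t 0
  set ψ : Cylinder d → ℂ := fun z => χ z.1 * fourier (-n) z.2 with hψ
  have hψc : Continuous ψ := continuous_mul_fourier hχ.continuous (-n)
  have hψcs : HasCompactSupport ψ := hasCompactSupport_mul_snd _ hχc
  have hψm : MemLp ψ 2 volume := memLp_mul_fourier hχ.continuous hχc (-n)
  have hΔm := memLp_mul_fourier (continuous_laplacian hχ) (hasCompactSupport_laplacian hχc) (-n)
  set K : AddCircle (2 * Real.pi) → ℂ := fun τ =>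
    (∫ z, powerNonlinearity p (profile a τ z) * ψ z) * fourier (n ^ 2) τ with hK
  have hKc : Continuous K :=
    ((continuous_integral_powerNonlinearity_mul hp hp2 hψc hψcs).comp (continuous_profile ha)).mul
      (fourier (n ^ 2)).continuous
  have hcoe : Continuous fun t : ℝ => (t : AddCircle (2 * Real.pi)) :=
    AddCircle.continuous_mk' (2 * Real.pi)
  set L : ℝ → ℂ := fun t => ∫ z, U t z * ((Δ χ) z.1 * fourier (-n) z.2) with hL
  -- The error t^{-2} is written as t^{-α} t^{α-2}; as α < 2, it becomes an o(1) contribution to G.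
  have key := integral_eq_zero_of_bounded_of_hasDerivAt (f := amplitude χ n u)
    (G := fun t => fourier (n ^ 2) (t : AddCircle (2 * Real.pi)) *
      (-Complex.I * (∫ z, powerNonlinearity p (U t z) * ψ z) +
        Complex.I * (((4 * Real.pi * t) ^ (α - 2) : ℝ) : ℂ) * L t))
    (H := fun t => -Complex.I * K (t : AddCircle (2 * Real.pi))) hα0 hα1
    (M := ‖u 0‖ * (eLpNorm ψ 2 volume).toReal)
    (fun t ht => by
      have h0 : 0 < 4 * Real.pi * t := by positivity
      refine (hu.hasDerivAt_amplitude hp hp2 hχ hχc n ht).congr_deriv ?_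
      have h1 : (((4 * Real.pi * t) ^ (-α) : ℝ) : ℂ) * (((4 * Real.pi * t) ^ (α - 2) : ℝ) : ℂ) =
          ((4 * Real.pi * t : ℝ) : ℂ)⁻¹ ^ 2 := by
        rw [← Complex.ofReal_mul, ← Real.rpow_add h0, ← Complex.ofReal_inv, ← Complex.ofReal_pow]
        congr 1
        rw [show -α + (α - 2) = -((2 : ℕ) : ℝ) by push_cast; ring, Real.rpow_neg h0.le,
          Real.rpow_natCast, inv_pow]
      rw [← h1]
      ring)
    (fun t _ => by
      rw [amplitude, norm_mul, fourier_apply, Circle.norm_coe, one_mul]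
      exact (norm_integral_Lp_mul_le hψm _).trans_eq (by rw [← hUn t]))
    (continuous_const.mul (hKc.comp hcoe))
    (fun t => by simp only [AddCircle.coe_add_period])
    (by
      obtain ⟨C, hC0, hC⟩ := exists_norm_integral_powerNonlinearity_sub_le
        (μ := (volume : Measure (Cylinder d))) hp hp2 hψc hψcs
      set B := ‖u 0‖ * (eLpNorm (fun z : Cylinder d => (Δ χ) z.1 * fourier (-n) z.2) 2
        volume).toReal with hB
      have h1 : Tendsto (fun t : ℝ => C * (1 + ‖u 0‖ + Real.sqrt (∑' n, ‖a n‖ ^ 2)) *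
          ‖U t - profile a (t : AddCircle (2 * Real.pi))‖ + (4 * Real.pi * t) ^ (α - 2) * B) atTop
          (𝓝 (C * (1 + ‖u 0‖ + Real.sqrt (∑' n, ‖a n‖ ^ 2)) * 0 + 0 * B)) := by
        refine (hclose.const_mul _).add (Tendsto.mul_const _ ?_)
        have h2 : Tendsto (fun t : ℝ => 4 * Real.pi * t) atTop atTop :=
          tendsto_id.const_mul_atTop (by positivity)
        have h3 := (tendsto_rpow_neg_atTop (y := 2 - α) (by linarith)).comp h2
        rw [neg_sub] at h3
        exact h3
      rw [mul_zero, zero_mul, add_zero] at h1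
      refine squeeze_zero_norm' ?_ h1
      filter_upwards [eventually_gt_atTop 0] with t ht
      have h0 : 0 < 4 * Real.pi * t := by positivity
      have e : fourier (n ^ 2) (t : AddCircle (2 * Real.pi)) *
          (-Complex.I * (∫ z, powerNonlinearity p (U t z) * ψ z) +
            Complex.I * (((4 * Real.pi * t) ^ (α - 2) : ℝ) : ℂ) * L t) -
          -Complex.I * K (t : AddCircle (2 * Real.pi)) =
          fourier (n ^ 2) (t : AddCircle (2 * Real.pi)) *
          (-Complex.I * ((∫ z, powerNonlinearity p (U t z) * ψ z) -
            ∫ z, powerNonlinearity p (profile a (t : AddCircle (2 * Real.pi)) z) * ψ z) +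
            Complex.I * ((((4 * Real.pi * t) ^ (α - 2) : ℝ) : ℂ) * L t)) := by
        rw [hK]
        ring
      rw [e, norm_mul, fourier_apply, Circle.norm_coe, one_mul]
      refine (norm_add_le _ _).trans (add_le_add ?_ ?_)
      · rw [norm_mul, norm_neg, Complex.norm_I, one_mul]
        have h2 := hC (U t) (profile a (t : AddCircle (2 * Real.pi)))
        rwa [hUn, norm_profile ha] at h2
      · rw [norm_mul, Complex.norm_I, one_mul, norm_mul, Complex.norm_real,
          Real.norm_of_nonneg (Real.rpow_nonneg h0.le _)]
        refine mul_le_mul_of_nonneg_left ?_ (Real.rpow_nonneg h0.le _)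
        exact (norm_integral_Lp_mul_le hΔm (U t)).trans_eq (by rw [hUn t]))
  rw [intervalIntegral.integral_const_mul] at key
  have h1 := AddCircle.intervalIntegral_preimage (2 * Real.pi) 0 K
  rw [zero_add] at h1
  rw [h1] at key
  exact (mul_eq_zero.1 key).resolve_left (neg_ne_zero.2 Complex.I_ne_zero)

end

theorem theorem2p1 (d : ℕ) (hd : 1 ≤ d) (p : ℝ) (hp : 1 < p) (hp_two : p ≤ 2)
    (hp_long : p ≤ 1 + 2 / (d : ℝ)) (u : ℝ → L2Cylinder d) (hu : IsNLSSolution d p u)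
    (hu_ne : u ≠ 0) (h : L2Cylinder d) :
    ¬ Tendsto (fun t : ℝ => ‖u t - cylinderPropagator d t h‖) atTop (𝓝 0) := by
  intro hscat
  have ha := summable_norm_profileMode_sq h
  have hclose : Tendsto (fun t : ℝ => ‖cylinderLens d t (u t) -
      profile (profileMode h) (t : AddCircle (2 * Real.pi))‖) atTop (𝓝 0) := by
    have h1 := hscat.add (tendsto_cylinderLens_cylinderPropagator h)
    rw [add_zero] at h1
    refine squeeze_zero (fun _ => norm_nonneg _) (fun t => ?_) h1
    rw [← LinearIsometry.norm_map (cylinderLens d t) (u t - cylinderPropagator d t h), map_sub]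
    exact norm_sub_le_norm_sub_add_norm_sub _ _ _
  have hzero : ∀ n, profileMode h n = 0 :=
    eq_zero_of_forall_integral_powerNonlinearity_profile hp hp_two ha fun χ hχ hχc n =>
      hu.integral_powerNonlinearity_profile_eq_zero hd hp hp_two hp_long ha hclose
        (Complex.ofRealCLM.contDiff.comp hχ) (hχc.comp_left Complex.ofReal_zero) n
  have hprofile : ∀ τ, profile (profileMode h) τ = 0 := fun τ => by
    have h1 := norm_profile_sq ha τ
    simpa [hzero] using h1
  -- With a vanishing profile the asymptotics say that ‖u t‖ → 0, while this norm is constant in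
  -- time.
  simp only [hprofile, sub_zero, LinearIsometry.norm_map] at hclose
  have hu0 : ‖u 0‖ = 0 := by
    refine tendsto_nhds_unique ?_ hclose
    simp only [fun t => hu.norm_eq hp hp_two t 0]
    exact tendsto_const_nhds
  refine hu_ne (funext fun t => ?_)
  rw [Pi.zero_apply, ← norm_eq_zero, hu.norm_eq hp hp_two t 0, hu0]
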